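/- Let $G$ be an infinite connected graph of bounded degree. For $p\in[0,1]$ let $\pi_p$ be Bernoulli bond percolation on $G$ (each edge is open with probability $p$ and closed otherwise, independently), and let $p_c(G)=\sup\{p\in[0,1]:\pi_p(\text{there is an infinite open cluster})=0\}$. In dynamical percolation with parameter $p$, the edges of $G$ evolve as independent stationary two-state continuous-time Markov chains, started from $\pi_p$, in which closed switches to open at rate $p$ and open switches to closed at rate $1-p$ (equivalently, the status of each edge is refreshed to a new independent Bernoulli($p$) value at the rings of an independent rate $1$ Poisson clock); by convention an edge counts as open at the times at which it changes state. Write $\Psi_p$ for the law of this process and $\mathcal C_t$, $t\ge 0$, for the event that there is an infinite cluster of open edges at time $t$. **Theorem 1.1.** (i) There is an infinite connected bounded-degree graph $G$ with $0<p_c(G)<1$ which, at criticality, percolates at all times: $$\Psi_{p_c}\bigl(\mathcal C_t\text{ occurs for all }t\ge 0\bigr)=1.$$ (ii) There is an infinite connected bounded-degree graph $G$ with $0<p_c(G)<1$ which percolates at criticality at a fixed time, i.e. $\pi_{p_c}(\text{there is an infinite open cluster})=1$, but has exceptional times of nonpercolation: $$\Psi_{p_c}\bigl(\neg\,\mathcal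 C_t\text{ occurs for some }t\ge 0\bigr)=1.$$ -/

import Mathlib

open MeasureTheory ProbabilityTheory
open scoped unitInterval

namespace Percolation

/-- There is a uniform finite upper bound for the vertex degrees of `G`. -/
def BoundedDegree {V : Type} (G : SimpleGraph V) : Prop :=
  ∃ D : ℕ, ∀ v : V, (G.neighborSet v).encard ≤ D

/-- The random subgraph: all vertices of `G`, and exactly those edges of `G` that lie in the set
`S` of open edges. -/
def openSubgraph {V : Type} (G : SimpleGraph V) (S : Set G.edgeSet) : SimpleGraph V :=
  SimpleGraph.fromEdgeSet (Subtype.val '' S)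

/-- The event that some connected component (cluster) of the open subgraph is infinite. -/
def HasInfiniteCluster {V : Type} (G : SimpleGraph V) (S : Set G.edgeSet) : Prop :=
  ∃ c : (openSubgraph G S).ConnectedComponent, c.supp.Infinite

/-- The law of the status of one edge: `true` (open) with probability `p`, `false` (closed) with
probability `1 - p`. -/
noncomputable def edgeLaw (p : I) : Measure Bool :=
  bernoulliMeasure true false p

instance (p : I) : IsProbabilityMeasure (edgeLaw p) := by
  unfold edgeLaw; infer_instance

/-- Bernoulli(`p`) bond percolation on `G`: the statuses of the edges are independent. -/
noncomputable def bondMeasure {V : Type} (G : SimpleGraph V) (p : I) :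
    Measure (G.edgeSet → Bool) :=
  Measure.infinitePi fun _ => edgeLaw p

instance {V : Type} (G : SimpleGraph V) (p : I) : IsProbabilityMeasure (bondMeasure G p) := by
  unfold bondMeasure; infer_instance

/-- The set of open edges of a configuration. -/
def openEdges {V : Type} {G : SimpleGraph V} (η : G.edgeSet → Bool) : Set G.edgeSet :=
  {e | η e = true}

/-- The event that a static percolation configuration has an infinite cluster. -/
def percolates {V : Type} (G : SimpleGraph V) : Set (G.edgeSet → Bool) :=
  {η | HasInfiniteCluster G (openEdges η)}

/-- The critical probability `sup {p ∈ [0,1] : there is a.s. no infinite cluster at p}`.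
(The supremum is taken in `[0,1]`; the set always contains `0`.) -/
noncomputable def criticalProb {V : Type} (G : SimpleGraph V) : I :=
  sSup {p : I | bondMeasure G p (percolates G) = 0}

/-- One step of the refresh process of an edge: a waiting time and a new status, independent of
each other; the waiting time is exponential of rate `1`, the status is open with
probability `p`. -/
noncomputable def stepLaw (p : I) : Measure (ℝ × Bool) :=
  (expMeasure 1).prod (edgeLaw p)

instance (p : I) : IsProbabilityMeasure (stepLaw p) := by
  have : IsProbabilityMeasure (expMeasure 1) := isProbabilityMeasure_expMeasure one_pos
  unfold stepLaw; infer_instance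

/-- Sample points of dynamical percolation on `G`. For an edge `e` and `n : ℕ`, `(ω e n).2` is
the status of `e` after its `n`-th refresh (its initial status if `n = 0`), and `(ω e n).1` is the
time that elapses from then until the next refresh of `e`. -/
abbrev History {V : Type} (G : SimpleGraph V) : Type := G.edgeSet → ℕ → ℝ × Bool

/-- The law of dynamical percolation with parameter `p` on `G`, started in stationarity: every
edge has its own independent rate `1` Poisson clock, and when the clock rings the status is
replaced by a fresh Bernoulli(`p`) one. So the edges are independent stationary two-state Markov
chains which switch from closed to open at rate `p` and from open to closed at rate `1 - p`. -/
noncomputable def dynMeasure {V : Type} (G : SimpleGraph V) (p : I) : Measure (History G) :=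
  Measure.infinitePi fun _ => Measure.infinitePi fun _ => stepLaw p

instance {V : Type} (G : SimpleGraph V) (p : I) : IsProbabilityMeasure (dynMeasure G p) := by
  unfold dynMeasure; infer_instance

/-- The time of the `n`-th refresh of the edge `e`; `0` for `n = 0`. -/
noncomputable def refreshTime {V : Type} {G : SimpleGraph V} (ω : History G) (e : G.edgeSet)
    (n : ℕ) : ℝ :=
  ∑ i ∈ Finset.range n, (ω e i).1

/-- The set of edges that are open at time `t`. Between its `n`-th and its `(n+1)`-st refresh an
edge has the status `(ω e n).2`; the intervals are closed at both ends, so that an edge counts as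
open at the times at which it changes state. -/
def openEdgesAt {V : Type} {G : SimpleGraph V} (ω : History G) (t : ℝ) : Set G.edgeSet :=
  {e | ∃ n : ℕ, (ω e n).2 = true ∧ refreshTime ω e n ≤ t ∧ t ≤ refreshTime ω e (n + 1)}

/-- The event that there is an infinite cluster of open edges at time `t`. -/
def percolatesAt {V : Type} (G : SimpleGraph V) (t : ℝ) : Set (History G) :=
  {ω | HasInfiniteCluster G (openEdgesAt ω t)}

end Percolation

/-!
The graphs of both parts belong to one family, `chainGraph a`: a chain of *gaps* separated by
*hubs*. The `n`-th gap consists of `2 ^ a n` disjoint parallel *items*, an item being a bottleneck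
edge with a binary tree hanging at each end. The leaves of these trees are matched, through paths
of their own, with those of the trees on the other side of the hub, in such a way that any two
trees that meet at a hub are joined by a huge number of disjoint paths. Every path to infinity
crosses all but finitely many gaps, so percolation fails if infinitely many gaps are closed
(`not_exists_infinite_component`), and it holds if all gaps and hubs from some point on are open
(`exists_infinite_component`). A gap is closed if no item joins its two sides, and open if some item
does so with trees that have grown large; the probability that a gap is not open is of the same
order as the probability that it is closed, and the hubs connect such trees with overwhelming
probability. So everything depends on the gaps.

An item of a gap with `2 ^ k` items is closed with a probability `deadProb p k` which is strictly
decreasing in `p`, so at `p = crit` the gap is closed with probability `critDead k ^ 2 ^ k`, while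
at `p < crit` this probability is larger by a factor that is exponentially large in `2 ^ k`. Let
`a = gapSeq β`: the number of gaps with `2 ^ k` items is about `β ^ (-k) * critDead k ^ (-2 ^ k)`.
Then `∑ γ ^ a n * critDead (a n) ^ 2 ^ a n` converges for `γ < β` (`summable_gapSeq`) and diverges
for `γ = β` (`not_summable_gapSeq`), and the Borel-Cantelli lemmas show, for `1 < β ≤ 4`, that
`crit` is the critical probability and that there is percolation at it (`criticalProb_chainGraph`,
`ae_mem_percolates`).

In dynamical percolation the number of chances that a gap with `2 ^ k` items has to close during a
unit of time is of order `2 ^ k`, the number of its bottleneck edges, each of which is refreshed at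
rate `1`.

* For `β = 4`, cover a unit of time by `2 ^ k` windows of length `2 ^ (-k)`. The edges that are open
  throughout a window form a Bernoulli set of density at least `crit - 2 ^ (-k)`, and this is so
  close to `crit` that a gap is open in it except with a probability of order
  `critDead k ^ 2 ^ k`. As `∑ 2 ^ a n * critDead (a n) ^ 2 ^ a n` is finite, almost surely all
  but finitely many gaps are open at all times of a bounded interval (`ae_forall_percolatesAt`).
* For `β = 2`, inspect the gap at times whose distances are a large multiple of `2 ^ (-k)`. The
  events that it is closed at these times are so weakly correlated that the Bonferroni inequality
  applies (`le_dynMeasure_exists_gapClosed`), and as the gaps are independent and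
  `∑ 2 ^ a n * critDead (a n) ^ 2 ^ a n` is infinite, in every time interval infinitely many gaps
  close at some time. Since an edge counts as open at the times at which it changes state, the set
  of times at which a gap is closed is open; by the Baire category theorem, there are times at which
  infinitely many gaps are closed (`ae_exists_notMem_percolatesAt`).
-/

namespace Percolation

/-! ### Events in product spaces -/

section ProductSpaces

variable {ι α : Type*} [MeasurableSpace α]

/-- A measurable function of the coordinates in `u` is measurable for the `σ`-algebra that these
coordinates generate. -/
theorem comap_le_of_dependsOn [Nonempty α] {δ : Type*} [MeasurableSpace δ] {h : (ι → α) → δ}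
    {u : Set ι} (hh : Measurable h) (hu : DependsOn h u) :
    MeasurableSpace.comap h inferInstance ≤
      ⨆ i ∈ u, MeasurableSpace.comap (fun ξ : ι → α => ξ i) inferInstance := by
  classical
  obtain ⟨a⟩ := ‹Nonempty α›
  set r : (ι → α) → (ι → α) := fun ξ i => if i ∈ u then ξ i else a
  have hr : @Measurable _ _ (⨆ i ∈ u, MeasurableSpace.comap (fun ξ : ι → α => ξ i) inferInstance)
      _ r := by
    refine @measurable_pi_lambda _ _ _ (_) _ _ fun i => ?_
    by_cases hi : i ∈ u
    · simp only [r, hi, if_true]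
      exact Measurable.mono (comap_measurable _) (le_iSup₂_of_le i hi le_rfl) le_rfl
    · simp only [r, hi, if_false]
      exact measurable_const
  have hcomp : h = h ∘ r := by
    funext ξ
    exact hu fun i hi => by simp [r, hi]
  rintro _ ⟨B, hB, rfl⟩
  rw [hcomp]
  exact hr (hh hB)

theorem indepFun_of_dependsOn (κ : Measure α) [IsProbabilityMeasure κ]
    {β γ : Type*} [MeasurableSpace β] [MeasurableSpace γ]
    {f : (ι → α) → β} {g : (ι → α) → γ} {s t : Set ι} (hf : Measurable f) (hg : Measurable g)
    (hfs : DependsOn f s) (hgt : DependsOn g t) (hst : Disjoint s t) :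
    IndepFun f g (Measure.infinitePi fun _ : ι => κ) := by
  have : Nonempty α := κ.nonempty_of_neZero
  have hind : iIndep (fun i : ι => MeasurableSpace.comap (fun ξ : ι → α => ξ i) inferInstance)
      (Measure.infinitePi fun _ : ι => κ) :=
    (iIndepFun_infinitePi (P := fun _ : ι => κ) (X := fun _ x => x)
      (fun _ => measurable_id)).iIndep
  exact indep_of_indep_of_le_left (indep_of_indep_of_le_right
    (indep_iSup_of_disjoint (fun i => (measurable_pi_apply i).comap_le) hind hst)
    (comap_le_of_dependsOn hg hgt)) (comap_le_of_dependsOn hf hfs)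

theorem measure_inter_of_dependsOn (κ : Measure α) [IsProbabilityMeasure κ]
    {A B : Set (ι → α)} {s t : Set ι} (hA : MeasurableSet A)
    (hB : MeasurableSet B) (hAs : DependsOn (fun ξ => ξ ∈ A) s)
    (hBt : DependsOn (fun ξ => ξ ∈ B) t) (hst : Disjoint s t) :
    (Measure.infinitePi fun _ : ι => κ) (A ∩ B)
      = (Measure.infinitePi fun _ : ι => κ) A * (Measure.infinitePi fun _ : ι => κ) B := by
  have h := indepFun_of_dependsOn κ (f := fun ξ => ξ ∈ A) (g := fun ξ => ξ ∈ B)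
    (measurable_mem.2 hA) (measurable_mem.2 hB) hAs hBt hst
  have := h.measure_inter_preimage_eq_mul {True} {True} (MeasurableSet.singleton _)
    (MeasurableSet.singleton _)
  have e : ∀ C : Set (ι → α), (fun ξ => ξ ∈ C) ⁻¹' ({True} : Set Prop) = C := by
    intro C; ext ξ; simp
  rwa [e, e] at this

theorem measure_biInter_of_dependsOn (κ : Measure α) [IsProbabilityMeasure κ]
    {J : Type*} (F : Finset J) {A : J → Set (ι → α)}
    {L : J → Set ι} (hA : ∀ i, MeasurableSet (A i)) (hd : ∀ i, DependsOn (fun ξ => ξ ∈ A i) (L i))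
    (hL : ∀ i ∈ F, ∀ j ∈ F, i ≠ j → Disjoint (L i) (L j)) :
    (Measure.infinitePi fun _ : ι => κ) (⋂ i ∈ F, A i)
      = ∏ i ∈ F, (Measure.infinitePi fun _ : ι => κ) (A i) := by
  classical
  induction F using Finset.induction_on with
  | empty => simp
  | insert i F hi ih =>
    rw [Finset.prod_insert hi, Finset.set_biInter_insert, measure_inter_of_dependsOn κ (hA i)
      (Finset.measurableSet_biInter _ fun j _ => hA j) (hd i) (t := ⋃ j ∈ F, L j), ih]
    · intro a ha b hb hab
      exact hL a (Finset.mem_insert_of_mem ha) b (Finset.mem_insert_of_mem hb) hab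
    · intro x y hxy
      simp only [Set.mem_iInter]
      refine forall_congr fun j => forall_congr fun hj => ?_
      exact hd j fun l hl => hxy l (Set.mem_biUnion hj hl)
    · rw [Set.disjoint_iUnion₂_right]
      intro j hj
      exact hL i (Finset.mem_insert_self _ _) j (Finset.mem_insert_of_mem hj)
        (fun h => hi (h ▸ hj))

theorem iIndepSet_of_dependsOn (κ : Measure α) [IsProbabilityMeasure κ]
    {J : Type*} {A : J → Set (ι → α)} {L : J → Set ι}
    (hA : ∀ i, MeasurableSet (A i)) (hd : ∀ i, DependsOn (fun ξ => ξ ∈ A i) (L i))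
    (hL : Pairwise fun i j => Disjoint (L i) (L j)) :
    iIndepSet A (Measure.infinitePi fun _ : ι => κ) := by
  rw [iIndepSet_iff_meas_biInter hA]
  intro F
  exact measure_biInter_of_dependsOn κ F hA hd fun i _ j _ hij => hL hij

/-- If, for every value `b` of a discrete variable `ρ` that satisfies `good`, the event `N b` is
independent of `ρ = b` and has probability at most `ε`, then so has the event that `ρ` is good
and `N ρ` occurs. -/
theorem measure_le_of_conditioning {Ω β : Type*} [MeasurableSpace Ω] (μ : Measure Ω)
    [IsProbabilityMeasure μ] (B : Finset β) (ρ : Ω → β) (hρ : ∀ ω, ρ ω ∈ B)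
    (hm : ∀ b, MeasurableSet {ω | ρ ω = b}) (good : β → Prop) (N : β → Set Ω) (ε : ENNReal)
    (h : ∀ b, good b → μ ({ω | ρ ω = b} ∩ N b) ≤ μ {ω | ρ ω = b} * ε) :
    μ {ω | good (ρ ω) ∧ ω ∈ N (ρ ω)} ≤ ε := by
  classical
  have hsub : {ω | good (ρ ω) ∧ ω ∈ N (ρ ω)} ⊆
      ⋃ b ∈ B.filter good, ({ω | ρ ω = b} ∩ N b) := by
    rintro ω ⟨h1, h2⟩
    simp only [Set.mem_iUnion]
    exact ⟨ρ ω, by simp [hρ, h1], rfl, h2⟩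
  calc μ {ω | good (ρ ω) ∧ ω ∈ N (ρ ω)}
      ≤ ∑ b ∈ B.filter good, μ ({ω | ρ ω = b} ∩ N b) :=
        (measure_mono hsub).trans (measure_biUnion_finset_le _ _)
    _ ≤ ∑ b ∈ B.filter good, μ {ω | ρ ω = b} * ε :=
        Finset.sum_le_sum fun b hb => h b (Finset.mem_filter.1 hb).2
    _ ≤ (∑ b ∈ B, μ {ω | ρ ω = b}) * ε := by
        rw [Finset.sum_mul]
        exact Finset.sum_le_sum_of_subset (Finset.filter_subset _ _)
    _ = μ (⋃ b ∈ B, {ω | ρ ω = b}) * ε := by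
        rw [measure_biUnion_finset _ fun b _ => hm b]
        intro b _ b' _ hbb
        exact Set.disjoint_left.2 fun ω (h1 : ρ ω = b) (h2 : ρ ω = b') => hbb (h1 ▸ h2)
    _ ≤ 1 * ε := by gcongr; exact prob_le_one
    _ = ε := one_mul ε

end ProductSpaces

/-- A Bonferroni-type lower bound: `J` events of probability `A`, the overlaps of each of which
with the preceding ones have total probability at most `A / 2`. -/
theorem le_measureReal_biUnion_range {Ω : Type*} [MeasurableSpace Ω] (μ : Measure Ω)
    [IsProbabilityMeasure μ] (E : ℕ → Set Ω) (hE : ∀ j, MeasurableSet (E j)) (A : ℝ)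
    (hA : ∀ j, μ.real (E j) = A) {J : ℕ}
    (h : ∀ j < J, ∑ i ∈ Finset.range j, μ.real (E i ∩ E j) ≤ A / 2) :
    J * (A / 2) ≤ μ.real (⋃ j ∈ Finset.range J, E j) := by
  induction J with
  | zero => simp
  | succ J ih =>
    have h1 : (⋃ j ∈ Finset.range (J + 1), E j) = (⋃ j ∈ Finset.range J, E j) ∪ E J := by
      rw [Finset.range_add_one, Finset.set_biUnion_insert, Set.union_comm]
    have h2 := measureReal_union_add_inter (μ := μ) (s := ⋃ j ∈ Finset.range J, E j) (hE J)
      (measure_ne_top _ _) (measure_ne_top _ _)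
    have h3 : μ.real ((⋃ j ∈ Finset.range J, E j) ∩ E J) ≤ A / 2 := by
      refine le_trans ?_ (h J (Nat.lt_succ_self J))
      rw [Set.iUnion₂_inter]
      exact measureReal_biUnion_finset_le _ _
    have h4 := ih fun j hj => h j (hj.trans (Nat.lt_succ_self J))
    rw [h1]
    have := hA J
    push_cast
    linarith

/-! ### The graph -/

/-- Names of potential vertices: `(n, true, w)` is the node `w` of the binary forest that leaves
the `n`-th gap forwards, `(n, false, w)` the node `w` of the one that leaves it backwards. The
children of the word `w` are the words `b :: w`. -/
abbrev Node : Type := ℕ × Bool × List Bool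

/-- Names of potential edges. The label `(v, false)` names the edge from `v` to its parent in the
forest or, if `v` is a root, to the root on the other side of the gap; the label `(v, true)` names
the hub edge at `v`. -/
abbrev Label : Type := Node × Bool

/-- The depth at which the trees of an item are inspected, in a gap with `2 ^ k` items. During the
first `2 ^ k` generations a surviving tree acquires exponentially many nodes; another `2 ^ k`
generations make the survival probability insensitive to how it is measured, see
`iterate_branch_sub_le`. -/
def depth (k : ℕ) : ℕ := 2 * 2 ^ k

/-- The length of the words at the inspected level of a forest with `2 ^ k` roots. -/
def stem (k : ℕ) : ℕ := k + depth k

/-- The length of the leaves of a forest: a leaf of a forest consists of a word of the inspected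
level and the address of a word of the inspected level of the forest it faces. -/
def top (a : ℕ → ℕ) (n : ℕ) (s : Bool) : ℕ :=
  stem (a n) + if s then stem (a (n + 1)) else stem (a (n - 1))

/-- `IsEdge a l u v`: the label `l` names an edge of the graph with lower end `u` and upper
end `v`. -/
inductive IsEdge (a : ℕ → ℕ) : Label → Node → Node → Prop
  | tree (n : ℕ) (s b : Bool) (w : List Bool) (h : a n ≤ w.length) (h' : w.length < top a n s) :
      IsEdge a ((n, s, b :: w), false) (n, s, w) (n, s, b :: w)
  | bottleneck (n : ℕ) (w : List Bool) (h : w.length = a n) :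
      IsEdge a ((n, true, w), false) (n, false, w) (n, true, w)
  | hub (n : ℕ) (x y : List Bool) (hx : x.length = stem (a n)) (hy : y.length = stem (a (n + 1))) :
      IsEdge a ((n + 1, false, x ++ y), true) (n, true, y ++ x) (n + 1, false, x ++ y)

/-- The vertices: the words whose length lies between that of the roots and that of the leaves. -/
abbrev Vert (a : ℕ → ℕ) : Type :=
  {v : Node // a v.1 ≤ v.2.2.length ∧ v.2.2.length ≤ top a v.1 v.2.1}

theorem IsEdge.fst_eq {a : ℕ → ℕ} {l : Label} {u v : Node} (h : IsEdge a l u v) : l.1 = v := by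
  cases h <;> rfl

theorem IsEdge.label_unique {a : ℕ → ℕ} {l l' : Label} {u v : Node} (h : IsEdge a l u v)
    (h' : IsEdge a l' u v) : l = l' := by
  refine Prod.ext (h.fst_eq.trans h'.fst_eq.symm) ?_
  have key : ∀ {l : Label}, IsEdge a l u v → (l.2 = true ↔ u.1 ≠ v.1) := by
    intro l hl
    cases hl <;> simp
  exact Bool.eq_iff_iff.2 ((key h).trans (key h').symm)

theorem IsEdge.lower_unique {a : ℕ → ℕ} {l : Label} {u u' v : Node} (h : IsEdge a l u v)
    (h' : IsEdge a l u' v) : u = u' := by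
  generalize hl : l = l' at h'
  generalize hv : v = v' at h'
  cases h with
  | tree n s b w h1 h2 =>
    cases h' with
    | tree n' s' b' w' h1' h2' => simp_all
    | bottleneck n' w' h' =>
      simp only [Prod.mk.injEq] at hv
      obtain ⟨rfl, rfl, rfl⟩ := hv
      simp only [List.length_cons] at h'
      omega
    | hub n' x y hx hy => simp at hl
  | bottleneck n w h =>
    cases h' with
    | tree n' s' b' w' h1' h2' =>
      simp only [Prod.mk.injEq] at hv
      obtain ⟨rfl, rfl, rfl⟩ := hv
      simp only [List.length_cons] at h
      omega
    | bottleneck n' w' h' => simp_all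
    | hub n' x y hx hy => simp at hl
  | hub n x y hx hy =>
    cases h' with
    | tree n' s' b' w' h1' h2' => simp at hl
    | bottleneck n' w' h' => simp at hl
    | hub n' x' y' hx' hy' =>
      simp only [Prod.mk.injEq, Nat.add_right_cancel_iff, true_and] at hv
      obtain ⟨rfl, hv⟩ := hv
      obtain ⟨rfl, rfl⟩ := List.append_inj hv (hx.trans hx'.symm)
      rfl

theorem IsEdge.lt {a : ℕ → ℕ} {l : Label} {u v : Node} (h : IsEdge a l u v) :
    u.1 < v.1 ∨ u.1 = v.1 ∧ (u.2.1 < v.2.1 ∨ u.2.1 = v.2.1 ∧ u.2.2.length < v.2.2.length) := by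
  cases h <;> simp

theorem IsEdge.asymm {a : ℕ → ℕ} {l l' : Label} {u v : Node} (h : IsEdge a l u v) :
    ¬ IsEdge a l' v u := by
  intro h'
  obtain ⟨n, s, w⟩ := u
  obtain ⟨n', s', w'⟩ := v
  have h1 := h.lt
  have h2 := h'.lt
  simp only at h1 h2
  rcases h1 with h1 | ⟨h1, h1 | ⟨h1, h1'⟩⟩ <;> rcases h2 with h2 | ⟨h2, h2 | ⟨h2, h2'⟩⟩ <;>
    first
    | omega
    | exact absurd h1 (not_lt_of_gt h2)
    | (subst h1; exact lt_irrefl _ h2)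
    | (subst h2; exact lt_irrefl _ h1)

/-- The graph with all vertices and the edges whose labels lie in `S`. -/
def labelGraph (a : ℕ → ℕ) (S : Set Label) : SimpleGraph (Vert a) where
  Adj u v := ∃ l ∈ S, IsEdge a l u.1 v.1 ∨ IsEdge a l v.1 u.1
  symm := ⟨fun _ _ ⟨l, hl, h⟩ => ⟨l, hl, h.symm⟩⟩
  loopless := ⟨fun _ ⟨_, _, h⟩ => h.elim (fun h => h.asymm h) fun h => h.asymm h⟩

/-- The graph of the theorem: a chain of gaps and hubs. The `n`-th gap consists of `2 ^ a n`
parallel items, an item being an edge at each end of which a binary tree is rooted; in the hub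
between two consecutive gaps, each node of the inspected level of a tree on one side is joined by a
path of its own to each node of the inspected level of a tree on the other side. -/
def chainGraph (a : ℕ → ℕ) : SimpleGraph (Vert a) := labelGraph a Set.univ

theorem exists_label {a : ℕ → ℕ} (e : (chainGraph a).edgeSet) :
    ∃ l : Label, ∃ u v : Vert a, e.1 = s(u, v) ∧ IsEdge a l u.1 v.1 := by
  obtain ⟨e, he⟩ := e
  induction e with
  | h u v =>
    obtain ⟨l, -, h | h⟩ := he
    · exact ⟨l, u, v, rfl, h⟩
    · exact ⟨l, v, u, Sym2.eq_swap, h⟩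

/-- The label of an edge. -/
noncomputable def label {a : ℕ → ℕ} (e : (chainGraph a).edgeSet) : Label :=
  (exists_label e).choose

theorem label_spec {a : ℕ → ℕ} (e : (chainGraph a).edgeSet) :
    ∃ u v : Vert a, e.1 = s(u, v) ∧ IsEdge a (label e) u.1 v.1 :=
  (exists_label e).choose_spec

theorem label_eq {a : ℕ → ℕ} {e : (chainGraph a).edgeSet} {l : Label} {u v : Vert a}
    (he : e.1 = s(u, v)) (hl : IsEdge a l u.1 v.1) : label e = l := by
  obtain ⟨u', v', he', hl'⟩ := label_spec e
  rw [he, Sym2.eq_iff] at he'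
  rcases he' with ⟨rfl, rfl⟩ | ⟨rfl, rfl⟩
  · exact hl'.label_unique hl
  · exact absurd hl' hl.asymm

theorem label_injective {a : ℕ → ℕ} :
    Function.Injective (label : (chainGraph a).edgeSet → Label) := by
  intro e e' h
  obtain ⟨u, v, he, hl⟩ := label_spec e
  obtain ⟨u', v', he', hl'⟩ := label_spec e'
  rw [← h] at hl'
  have hv : v = v' := Subtype.ext (hl.fst_eq.symm.trans hl'.fst_eq)
  subst hv
  have hu : u = u' := Subtype.ext (hl.lower_unique hl')
  exact Subtype.ext (he.trans (hu ▸ he'.symm))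

theorem openSubgraph_chainGraph (a : ℕ → ℕ) (S : Set Label) :
    openSubgraph (chainGraph a) {e | label e ∈ S} = labelGraph a S := by
  ext u v
  simp only [openSubgraph, SimpleGraph.fromEdgeSet_adj]
  constructor
  · rintro ⟨⟨e, he, huv⟩, -⟩
    obtain ⟨u', v', he', hl⟩ := label_spec e
    rw [he', Sym2.eq_iff] at huv
    rcases huv with ⟨rfl, rfl⟩ | ⟨rfl, rfl⟩
    · exact ⟨_, he, Or.inl hl⟩
    · exact ⟨_, he, Or.inr hl⟩
  · intro h
    have hne := h.ne
    obtain ⟨l, hl, h⟩ := h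
    refine ⟨?_, hne⟩
    have hadj : (chainGraph a).Adj u v := ⟨l, trivial, h⟩
    refine ⟨⟨s(u, v), hadj⟩, ?_, rfl⟩
    have : label (⟨s(u, v), hadj⟩ : (chainGraph a).edgeSet) = l := by
      rcases h with h | h
      · exact label_eq rfl h
      · exact label_eq Sym2.eq_swap h
    simpa [this] using hl

theorem le_stem (k : ℕ) : k ≤ stem k := Nat.le_add_right _ _

theorem stem_le_top (a : ℕ → ℕ) (n : ℕ) (s : Bool) : stem (a n) ≤ top a n s :=
  Nat.le_add_right _ _

theorem le_top (a : ℕ → ℕ) (n : ℕ) (s : Bool) : a n ≤ top a n s :=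
  (le_stem _).trans (stem_le_top a n s)

theorem boundedDegree_chainGraph (a : ℕ → ℕ) : BoundedDegree (chainGraph a) := by
  refine ⟨6, fun v => ?_⟩
  obtain ⟨⟨n, s, w⟩, hv⟩ := v
  set T : Finset Node := {(n, s, w.tail), (n, s, true :: w), (n, s, false :: w), (n, !s, w),
    (n - 1, true, w.drop (stem (a (n - 1))) ++ w.take (stem (a (n - 1)))),
    (n + 1, false, w.drop (stem (a (n + 1))) ++ w.take (stem (a (n + 1))))} with hT
  have hsub : Subtype.val '' (chainGraph a).neighborSet ⟨(n, s, w), hv⟩ ⊆ (T : Set Node) := by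
    rintro _ ⟨⟨u, hu⟩, ⟨l, -, h⟩, rfl⟩
    simp only [hT, Finset.coe_insert, Finset.coe_singleton, Set.mem_insert_iff,
      Set.mem_singleton_iff]
    rcases h with h | h
    · cases h with
      | tree n s b w h1 h2 => cases b <;> simp
      | bottleneck n w h => simp
      | hub n x y hx hy => simp [← hy]
    · cases h with
      | tree n s b w h1 h2 => simp
      | bottleneck n w h => simp
      | hub n x y hx hy => simp [← hx]
  calc ((chainGraph a).neighborSet ⟨(n, s, w), hv⟩).encard
      = (Subtype.val '' (chainGraph a).neighborSet ⟨(n, s, w), hv⟩).encard :=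
        (Subtype.val_injective.encard_image _).symm
    _ ≤ (T : Set Node).encard := Set.encard_le_encard hsub
    _ = T.card := Set.encard_coe_eq_coe_finsetCard T
    _ ≤ 6 := by exact_mod_cast Finset.card_le_six

/-! ### Open paths in the forests -/

/-- All edges of the forest `(n, s)` on the path from the word `w` to its descendant `y ++ w`
are open. -/
def PathOpen (S : Set Label) (n : ℕ) (s : Bool) : List Bool → List Bool → Prop
  | [], _ => True
  | b :: y, w => ((n, s, b :: (y ++ w)), false) ∈ S ∧ PathOpen S n s y w

theorem pathOpen_append {S : Set Label} {n : ℕ} {s : Bool} {y z w : List Bool} :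
    PathOpen S n s (y ++ z) w ↔ PathOpen S n s y (z ++ w) ∧ PathOpen S n s z w := by
  induction y with
  | nil => simp [PathOpen]
  | cons b y ih => simp [PathOpen, ih, and_assoc]

theorem PathOpen.reachable {a : ℕ → ℕ} {S : Set Label} {n : ℕ} {s : Bool} {y w : List Bool}
    (h : PathOpen S n s y w) (hw : a n ≤ w.length) (hy : (y ++ w).length ≤ top a n s) :
    (labelGraph a S).Reachable ⟨(n, s, w), hw, by simp at hy ⊢; omega⟩
      ⟨(n, s, y ++ w), by simp; omega, hy⟩ := by
  induction y with
  | nil => exact SimpleGraph.Reachable.refl _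
  | cons b y ih =>
    simp only [List.cons_append, List.length_cons] at hy
    refine (ih h.2 (by omega)).trans (SimpleGraph.Adj.reachable ?_)
    exact ⟨_, h.1, Or.inl (IsEdge.tree n s b (y ++ w) (by simp; omega) (by omega))⟩

theorem pathOpen_univ (n : ℕ) (s : Bool) (y w : List Bool) : PathOpen Set.univ n s y w := by
  induction y with
  | nil => trivial
  | cons b y ih => exact ⟨trivial, ih⟩

/-- The words of length `d`. -/
def words : ℕ → Finset (List Bool)
  | 0 => {[]}
  | d + 1 => (words d).image (List.cons true) ∪ (words d).image (List.cons false)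

theorem mem_words {d : ℕ} {w : List Bool} : w ∈ words d ↔ w.length = d := by
  induction d generalizing w with
  | zero => simp [words]
  | succ d ih =>
    cases w with
    | nil => simp [words]
    | cons b w => cases b <;> simp [words, ih]

theorem card_words (d : ℕ) : (words d).card = 2 ^ d := by
  induction d with
  | zero => simp [words]
  | succ d ih =>
    rw [words, Finset.card_union_of_disjoint, Finset.card_image_of_injective _ List.cons_injective,
      Finset.card_image_of_injective _ List.cons_injective, ih, pow_succ]
    · ring
    · rw [Finset.disjoint_left]
      intro w h1 h2
      simp only [Finset.mem_image] at h1 h2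
      obtain ⟨u, -, rfl⟩ := h1
      obtain ⟨v, -, h⟩ := h2
      simp at h

open Classical in
/-- The descendants of `w` in the forest `(n, s)`, `d` generations below, to which the path from
`w` is open; each is given by the word that has to be prepended to `w`. -/
noncomputable def reached (S : Set Label) (n : ℕ) (s : Bool) (d : ℕ) (w : List Bool) :
    Finset (List Bool) :=
  (words d).filter fun y => PathOpen S n s y w

theorem mem_reached {S : Set Label} {n : ℕ} {s : Bool} {d : ℕ} {w y : List Bool} :
    y ∈ reached S n s d w ↔ y.length = d ∧ PathOpen S n s y w := by
  simp [reached, mem_words]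

/-- The item with root `i` of the `n`-th gap is open with threshold `M`: its edge is open and, on
both sides, at least `M` nodes of the inspected level are reached from the root. -/
def ItemOpen (a : ℕ → ℕ) (S : Set Label) (n M : ℕ) (i : List Bool) : Prop :=
  ((n, true, i), false) ∈ S ∧ ∀ s, M ≤ (reached S n s (depth (a n)) i).card

/-- No item of the `n`-th gap provides a connection even to the inspected levels. -/
def GapClosed (a : ℕ → ℕ) (S : Set Label) (n : ℕ) : Prop :=
  ∀ i : List Bool, i.length = a n → ¬ ItemOpen a S n 1 i

/-- Some item of the `n`-th gap reaches at least `M` nodes of both inspected levels. -/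
def GapOpen (a : ℕ → ℕ) (S : Set Label) (M n : ℕ) : Prop :=
  ∃ i : List Bool, i.length = a n ∧ ItemOpen a S n M i

/-- The hub edge at the leaf `x ++ y` and the two paths that lead to it from the nodes `x` and `y`
of the inspected levels are open. -/
def LinkOpen (S : Set Label) (n : ℕ) (x y : List Bool) : Prop :=
  PathOpen S n true y x ∧ ((n + 1, false, x ++ y), true) ∈ S ∧ PathOpen S (n + 1) false x y

/-- The hub between the gaps `n` and `n + 1` connects any two trees, one from each side, that reach
at least `M` and `M'` nodes of the inspected levels. -/
def HubOpen (a : ℕ → ℕ) (S : Set Label) (M M' n : ℕ) : Prop :=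
  ∀ i j : List Bool, i.length = a n → j.length = a (n + 1) →
    M ≤ (reached S n true (depth (a n)) i).card →
    M' ≤ (reached S (n + 1) false (depth (a (n + 1))) j).card →
    ∃ x ∈ reached S n true (depth (a n)) i,
      ∃ y ∈ reached S (n + 1) false (depth (a (n + 1))) j, LinkOpen S n (x ++ i) (y ++ j)

theorem reachable_of_linkOpen {a : ℕ → ℕ} {S : Set Label} {n : ℕ} {x y i j : List Bool}
    (hi : i.length = a n) (hj : j.length = a (n + 1))
    (hx : x ∈ reached S n true (depth (a n)) i)
    (hy : y ∈ reached S (n + 1) false (depth (a (n + 1))) j)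
    (h : LinkOpen S n (x ++ i) (y ++ j)) :
    (labelGraph a S).Reachable ⟨(n, true, i), hi.ge, hi.le.trans (le_top a n _)⟩
      ⟨(n + 1, false, j), hj.ge, hj.le.trans (le_top a (n + 1) _)⟩ := by
  obtain ⟨hx1, hx2⟩ := mem_reached.1 hx
  obtain ⟨hy1, hy2⟩ := mem_reached.1 hy
  have hxs : (x ++ i).length = stem (a n) := by simp [hx1, hi, stem, add_comm]
  have hys : (y ++ j).length = stem (a (n + 1)) := by simp [hy1, hj, stem, add_comm]
  have ht : top a n true = stem (a n) + stem (a (n + 1)) := by simp [top]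
  have ht' : top a (n + 1) false = stem (a (n + 1)) + stem (a n) := by simp [top]
  have r1 := hx2.reachable (a := a) hi.ge (by rw [hxs]; exact stem_le_top _ _ _)
  have r2 := h.1.reachable (a := a) (hxs ▸ le_stem _)
    (by rw [List.length_append, hxs, hys, ht]; omega)
  have r3 := hy2.reachable (a := a) hj.ge (by rw [hys]; exact stem_le_top _ _ _)
  have r4 := h.2.2.reachable (a := a) (hys ▸ le_stem _)
    (by rw [List.length_append, hxs, hys, ht']; omega)
  refine (r1.trans r2).trans (SimpleGraph.Reachable.trans ?_ (r3.trans r4).symm)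
  exact SimpleGraph.Adj.reachable ⟨_, h.2.1, Or.inl (IsEdge.hub n _ _ hxs hys)⟩

theorem reachable_bottleneck {a : ℕ → ℕ} {S : Set Label} {n : ℕ} {i : List Bool}
    (hi : i.length = a n) (h : ((n, true, i), false) ∈ S) :
    (labelGraph a S).Reachable ⟨(n, false, i), hi.ge, hi.le.trans (le_top a n _)⟩
      ⟨(n, true, i), hi.ge, hi.le.trans (le_top a n _)⟩ :=
  SimpleGraph.Adj.reachable ⟨_, h, Or.inl (IsEdge.bottleneck n i hi)⟩

theorem PathOpen.mono {S T : Set Label} (hST : S ⊆ T) {n : ℕ} {s : Bool} {y w : List Bool}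
    (h : PathOpen S n s y w) : PathOpen T n s y w := by
  induction y with
  | nil => trivial
  | cons b y ih => exact ⟨hST h.1, ih h.2⟩

theorem reached_mono {S T : Set Label} (hST : S ⊆ T) (n : ℕ) (s : Bool) (d : ℕ) (w : List Bool) :
    reached S n s d w ⊆ reached T n s d w := fun _ hy =>
  mem_reached.2 ⟨(mem_reached.1 hy).1, (mem_reached.1 hy).2.mono hST⟩

theorem ItemOpen.mono {a : ℕ → ℕ} {S T : Set Label} (hST : S ⊆ T) {n M : ℕ} {i : List Bool}
    (h : ItemOpen a S n M i) : ItemOpen a T n M i :=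
  ⟨hST h.1, fun s => (h.2 s).trans (Finset.card_le_card (reached_mono hST _ _ _ _))⟩

theorem labelGraph_mono {a : ℕ → ℕ} {S T : Set Label} (hST : S ⊆ T) :
    labelGraph a S ≤ labelGraph a T := fun _ _ ⟨l, hl, h⟩ => ⟨l, hST hl, h⟩

/-- If all gaps and hubs from some point on are open, there is an infinite cluster. The gaps may be
considered in larger and larger sets of open edges; since the opening of a hub is not monotone in
the set of open edges, it is required in the set that belongs to the second of the two adjacent
gaps, in which the items that were chosen in both gaps are open. -/
theorem exists_infinite_component {a : ℕ → ℕ} {W : ℕ → Set Label} (hW : Monotone W)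
    {S : Set Label} (hS : ∀ n, W n ⊆ S) (M : ℕ → ℕ) (N : ℕ)
    (hgap : ∀ n ≥ N, GapOpen a (W n) (M n) n)
    (hhub : ∀ n ≥ N, HubOpen a (W (n + 1)) (M n) (M (n + 1)) n) :
    ∃ c : (labelGraph a S).ConnectedComponent, c.supp.Infinite := by
  have hgap' : ∀ m, ∃ i : List Bool, i.length = a (N + m) ∧
      ItemOpen a (W (N + m)) (N + m) (M (N + m)) i :=
    fun m => hgap (N + m) (Nat.le_add_right _ _)
  choose i hi hopen using hgap'
  set v : ℕ → Vert a := fun m =>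
    ⟨(N + m, true, i m), (hi m).ge, (hi m).le.trans (le_top a _ _)⟩ with hv
  have hstep : ∀ m, (labelGraph a S).Reachable (v m) (v (m + 1)) := by
    intro m
    obtain ⟨x, hx, y, hy, hlink⟩ := hhub (N + m) (Nat.le_add_right _ _) (i m) (i (m + 1)) (hi m)
      (hi (m + 1)) (((hopen m).mono (hW (Nat.le_succ _))).2 true) ((hopen (m + 1)).2 false)
    exact ((reachable_of_linkOpen (hi m) (hi (m + 1)) hx hy hlink).trans
      (reachable_bottleneck (hi (m + 1)) (hopen (m + 1)).1)).mono (labelGraph_mono (hS _))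
  have hall : ∀ m, (labelGraph a S).Reachable (v 0) (v m) := by
    intro m
    induction m with
    | zero => exact SimpleGraph.Reachable.refl _
    | succ m ih => exact ih.trans (hstep m)
  refine ⟨(labelGraph a S).connectedComponentMk (v 0), ?_⟩
  refine Set.infinite_of_injective_forall_mem (f := v) ?_ fun m => ?_
  · intro m m' h
    have := congrArg (fun u : Vert a => u.1.1) h
    simpa [hv] using this
  · exact SimpleGraph.ConnectedComponent.sound (hall m).symm

theorem connected_chainGraph (a : ℕ → ℕ) : (chainGraph a).Connected := by
  have hub : ∀ n (i j : List Bool) (hi : i.length = a n) (hj : j.length = a (n + 1)),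
      (chainGraph a).Reachable ⟨(n, true, i), hi.ge, hi.le.trans (le_top a n _)⟩
        ⟨(n + 1, false, j), hj.ge, hj.le.trans (le_top a (n + 1) _)⟩ := by
    intro n i j hi hj
    refine reachable_of_linkOpen hi hj (x := List.replicate _ true) (y := List.replicate _ true)
      (mem_reached.2 ⟨List.length_replicate, pathOpen_univ _ _ _ _⟩)
      (mem_reached.2 ⟨List.length_replicate, pathOpen_univ _ _ _ _⟩)
      ⟨pathOpen_univ _ _ _ _, trivial, pathOpen_univ _ _ _ _⟩
  have bot : ∀ n (i : List Bool) (hi : i.length = a n),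
      (chainGraph a).Reachable ⟨(n, false, i), hi.ge, hi.le.trans (le_top a n _)⟩
        ⟨(n, true, i), hi.ge, hi.le.trans (le_top a n _)⟩ :=
    fun n i hi => reachable_bottleneck hi trivial
  have hz : ∀ k, (List.replicate k true).length = k := fun k => List.length_replicate
  set o : ∀ n, Vert a := fun n => ⟨(n, true, List.replicate (a n) true), (hz _).ge,
    (hz _).le.trans (le_top a n _)⟩ with ho
  have hoo : ∀ n, (chainGraph a).Reachable (o 0) (o n) := by
    intro n
    induction n with
    | zero => exact SimpleGraph.Reachable.refl _
    | succ n ih => exact ih.trans ((hub n _ _ (hz _) (hz _)).trans (bot (n + 1) _ (hz _)))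
  have htrue : ∀ n (i : List Bool) (hi : i.length = a n), (chainGraph a).Reachable (o 0)
      ⟨(n, true, i), hi.ge, hi.le.trans (le_top a n _)⟩ := fun n i hi =>
    ((hoo n).trans (hub n _ _ (hz _) (hz _))).trans (hub n i _ hi (hz _)).symm
  have hroot : ∀ n s (i : List Bool) (hi : i.length = a n), (chainGraph a).Reachable (o 0)
      ⟨(n, s, i), hi.ge, hi.le.trans (le_top a n _)⟩ := by
    intro n s i hi
    cases s with
    | true => exact htrue n i hi
    | false => exact (htrue n i hi).trans (bot n i hi).symm
  have hbase : ∀ v : Vert a, (chainGraph a).Reachable (o 0) v := by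
    rintro ⟨⟨n, s, w⟩, h1, h2⟩
    simp only at h1 h2
    have hi : (w.drop (w.length - a n)).length = a n := by simp; omega
    have h := (pathOpen_univ n s (w.take (w.length - a n)) (w.drop (w.length - a n))).reachable
      (a := a) hi.ge (by rwa [List.take_append_drop])
    simp only [List.take_append_drop] at h
    exact (hroot n s _ hi).trans h
  have : Nonempty (Vert a) := ⟨o 0⟩
  exact ⟨fun u v => (hbase u).symm.trans (hbase v)⟩

theorem infinite_vert (a : ℕ → ℕ) : Infinite (Vert a) := by
  refine Infinite.of_injective (fun n : ℕ => (⟨(n, true, List.replicate (a n) true),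
    List.length_replicate.ge, List.length_replicate.le.trans (le_top a n _)⟩ : Vert a)) ?_
  intro m m' h
  exact congrArg (fun u : Vert a => u.1.1) h

/-! ### Closed gaps confine the clusters -/

/-- The word `w` is reached within the forest `(n, s)` from a root that satisfies `P`. -/
def ReachedFrom (a : ℕ → ℕ) (S : Set Label) (n : ℕ) (s : Bool) (P : List Bool → Prop)
    (w : List Bool) : Prop :=
  ∃ y i : List Bool, w = y ++ i ∧ i.length = a n ∧ PathOpen S n s y i ∧ P i

/-- The inspected level is not reached from the root `i` of the forest `(n, s)`. -/
def RootDead (a : ℕ → ℕ) (S : Set Label) (n : ℕ) (s : Bool) (i : List Bool) : Prop :=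
  ∀ y : List Bool, y.length = depth (a n) → ¬ PathOpen S n s y i

theorem rootDead_or_of_gapClosed {a : ℕ → ℕ} {S : Set Label} {n : ℕ} (h : GapClosed a S n)
    {i : List Bool} (hi : i.length = a n) (hb : ((n, true, i), false) ∈ S) :
    RootDead a S n false i ∨ RootDead a S n true i := by
  by_contra hcon
  simp only [RootDead, not_or, not_forall, not_not] at hcon
  obtain ⟨⟨y, hy, hy'⟩, z, hz, hz'⟩ := hcon
  refine h i hi ⟨hb, fun s => Finset.card_pos.2 ?_⟩
  cases s with
  | true => exact ⟨z, mem_reached.2 ⟨hz, hz'⟩⟩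
  | false => exact ⟨y, mem_reached.2 ⟨hy, hy'⟩⟩

theorem reachedFrom_cons {a : ℕ → ℕ} {S : Set Label} {n : ℕ} {s b : Bool} {P : List Bool → Prop}
    {w : List Bool} (hw : a n ≤ w.length) (hS : ((n, s, b :: w), false) ∈ S) :
    ReachedFrom a S n s P (b :: w) ↔ ReachedFrom a S n s P w := by
  constructor
  · rintro ⟨y, i, h, hi, hp, hP⟩
    cases y with
    | nil =>
      have := congrArg List.length h
      simp only [List.length_cons, List.nil_append] at this
      omega
    | cons c y =>
      simp only [List.cons_append, List.cons.injEq] at h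
      exact ⟨y, i, h.2, hi, hp.2, hP⟩
  · rintro ⟨y, i, rfl, hi, hp, hP⟩
    exact ⟨b :: y, i, rfl, hi, ⟨hS, hp⟩, hP⟩

theorem reachedFrom_root {a : ℕ → ℕ} {S : Set Label} {n : ℕ} {s : Bool} {P : List Bool → Prop}
    {i : List Bool} (hi : i.length = a n) : ReachedFrom a S n s P i ↔ P i := by
  constructor
  · rintro ⟨y, j, h, hj, hp, hP⟩
    have : y = [] := by
      have := congrArg List.length h
      simp only [List.length_append] at this
      exact List.length_eq_zero_iff.1 (by omega)
    subst this
    simpa [h] using hP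
  · intro h
    exact ⟨[], i, rfl, hi, trivial, h⟩

theorem not_reachedFrom_of_stem_le {a : ℕ → ℕ} {S : Set Label} {n : ℕ} {s : Bool}
    {P : List Bool → Prop} (hP : ∀ i, P i → RootDead a S n s i) {w : List Bool}
    (hw : stem (a n) ≤ w.length) : ¬ ReachedFrom a S n s P w := by
  rintro ⟨y, i, rfl, hi, hp, hPi⟩
  have hl : depth (a n) ≤ y.length := by
    simp only [List.length_append, stem] at hw
    omega
  refine hP i hPi (y.drop (y.length - depth (a n))) (by simp; omega) ?_
  rw [← List.take_append_drop (y.length - depth (a n)) y, pathOpen_append] at hp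
  exact hp.2

/-- The vertices on the near side of a closed gap: a dead tree belongs to the side of the
bottleneck, the rest of its forest to the side of the hub. -/
def NearSide (a : ℕ → ℕ) (S : Set Label) (n : ℕ) (v : Node) : Prop :=
  v.1 < n ∨ v.1 = n ∧
    ((v.2.1 = false ∧ ¬ ReachedFrom a S n false (RootDead a S n false) v.2.2) ∨
      (v.2.1 = true ∧ ReachedFrom a S n true (fun i => RootDead a S n true i ∧
        ¬ RootDead a S n false i ∧ ((n, true, i), false) ∈ S) v.2.2))

/-- No open edge leaves the near side of a closed gap. -/
theorem nearSide_iff_of_isEdge {a : ℕ → ℕ} {S : Set Label} {n : ℕ} (h : GapClosed a S n)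
    {l : Label} (hl : l ∈ S) {u v : Node} (huv : IsEdge a l u v) :
    NearSide a S n u ↔ NearSide a S n v := by
  cases huv with
  | tree m s b w h1 h2 =>
    simp only [NearSide]
    refine or_congr Iff.rfl (and_congr_right fun hm => ?_)
    subst hm
    refine or_congr (and_congr_right fun hs => ?_) (and_congr_right fun hs => ?_)
    · subst hs
      exact not_congr (reachedFrom_cons h1 hl).symm
    · subst hs
      exact (reachedFrom_cons h1 hl).symm
  | bottleneck m i hi =>
    simp only [NearSide]
    refine or_congr Iff.rfl (and_congr_right fun hm => ?_)
    subst hm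
    simp only [reachedFrom_root hi, true_and, Bool.false_eq_true, false_and, or_false,
      Bool.true_eq_false, false_or]
    -- an open bottleneck has a dead tree at one end; so its ends are on the near side if and only
    -- if the tree at the lower end is not dead
    have := rootDead_or_of_gapClosed h hi hl
    tauto
  | hub m x y hx hy =>
    simp only [NearSide, Bool.true_eq_false, Bool.false_eq_true, false_and, false_or, or_false,
      true_and]
    rcases lt_trichotomy (m + 1) n with hm | hm | hm
    · exact iff_of_true (Or.inl (by omega)) (Or.inl hm)
    -- a dead tree does not reach the leaves, where the hub edges are
    · subst hm
      refine iff_of_true (Or.inl (by omega)) (Or.inr ⟨rfl, ?_⟩)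
      exact not_reachedFrom_of_stem_le (fun i hi => hi) (by simp; omega)
    · refine iff_of_false ?_ (by omega)
      rintro (h' | ⟨rfl, h'⟩)
      · omega
      · exact not_reachedFrom_of_stem_le (fun i hi => hi.1) (by simp; omega) h'

theorem finite_nearSide (a : ℕ → ℕ) (S : Set Label) (n : ℕ) :
    {v : Vert a | NearSide a S n v.1}.Finite := by
  have hfin : (⋃ m ∈ Set.Iic n, ⋃ s : Bool,
      (fun w : List Bool => ((m, s, w) : Node)) '' {w | w.length ≤ top a m s}).Finite :=
    Set.Finite.biUnion (Set.finite_Iic n) fun m _ => Set.finite_iUnion fun s =>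
      (List.finite_length_le Bool (top a m s)).image _
  refine Set.Finite.of_finite_image (hfin.subset ?_) Subtype.val_injective.injOn
  rintro _ ⟨⟨⟨m, s, w⟩, h1, h2⟩, hv, rfl⟩
  simp only [Set.mem_iUnion]
  refine ⟨m, ?_, s, w, h2, rfl⟩
  rcases hv with h | ⟨h, -⟩
  · exact le_of_lt h
  · exact le_of_eq h

/-- If infinitely many gaps are closed, all clusters are finite. -/
theorem not_exists_infinite_component {a : ℕ → ℕ} {S : Set Label}
    (h : ∀ N, ∃ n ≥ N, GapClosed a S n) :
    ¬ ∃ c : (labelGraph a S).ConnectedComponent, c.supp.Infinite := by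
  rintro ⟨c, hc⟩
  induction c using SimpleGraph.ConnectedComponent.ind with
  | h v =>
    obtain ⟨n, hn, hclosed⟩ := h (v.1.1 + 1)
    refine hc ((finite_nearSide a S n).subset ?_)
    intro u hu
    have hr : (labelGraph a S).Reachable v u :=
      (SimpleGraph.ConnectedComponent.exact hu).symm
    obtain ⟨p⟩ := hr
    have hv : NearSide a S n v.1 := Or.inl hn
    clear hu hc hn
    induction p with
    | nil => exact hv
    | cons hadj p ih =>
      refine ih ?_
      obtain ⟨l, hl, h' | h'⟩ := hadj
      · exact (nearSide_iff_of_isEdge hclosed hl h').1 hv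
      · exact (nearSide_iff_of_isEdge hclosed hl h').2 hv

/-! ### Measurability and locality -/

section Measurability

variable {Ω : Type*} [MeasurableSpace Ω] {R : Ω → Set Label}

theorem measurableSet_pathOpen (hR : ∀ l, MeasurableSet {ω | l ∈ R ω}) (n : ℕ) (s : Bool)
    (y w : List Bool) : MeasurableSet {ω | PathOpen (R ω) n s y w} := by
  induction y with
  | nil => simp [PathOpen]
  | cons b y ih => exact (hR _).inter ih

theorem measurableSet_reached_eq (hR : ∀ l, MeasurableSet {ω | l ∈ R ω}) (n : ℕ) (s : Bool)
    (d : ℕ) (w : List Bool) (A : Finset (List Bool)) :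
    MeasurableSet {ω | reached (R ω) n s d w = A} := by
  simp only [Finset.ext_iff, mem_reached, Set.ofPred_forall]
  refine MeasurableSet.iInter fun y => ?_
  by_cases hy : y ∈ A <;> simp only [hy, iff_true, iff_false]
  · exact (MeasurableSet.const _).inter (measurableSet_pathOpen hR n s y w)
  · exact ((MeasurableSet.const _).inter (measurableSet_pathOpen hR n s y w)).compl

theorem measurable_card_reached (hR : ∀ l, MeasurableSet {ω | l ∈ R ω}) (n : ℕ) (s : Bool)
    (d : ℕ) (w : List Bool) : Measurable fun ω => (reached (R ω) n s d w).card := by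
  classical
  simp only [reached, Finset.card_filter]
  refine Finset.measurable_sum _ fun y _ => ?_
  exact Measurable.ite (measurableSet_pathOpen hR n s y w) measurable_const measurable_const

theorem measurableSet_itemOpen (hR : ∀ l, MeasurableSet {ω | l ∈ R ω}) (a : ℕ → ℕ) (n M : ℕ)
    (i : List Bool) : MeasurableSet {ω | ItemOpen a (R ω) n M i} := by
  have h : MeasurableSet {ω | ∀ s, M ≤ (reached (R ω) n s (depth (a n)) i).card} := by
    rw [Set.ofPred_forall]
    exact MeasurableSet.iInter fun s =>
      measurable_card_reached hR n s _ i (measurableSet_Ici (a := M))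
  exact (hR _).inter h

theorem measurableSet_gapClosed (hR : ∀ l, MeasurableSet {ω | l ∈ R ω}) (a : ℕ → ℕ) (n : ℕ) :
    MeasurableSet {ω | GapClosed a (R ω) n} := by
  simp only [GapClosed, Set.ofPred_forall]
  exact MeasurableSet.iInter fun i => MeasurableSet.iInter fun _ =>
    (measurableSet_itemOpen hR a n 1 i).compl

theorem measurableSet_gapOpen (hR : ∀ l, MeasurableSet {ω | l ∈ R ω}) (a : ℕ → ℕ) (M n : ℕ) :
    MeasurableSet {ω | GapOpen a (R ω) M n} := by
  simp only [GapOpen, Set.ofPred_exists]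
  exact MeasurableSet.iUnion fun i =>
    (MeasurableSet.const _).inter (measurableSet_itemOpen hR a n M i)

theorem measurableSet_linkOpen (hR : ∀ l, MeasurableSet {ω | l ∈ R ω}) (n : ℕ)
    (x y : List Bool) : MeasurableSet {ω | LinkOpen (R ω) n x y} :=
  (measurableSet_pathOpen hR _ _ _ _).inter
    ((hR _).inter (measurableSet_pathOpen hR _ _ _ _))

theorem measurableSet_hubOpen (hR : ∀ l, MeasurableSet {ω | l ∈ R ω}) (a : ℕ → ℕ)
    (M M' n : ℕ) : MeasurableSet {ω | HubOpen a (R ω) M M' n} := by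
  have himp : ∀ {A B : Set Ω}, MeasurableSet A → MeasurableSet B →
      MeasurableSet {ω | ω ∈ A → ω ∈ B} := by
    intro A B hA hB
    have : {ω | ω ∈ A → ω ∈ B} = Aᶜ ∪ B := by ext; simp [imp_iff_not_or]
    rw [this]; exact hA.compl.union hB
  have hmem : ∀ (m : ℕ) (s : Bool) (d : ℕ) (w y : List Bool),
      MeasurableSet {ω | y ∈ reached (R ω) m s d w} := by
    intro m s d w y
    simp only [mem_reached]
    exact (MeasurableSet.const _).inter (measurableSet_pathOpen hR _ _ _ _)
  have hlink : ∀ i j x y : List Bool, MeasurableSet {ω | y ∈ reached (R ω) (n + 1) false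
      (depth (a (n + 1))) j ∧ LinkOpen (R ω) n (x ++ i) (y ++ j)} := fun i j x y =>
    (hmem _ _ _ _ _).inter (measurableSet_linkOpen hR _ _ _)
  have hex : ∀ i j x : List Bool, MeasurableSet {ω | ∃ y ∈ reached (R ω) (n + 1) false
      (depth (a (n + 1))) j, LinkOpen (R ω) n (x ++ i) (y ++ j)} := by
    intro i j x
    rw [Set.ofPred_exists]
    exact MeasurableSet.iUnion fun y => hlink i j x y
  have hex' : ∀ i j : List Bool, MeasurableSet {ω | ∃ x ∈ reached (R ω) n true (depth (a n)) i,
      ∃ y ∈ reached (R ω) (n + 1) false (depth (a (n + 1))) j,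
        LinkOpen (R ω) n (x ++ i) (y ++ j)} := by
    intro i j
    rw [Set.ofPred_exists]
    exact MeasurableSet.iUnion fun x => (hmem _ _ _ _ _).inter (hex i j x)
  simp only [HubOpen, Set.ofPred_forall]
  exact MeasurableSet.iInter fun i => MeasurableSet.iInter fun j => MeasurableSet.iInter fun _ =>
    MeasurableSet.iInter fun _ => himp (measurable_card_reached hR n true _ i measurableSet_Ici)
    (himp (measurable_card_reached hR _ _ _ j measurableSet_Ici) (hex' i j))

end Measurability

/-- The function `f` of a set of labels is determined by the part of the set that lies in `L`. -/
def LocalOn {β : Type*} (f : Set Label → β) (L : Set Label) : Prop :=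
  ∀ S T : Set Label, (∀ l ∈ L, l ∈ S ↔ l ∈ T) → f S = f T

theorem LocalOn.dependsOn {α β : Type*} {f : Set Label → β} {L : Set Label} (h : LocalOn f L)
    (o : Set α) : DependsOn (fun ξ : Label → α => f {l | ξ l ∈ o}) L := by
  intro x y hxy
  exact h _ _ fun l hl => by simp [hxy l hl]

/-- The labels of the edges of the forest `(n, s)` that lie between `w` and its descendants. -/
def treeLabels (n : ℕ) (s : Bool) (w : List Bool) : Set Label :=
  {l | ∃ z : List Bool, z ≠ [] ∧ l = ((n, s, z ++ w), false)}

theorem localOn_pathOpen (n : ℕ) (s : Bool) (y w : List Bool) :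
    LocalOn (fun S => PathOpen S n s y w) (treeLabels n s w) := by
  intro S T h
  induction y with
  | nil => rfl
  | cons b y ih =>
    simp only [PathOpen] at ih ⊢
    have hb := h ((n, s, b :: (y ++ w)), false) ⟨b :: y, by simp, rfl⟩
    rw [ih, hb]

theorem localOn_reached (n : ℕ) (s : Bool) (d : ℕ) (w : List Bool) :
    LocalOn (fun S => reached S n s d w) (treeLabels n s w) := by
  intro S T h
  ext y
  simp only [mem_reached]
  exact and_congr_right fun _ => iff_of_eq (localOn_pathOpen n s y w S T h)

/-- The labels of the edges of an item. -/
def itemLabels (n : ℕ) (i : List Bool) : Set Label :=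
  {l | l = ((n, true, i), false) ∨ ∃ s, l ∈ treeLabels n s i}

theorem localOn_itemOpen (a : ℕ → ℕ) (n M : ℕ) (i : List Bool) :
    LocalOn (fun S => ItemOpen a S n M i) (itemLabels n i) := by
  intro S T h
  simp only [ItemOpen]
  have hr : ∀ s, reached S n s (depth (a n)) i = reached T n s (depth (a n)) i := fun s =>
    localOn_reached n s _ i S T fun l hl => h l (Or.inr ⟨s, hl⟩)
  simp only [hr, h _ (Or.inl rfl)]

theorem disjoint_itemLabels {n m : ℕ} {i j : List Bool} (h : i.length = j.length)
    (hne : i ≠ j) : Disjoint (itemLabels n i) (itemLabels m j) := by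
  have key : ∀ {n : ℕ} {i : List Bool} {l : Label}, l ∈ itemLabels n i → ∃ z, l.1.2.2 = z ++ i := by
    rintro n i l (rfl | ⟨s, z, -, rfl⟩)
    · exact ⟨[], rfl⟩
    · exact ⟨z, rfl⟩
  rw [Set.disjoint_left]
  intro l h1 h2
  obtain ⟨z, hz⟩ := key h1
  obtain ⟨z', hz'⟩ := key h2
  exact hne (List.append_inj' (hz.symm.trans hz') h).2

/-- The labels of the edges of the items of a gap, all roots being allowed. -/
def gapLabels (n : ℕ) : Set Label := {l | l.1.1 = n ∧ l.2 = false}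

theorem itemLabels_subset (n : ℕ) (i : List Bool) : itemLabels n i ⊆ gapLabels n := by
  rintro l (rfl | ⟨s, z, -, rfl⟩) <;> exact ⟨rfl, rfl⟩

theorem localOn_gapClosed (a : ℕ → ℕ) (n : ℕ) :
    LocalOn (fun S => GapClosed a S n) (gapLabels n) := by
  intro S T h
  simp only [GapClosed]
  refine propext (forall_congr' fun i => imp_congr_right fun _ => not_congr (iff_of_eq ?_))
  exact localOn_itemOpen a n 1 i S T fun l hl => h l (itemLabels_subset n i hl)

/-! ### Percolation on the labels -/

/-- Independent labels, each of which is open with probability `q`. -/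
noncomputable def labelMeasure (q : I) : Measure (Label → Bool) :=
  Measure.infinitePi fun _ => edgeLaw q

instance (q : I) : IsProbabilityMeasure (labelMeasure q) := by
  unfold labelMeasure; infer_instance

/-- The set of open labels. -/
def openLabels (ξ : Label → Bool) : Set Label := {l | ξ l ∈ ({true} : Set Bool)}

theorem measurableSet_mem_openLabels (l : Label) :
    MeasurableSet {ξ : Label → Bool | l ∈ openLabels ξ} :=
  measurable_pi_apply l (measurableSet_singleton true)

theorem edgeLaw_real_true (q : I) : (edgeLaw q).real {true} = q := by
  classical
  rw [edgeLaw, bernoulliMeasure_real_apply _ (measurableSet_singleton _)]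
  simp

theorem edgeLaw_real_false (q : I) : (edgeLaw q).real {false} = 1 - q := by
  classical
  rw [edgeLaw, bernoulliMeasure_real_apply _ (measurableSet_singleton _)]
  simp

theorem labelMeasure_real_subset (q : I) (F : Finset Label) :
    (labelMeasure q).real {ξ | ∀ l ∈ F, l ∈ openLabels ξ} = (q : ℝ) ^ F.card := by
  have h : {ξ : Label → Bool | ∀ l ∈ F, l ∈ openLabels ξ}
      = Set.pi (F : Set Label) fun _ => ({true} : Set Bool) := by
    ext ξ; simp [openLabels]
  rw [h, labelMeasure, measureReal_def,
    Measure.infinitePi_pi _ (fun _ _ => measurableSet_singleton _),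
    ENNReal.toReal_prod]
  simp only [← measureReal_def, edgeLaw_real_true, Finset.prod_const]

theorem labelMeasure_real_mem (q : I) (l : Label) :
    (labelMeasure q).real {ξ | l ∈ openLabels ξ} = q := by
  simpa using labelMeasure_real_subset q {l}

/-- The survival probability of a Galton-Watson process with `Binomial(2, q)` offspring after one
more generation, in terms of the present one. -/
def branch (q u : ℝ) : ℝ := 1 - (1 - q * u) ^ 2

theorem card_reached_succ (S : Set Label) [DecidablePred (· ∈ S)] (n : ℕ) (s : Bool) (d : ℕ)
    (w : List Bool) :
    (reached S n s (d + 1) w).card =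
      (if ((n, s, true :: w), false) ∈ S then (reached S n s d (true :: w)).card else 0) +
      (if ((n, s, false :: w), false) ∈ S then (reached S n s d (false :: w)).card else 0) := by
  classical
  set D : Bool → Finset (List Bool) := fun b =>
    if ((n, s, b :: w), false) ∈ S then (reached S n s d (b :: w)).image (· ++ [b]) else ∅ with hD
  have hmem : ∀ b y, y ∈ D b ↔ ∃ z, y = z ++ [b] ∧ z.length = d ∧ PathOpen S n s y w := by
    intro b y
    by_cases h : ((n, s, b :: w), false) ∈ S
    · simp only [hD, h, if_true, Finset.mem_image, mem_reached]
      constructor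
      · rintro ⟨z, ⟨hz, hp⟩, rfl⟩
        exact ⟨z, rfl, hz, pathOpen_append.2 ⟨hp, h, trivial⟩⟩
      · rintro ⟨z, rfl, hz, hp⟩
        exact ⟨z, ⟨hz, (pathOpen_append.1 hp).1⟩, rfl⟩
    · simp only [hD, h, if_false, Finset.notMem_empty, false_iff]
      rintro ⟨z, rfl, -, hp⟩
      exact h (pathOpen_append.1 hp).2.1
  have hunion : reached S n s (d + 1) w = D true ∪ D false := by
    ext y
    rw [Finset.mem_union, hmem, hmem, mem_reached]
    constructor
    · rintro ⟨hy, hp⟩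
      obtain ⟨z, b, rfl⟩ : ∃ z b, y = z ++ [b] := by
        have hne : y ≠ [] := by rintro rfl; simp at hy
        exact ⟨y.dropLast, y.getLast hne, (List.dropLast_append_getLast hne).symm⟩
      have hz : z.length = d := by simpa using hy
      cases b
      · exact Or.inr ⟨z, rfl, hz, hp⟩
      · exact Or.inl ⟨z, rfl, hz, hp⟩
    · rintro (⟨z, rfl, hz, hp⟩ | ⟨z, rfl, hz, hp⟩) <;> exact ⟨by simp [hz], hp⟩
  have hdisj : Disjoint (D true) (D false) := by
    rw [Finset.disjoint_left]
    intro y h1 h2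
    obtain ⟨z, rfl, -⟩ := (hmem _ _).1 h1
    obtain ⟨z', h, -⟩ := (hmem _ _).1 h2
    simpa using (List.append_inj' h rfl).2
  have hcard : ∀ b, (D b).card =
      if ((n, s, b :: w), false) ∈ S then (reached S n s d (b :: w)).card else 0 := by
    intro b
    simp only [hD]
    split_ifs
    · exact Finset.card_image_of_injective _ fun u v h => List.append_cancel_right h
    · rfl
  rw [hunion, Finset.card_union_of_disjoint hdisj, hcard, hcard]

/-- The labels of the edges below the child `b :: w` of `w`, including the edge to that child. -/
def branchLabels (n : ℕ) (s : Bool) (w : List Bool) (b : Bool) : Set Label :=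
  {l | ∃ z : List Bool, l = ((n, s, z ++ b :: w), false)}

theorem treeLabels_subset_branchLabels (n : ℕ) (s : Bool) (w : List Bool) (b : Bool) :
    treeLabels n s (b :: w) ⊆ branchLabels n s w b := fun _ ⟨z, _, h⟩ => ⟨z, h⟩

theorem disjoint_branchLabels (n : ℕ) (s : Bool) (w : List Bool) :
    Disjoint (branchLabels n s w true) (branchLabels n s w false) := by
  rw [Set.disjoint_left]
  rintro _ ⟨z, rfl⟩ ⟨z', h⟩
  simp only [Prod.mk.injEq, true_and, and_true] at h
  have := (List.append_inj' h rfl).2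
  simp at this

theorem notMem_treeLabels (n : ℕ) (s s' : Bool) (w : List Bool) :
    ((n, s, w), false) ∉ treeLabels n s' w := by
  rintro ⟨z, hz, h⟩
  simp only [Prod.mk.injEq, true_and, and_true] at h
  exact hz (by simpa using h.2)

/-- The generating function of the number of nodes that are reached `d` generations below. -/
theorem integral_pow_card_reached (q : I) {x : ℝ} (hx0 : 0 ≤ x) (hx1 : x ≤ 1) (n : ℕ) (s : Bool)
    (d : ℕ) (w : List Bool) :
    ∫ ξ, (1 - x) ^ (reached (openLabels ξ) n s d w).card ∂labelMeasure q
      = 1 - (branch q)^[d] x := by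
  classical
  have hb : ∀ k : ℕ, (1 - x) ^ k ∈ Set.Icc (0 : ℝ) 1 := fun k =>
    ⟨pow_nonneg (by linarith) k, pow_le_one₀ (by linarith) (by linarith)⟩
  induction d generalizing w with
  | zero =>
    have h0 : ∀ S, (reached S n s 0 w).card = 1 := fun S =>
      Finset.card_eq_one.2 ⟨[], by
        ext y
        simp only [mem_reached, List.length_eq_zero_iff, Finset.mem_singleton]
        exact ⟨fun h => h.1, fun h => ⟨h, h ▸ trivial⟩⟩⟩
    simp [h0]
  | succ d ih =>
    -- `g b` is the contribution of the child `b :: w`: it is `Z b` if the edge to the child is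
    -- open, and `1` otherwise
    set Z : Bool → (Label → Bool) → ℝ := fun b ξ =>
      (1 - x) ^ (reached (openLabels ξ) n s d (b :: w)).card with hZ
    set o : Bool → (Label → Bool) → ℝ := fun b ξ =>
      if ((n, s, b :: w), false) ∈ openLabels ξ then 1 else 0 with ho
    have hZm : ∀ b, Measurable (Z b) := fun b =>
      (measurable_of_countable fun k : ℕ => (1 - x) ^ k).comp
        (measurable_card_reached measurableSet_mem_openLabels n s d (b :: w))
    have hom : ∀ b, Measurable (o b) := fun b =>
      Measurable.ite (measurableSet_mem_openLabels _) measurable_const measurable_const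
    have hZd : ∀ b, DependsOn (Z b) (treeLabels n s (b :: w)) := fun b =>
      LocalOn.dependsOn (f := fun S => (1 - x) ^ (reached S n s d (b :: w)).card)
        (fun S T h => by simp only [localOn_reached n s d (b :: w) S T h]) {true}
    have hod : ∀ b, DependsOn (o b) ({((n, s, b :: w), false)} : Set Label) := by
      intro b ξ ξ' h
      have := h _ rfl
      simp [ho, openLabels, this]
    have hind : ∀ b, IndepFun (o b) (fun ξ => 1 - Z b ξ) (labelMeasure q) := fun b =>
      indepFun_of_dependsOn (edgeLaw q) (hom b) (measurable_const.sub (hZm b)) (hod b)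
        (fun ξ ξ' h => by rw [hZd b h])
        (Set.disjoint_singleton_left.2 (notMem_treeLabels n s s (b :: w)))
    have hZint : ∀ b, Integrable (Z b) (labelMeasure q) := fun b =>
      Integrable.of_bound (hZm b).aestronglyMeasurable 1 (.of_forall fun ξ => by
        rw [Real.norm_eq_abs, abs_of_nonneg (hb _).1]; exact (hb _).2)
    have hoint : ∀ b, ∫ ξ, o b ξ ∂labelMeasure q = q := by
      intro b
      have : o b = Set.indicator {ξ | ((n, s, b :: w), false) ∈ openLabels ξ} 1 := by
        ext ξ; simp [ho, Set.indicator_apply]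
      rw [this, integral_indicator_one (measurableSet_mem_openLabels _), labelMeasure_real_mem]
    set g : Bool → (Label → Bool) → ℝ := fun b ξ => 1 - o b ξ * (1 - Z b ξ) with hg
    have hgint : ∀ b, ∫ ξ, g b ξ ∂labelMeasure q = 1 - q * (branch q)^[d] x := by
      intro b
      have h1 : Integrable (fun ξ => o b ξ * (1 - Z b ξ)) (labelMeasure q) := by
        refine Integrable.of_bound ((hom b).mul (measurable_const.sub (hZm b))).aestronglyMeasurable
          1 (.of_forall fun ξ => ?_)
        have := hb (reached (openLabels ξ) n s d (b :: w)).card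
        simp only [ho, hZ]
        rw [Real.norm_eq_abs, abs_le]
        split_ifs <;> constructor <;> linarith [this.1, this.2]
      have h2 := (hind b).integral_fun_mul_eq_mul_integral (hom b).aestronglyMeasurable
        (measurable_const.sub (hZm b)).aestronglyMeasurable
      simp only [hg]
      rw [integral_sub (integrable_const _) h1, h2, hoint,
        integral_sub (integrable_const _) (hZint b)]
      simp only [hZ, ih]
      simp
    have hgm : ∀ b, Measurable (g b) := fun b =>
      measurable_const.sub ((hom b).mul (measurable_const.sub (hZm b)))
    have hgd : ∀ b, DependsOn (g b) (branchLabels n s w b) := by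
      intro b ξ ξ' h
      have h1 := hod b (x := ξ) (y := ξ') (fun l hl => h l ⟨[], by simpa using hl⟩)
      have h2 := hZd b (x := ξ) (y := ξ')
        (fun l hl => h l (treeLabels_subset_branchLabels n s w b hl))
      simp only [hg, h1, h2]
    have hgind : IndepFun (g true) (g false) (labelMeasure q) :=
      indepFun_of_dependsOn (edgeLaw q) (hgm _) (hgm _) (hgd _) (hgd _)
        (disjoint_branchLabels n s w)
    have hprod : ∀ ξ, (1 - x) ^ (reached (openLabels ξ) n s (d + 1) w).card
        = g true ξ * g false ξ := by
      intro ξ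
      have : ∀ b, g b ξ = (1 - x) ^ (if ((n, s, b :: w), false) ∈ openLabels ξ then
          (reached (openLabels ξ) n s d (b :: w)).card else 0) := by
        intro b
        simp only [hg, ho, hZ]
        split_ifs <;> simp
      rw [card_reached_succ, pow_add, this, this]
    simp only [hprod]
    rw [hgind.integral_fun_mul_eq_mul_integral (hgm _).aestronglyMeasurable
      (hgm _).aestronglyMeasurable, hgint, hgint, Function.iterate_succ_apply', branch]
    ring

theorem labelMeasure_one_le_card_reached (q : I) (n : ℕ) (s : Bool) (d : ℕ) (w : List Bool) :
    (labelMeasure q).real {ξ | 1 ≤ (reached (openLabels ξ) n s d w).card} = (branch q)^[d] 1 := by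
  have h := integral_pow_card_reached q zero_le_one le_rfl n s d w
  have hm : MeasurableSet {ξ : Label → Bool | 1 ≤ (reached (openLabels ξ) n s d w).card} :=
    measurable_card_reached measurableSet_mem_openLabels n s d w measurableSet_Ici
  have : (fun ξ : Label → Bool => (1 - 1 : ℝ) ^ (reached (openLabels ξ) n s d w).card)
      = Set.indicator {ξ | 1 ≤ (reached (openLabels ξ) n s d w).card}ᶜ 1 := by
    ext ξ
    simp only [Set.indicator_apply, Set.mem_compl_iff, Set.mem_ofPred_eq, Nat.one_le_iff_ne_zero]
    by_cases hc : (reached (openLabels ξ) n s d w).card = 0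
    · simp only [hc, pow_zero, ne_eq, not_true_eq_false, not_false_eq_true, if_true, Pi.one_apply]
    · simp only [hc, ne_eq, not_true_eq_false, not_false_eq_true, if_false, sub_self, zero_pow]
  rw [this, integral_indicator_one hm.compl, probReal_compl_eq_one_sub hm] at h
  linarith

/-- A lower tail bound from the generating function: by Bernoulli's inequality, `(1 - x) ^ j` is
at least `1 - M * x` for `j < M`. -/
theorem le_labelMeasure_le_card_reached (q : I) {x : ℝ} (hx0 : 0 ≤ x) (hx1 : x ≤ 1) (M : ℕ)
    (n : ℕ) (s : Bool) (d : ℕ) (w : List Bool) :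
    (branch q)^[d] x - M * x
      ≤ (labelMeasure q).real {ξ | M ≤ (reached (openLabels ξ) n s d w).card} := by
  have h := integral_pow_card_reached q hx0 hx1 n s d w
  have hm : MeasurableSet {ξ : Label → Bool | M ≤ (reached (openLabels ξ) n s d w).card} :=
    measurable_card_reached measurableSet_mem_openLabels n s d w measurableSet_Ici
  have hb : ∀ k : ℕ, (1 - x) ^ k ∈ Set.Icc (0 : ℝ) 1 := fun k =>
    ⟨pow_nonneg (by linarith) k, pow_le_one₀ (by linarith) (by linarith)⟩
  have hle : ∫ ξ, (Set.indicator {ξ : Label → Bool | M ≤ (reached (openLabels ξ) n s d w).card}ᶜ 1 ξ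
      - M * x) ∂labelMeasure q
        ≤ ∫ ξ, (1 - x) ^ (reached (openLabels ξ) n s d w).card ∂labelMeasure q := by
    refine integral_mono ?_ ?_ fun ξ => ?_
    · exact ((integrable_const _).indicator hm.compl).sub (integrable_const _)
    · refine Integrable.of_bound ((measurable_of_countable fun k : ℕ => (1 - x) ^ k).comp
        (measurable_card_reached measurableSet_mem_openLabels n s d w)).aestronglyMeasurable 1
        (.of_forall fun ξ => ?_)
      rw [Real.norm_eq_abs, abs_of_nonneg (hb _).1]
      exact (hb _).2
    · set k := (reached (openLabels ξ) n s d w).card with hk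
      by_cases hc : M ≤ k
      · have : (0 : ℝ) ≤ M * x := by positivity
        simp only [Set.indicator_apply, Set.mem_compl_iff, Set.mem_ofPred_eq, ← hk, hc,
          not_true_eq_false, if_false]
        linarith [(hb k).1]
      · have h1 : (1 : ℝ) + k * (-x) ≤ (1 + -x) ^ k := one_add_mul_le_pow (by linarith) k
        have h2 : (k : ℝ) * x ≤ M * x := by
          gcongr
          exact_mod_cast (not_le.1 hc).le
        simp only [Set.indicator_apply, Set.mem_compl_iff, Set.mem_ofPred_eq, ← hk, hc,
          not_false_eq_true, if_true, Pi.one_apply]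
        rw [← sub_eq_add_neg] at h1
        linarith
  rw [h, integral_sub ((integrable_const _).indicator hm.compl) (integrable_const _),
    integral_indicator_one hm.compl, probReal_compl_eq_one_sub hm] at hle
  simp only [integral_const, probReal_univ, smul_eq_mul, one_mul] at hle
  linarith

/-! ### Gaps and hubs at a fixed time -/

theorem disjoint_treeLabels (n m : ℕ) {s t : Bool} (h : s ≠ t) (w w' : List Bool) :
    Disjoint (treeLabels n s w) (treeLabels m t w') := by
  rw [Set.disjoint_left]
  rintro _ ⟨z, -, rfl⟩ ⟨z', -, h'⟩
  simp only [Prod.mk.injEq] at h'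
  exact h h'.1.2.1

theorem labelMeasure_itemOpen_eq (q : I) (a : ℕ → ℕ) (n M : ℕ) (i : List Bool) :
    (labelMeasure q).real {ξ | ItemOpen a (openLabels ξ) n M i} = q *
      ((labelMeasure q).real {ξ | M ≤ (reached (openLabels ξ) n true (depth (a n)) i).card} *
      (labelMeasure q).real {ξ | M ≤ (reached (openLabels ξ) n false (depth (a n)) i).card}) := by
  set B : Bool → Set (Label → Bool) := fun s =>
    {ξ | M ≤ (reached (openLabels ξ) n s (depth (a n)) i).card} with hB
  have hBm : ∀ s, MeasurableSet (B s) := fun s =>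
    measurable_card_reached measurableSet_mem_openLabels n s _ i measurableSet_Ici
  have hBd : ∀ s, DependsOn (fun ξ => ξ ∈ B s) (treeLabels n s i) := fun s =>
    LocalOn.dependsOn (f := fun S => M ≤ (reached S n s (depth (a n)) i).card)
      (fun S T h => by simp only [localOn_reached n s _ i S T h]) {true}
  have hset : {ξ | ItemOpen a (openLabels ξ) n M i}
      = {ξ | ((n, true, i), false) ∈ openLabels ξ} ∩ (B true ∩ B false) := by
    ext ξ
    simp only [ItemOpen, Bool.forall_bool, hB]
    exact and_congr_right fun _ => and_comm
  have hod : DependsOn (fun ξ : Label → Bool => ξ ∈ {ξ | ((n, true, i), false) ∈ openLabels ξ})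
      ({((n, true, i), false)} : Set Label) := by
    intro ξ ξ' h
    have := h _ rfl
    simp [openLabels, this]
  have h12 : DependsOn (fun ξ => ξ ∈ B true ∩ B false)
      (treeLabels n true i ∪ treeLabels n false i) := by
    intro ξ ξ' h
    have h1 := hBd true (x := ξ) (y := ξ') fun l hl => h l (Or.inl hl)
    have h2 := hBd false (x := ξ) (y := ξ') fun l hl => h l (Or.inr hl)
    simp only [Set.mem_inter_iff, h1, h2]
  rw [hset, ← labelMeasure_real_mem q ((n, true, i), false)]
  simp only [measureReal_def, labelMeasure]
  rw [measure_inter_of_dependsOn (edgeLaw q) (measurableSet_mem_openLabels _)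
    ((hBm _).inter (hBm _)) hod h12, measure_inter_of_dependsOn (edgeLaw q) (hBm _) (hBm _)
    (hBd _) (hBd _) (disjoint_treeLabels n n (by simp) i i), ENNReal.toReal_mul, ENNReal.toReal_mul]
  rw [Set.disjoint_singleton_left]
  exact fun h => h.elim (notMem_treeLabels n true true i) (notMem_treeLabels n true false i)

/-- The probability that an item of a gap with `2 ^ k` items fails to join the two inspected
levels. -/
noncomputable def deadProb (q : ℝ) (k : ℕ) : ℝ := 1 - q * ((branch q)^[depth k] 1) ^ 2

theorem labelMeasure_itemOpen_one (q : I) (a : ℕ → ℕ) (n : ℕ) (i : List Bool) :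
    (labelMeasure q).real {ξ | ItemOpen a (openLabels ξ) n 1 i} = 1 - deadProb q (a n) := by
  rw [labelMeasure_itemOpen_eq, labelMeasure_one_le_card_reached, labelMeasure_one_le_card_reached,
    deadProb]
  ring

/-- The items of a gap are independent, for arbitrary states of the edges. -/
theorem measureReal_forall_item {α : Type*} [MeasurableSpace α] (κ : Measure α)
    [IsProbabilityMeasure κ] (n k : ℕ) (E : List Bool → Set (Label → α))
    (hE : ∀ i, MeasurableSet (E i)) (hd : ∀ i, DependsOn (fun ξ => ξ ∈ E i) (itemLabels n i)) :
    (Measure.infinitePi fun _ : Label => κ).real {ξ | ∀ i : List Bool, i.length = k → ξ ∈ E i}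
      = ∏ i ∈ words k, (Measure.infinitePi fun _ : Label => κ).real (E i) := by
  have : {ξ | ∀ i : List Bool, i.length = k → ξ ∈ E i} = ⋂ i ∈ words k, E i := by
    ext ξ; simp [mem_words]
  rw [this, measureReal_def, measure_biInter_of_dependsOn κ (words k) hE hd, ENNReal.toReal_prod]
  · rfl
  · intro i hi j hj hij
    rw [mem_words] at hi hj
    exact disjoint_itemLabels (hi.trans hj.symm) hij

theorem dependsOn_not_itemOpen {α : Type*} (a : ℕ → ℕ) (n M : ℕ) (i : List Bool) (o : Set α) :
    DependsOn (fun ξ : Label → α => ξ ∈ {ξ | ¬ ItemOpen a {l | ξ l ∈ o} n M i})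
      (itemLabels n i) :=
  LocalOn.dependsOn (f := fun S => ¬ ItemOpen a S n M i)
    (fun S T h => congrArg Not (localOn_itemOpen a n M i S T h)) o

theorem labelMeasure_gapClosed (q : I) (a : ℕ → ℕ) (n : ℕ) :
    (labelMeasure q).real {ξ | GapClosed a (openLabels ξ) n} = deadProb q (a n) ^ 2 ^ a n := by
  have hm : ∀ i, MeasurableSet {ξ | ItemOpen a (openLabels ξ) n 1 i} :=
    measurableSet_itemOpen measurableSet_mem_openLabels a n 1
  have h := measureReal_forall_item (edgeLaw q) n (a n)
    (fun i => {ξ | ¬ ItemOpen a (openLabels ξ) n 1 i}) (fun i => (hm i).compl)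
    (fun i => dependsOn_not_itemOpen a n 1 i {true})
  refine h.trans ?_
  rw [← card_words (a n), ← Finset.prod_const]
  refine Finset.prod_congr rfl fun i _ => ?_
  change (labelMeasure q).real {ξ | ItemOpen a (openLabels ξ) n 1 i}ᶜ = _
  rw [probReal_compl_eq_one_sub (hm i), labelMeasure_itemOpen_one]
  ring

theorem labelMeasure_not_gapOpen_le (q : I) (a : ℕ → ℕ) (M n : ℕ) {b : ℝ} (hb : 0 ≤ b)
    (h : ∀ s i, b ≤ (labelMeasure q).real
      {ξ | M ≤ (reached (openLabels ξ) n s (depth (a n)) i).card}) :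
    (labelMeasure q).real {ξ | ¬ GapOpen a (openLabels ξ) M n} ≤ (1 - q * b ^ 2) ^ 2 ^ a n := by
  have hm : ∀ i, MeasurableSet {ξ | ItemOpen a (openLabels ξ) n M i} :=
    measurableSet_itemOpen measurableSet_mem_openLabels a n M
  have hprod := measureReal_forall_item (edgeLaw q) n (a n)
    (fun i => {ξ | ¬ ItemOpen a (openLabels ξ) n M i}) (fun i => (hm i).compl)
    (fun i => dependsOn_not_itemOpen a n M i {true})
  have hset : {ξ | ¬ GapOpen a (openLabels ξ) M n} = {ξ | ∀ i : List Bool, i.length = a n →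
      ξ ∈ {ξ | ¬ ItemOpen a (openLabels ξ) n M i}} := by
    ext ξ; simp [GapOpen]
  rw [hset]
  refine hprod.trans_le ?_
  rw [← card_words (a n), ← Finset.prod_const]
  refine Finset.prod_le_prod (fun _ _ => measureReal_nonneg) fun i _ => ?_
  change (labelMeasure q).real {ξ | ItemOpen a (openLabels ξ) n M i}ᶜ ≤ _
  rw [probReal_compl_eq_one_sub (hm i), labelMeasure_itemOpen_eq]
  have hq : (0 : ℝ) ≤ q := q.2.1
  have h1 := h true i
  have h2 := h false i
  have : b ^ 2 ≤ (labelMeasure q).real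
      {ξ | M ≤ (reached (openLabels ξ) n true (depth (a n)) i).card} * (labelMeasure q).real
      {ξ | M ≤ (reached (openLabels ξ) n false (depth (a n)) i).card} := by
    rw [sq]; exact mul_le_mul h1 h2 hb (hb.trans h1)
  have := mul_le_mul_of_nonneg_left this hq
  linarith

/-- The labels on the path from `w` to `y ++ w`. -/
def pathLabels (n : ℕ) (s : Bool) : List Bool → List Bool → List Label
  | [], _ => []
  | b :: y, w => ((n, s, b :: (y ++ w)), false) :: pathLabels n s y w

theorem pathOpen_iff (S : Set Label) (n : ℕ) (s : Bool) (y w : List Bool) :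
    PathOpen S n s y w ↔ ∀ l ∈ pathLabels n s y w, l ∈ S := by
  induction y with
  | nil => simp [PathOpen, pathLabels]
  | cons b y ih => simp [PathOpen, pathLabels, ih]

theorem length_pathLabels (n : ℕ) (s : Bool) (y w : List Bool) :
    (pathLabels n s y w).length = y.length := by
  induction y with
  | nil => rfl
  | cons b y ih => simp [pathLabels, ih]

theorem pow_le_labelMeasure_linkOpen (q : I) (n : ℕ) (x y : List Bool) :
    (q : ℝ) ^ (y.length + x.length + 1) ≤ (labelMeasure q).real
      {ξ | LinkOpen (openLabels ξ) n x y} := by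
  classical
  set F : Finset Label := ((pathLabels n true y x) ++
    (((n + 1, false, x ++ y), true) :: pathLabels (n + 1) false x y)).toFinset with hF
  have hset : {ξ | LinkOpen (openLabels ξ) n x y} = {ξ | ∀ l ∈ F, l ∈ openLabels ξ} := by
    ext ξ
    simp only [LinkOpen, pathOpen_iff, hF, List.mem_toFinset, List.mem_append, List.mem_cons,
      Set.mem_ofPred_eq]
    aesop
  rw [hset, labelMeasure_real_subset]
  refine pow_le_pow_of_le_one q.2.1 q.2.2 ((List.toFinset_card_le _).trans ?_)
  simp only [List.length_append, List.length_cons, length_pathLabels]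
  omega

/-- The labels on which the link between `x` and `y` depends. -/
def linkLabels (n : ℕ) (x y : List Bool) : Set Label :=
  treeLabels n true x ∪ treeLabels (n + 1) false y ∪ {((n + 1, false, x ++ y), true)}

theorem localOn_linkOpen (n : ℕ) (x y : List Bool) :
    LocalOn (fun S => LinkOpen S n x y) (linkLabels n x y) := by
  intro S T h
  have h1 := localOn_pathOpen n true y x S T fun l hl => h l (Or.inl (Or.inl hl))
  have h2 := localOn_pathOpen (n + 1) false x y S T fun l hl => h l (Or.inl (Or.inr hl))
  have h3 := h _ (Or.inr rfl)
  simp only at h1 h2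
  simp only [LinkOpen, h1, h2, h3]

theorem disjoint_linkLabels {n : ℕ} {x y x' y' : List Bool} (hx : x.length = x'.length)
    (hy : y.length = y'.length) (hxx : x ≠ x') (hyy : y ≠ y') :
    Disjoint (linkLabels n x y) (linkLabels n x' y') := by
  rw [Set.disjoint_left]
  rintro l ((⟨z, -, rfl⟩ | ⟨z, -, rfl⟩) | rfl) ((⟨z', -, h⟩ | ⟨z', -, h⟩) | h) <;>
    simp only [Set.mem_singleton_iff, Prod.mk.injEq, true_and, and_true, Bool.false_eq_true,
      Bool.true_eq_false, false_and, and_false] at h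
  · exact hxx (List.append_inj' h hx).2
  · exact hyy (List.append_inj' h hy).2
  · exact hxx (List.append_inj h hx).1

/-- The labels that can be inspected when the trees that lead into a hub are explored down to the
inspected levels. -/
def exploredLabels (n c c' : ℕ) : Set Label :=
  {l | l.2 = false ∧ (l.1.1 = n → l.1.2.2.length ≤ c) ∧ (l.1.1 = n + 1 → l.1.2.2.length ≤ c')}

theorem disjoint_exploredLabels {n : ℕ} {x y : List Bool} :
    Disjoint (exploredLabels n x.length y.length) (linkLabels n x y) := by
  rw [Set.disjoint_left]
  rintro l ⟨h0, h1, h2⟩ ((⟨z, hz, rfl⟩ | ⟨z, hz, rfl⟩) | rfl)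
  · have := h1 rfl
    have := List.length_pos_iff.2 hz
    simp only [List.length_append] at *
    omega
  · have := h2 rfl
    have := List.length_pos_iff.2 hz
    simp only [List.length_append] at *
    omega
  · simp at h0

theorem reached_subset_words (S : Set Label) (n : ℕ) (s : Bool) (d : ℕ) (w : List Bool) :
    reached S n s d w ⊆ words d := fun _ h => mem_words.2 (mem_reached.1 h).1

theorem reached_congr {S T : Set Label} {n : ℕ} {s : Bool} {d : ℕ} {w : List Bool}
    (h : ∀ z : List Bool, z.length ≤ d →
      (((n, s, z ++ w), false) ∈ S ↔ ((n, s, z ++ w), false) ∈ T)) :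
    reached S n s d w = reached T n s d w := by
  have key : ∀ y : List Bool, y.length ≤ d → (PathOpen S n s y w ↔ PathOpen T n s y w) := by
    intro y hy
    induction y with
    | nil => rfl
    | cons b y ih =>
      simp only [List.length_cons] at hy
      exact and_congr (h (b :: y) (by simpa using hy)) (ih (by omega))
  ext y
  simp only [mem_reached]
  exact and_congr_right fun hy => key y hy.le

/-- Two trees that reach many nodes of the inspected levels are linked: choose `N` nodes on each
side, match them, and use that the `N` links between matched nodes are disjoint from each other and
from the explored parts of the trees. -/
theorem labelMeasure_not_hubOpen_pair_le (q : I) (n k k' d d' M M' N : ℕ) (hM : N ≤ M)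
    (hM' : N ≤ M') (i j : List Bool) (hi : i.length = k) (hj : j.length = k') :
    (labelMeasure q) {ξ | (M ≤ (reached (openLabels ξ) n true d i).card ∧
      M' ≤ (reached (openLabels ξ) (n + 1) false d' j).card) ∧
      ∀ x ∈ reached (openLabels ξ) n true d i, ∀ y ∈ reached (openLabels ξ) (n + 1) false d' j,
        ¬ LinkOpen (openLabels ξ) n (x ++ i) (y ++ j)}
      ≤ ENNReal.ofReal ((1 - (q : ℝ) ^ ((k + d) + (k' + d') + 1)) ^ N) := by
  set ρ : (Label → Bool) → Finset (List Bool) × Finset (List Bool) := fun ξ =>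
    (reached (openLabels ξ) n true d i, reached (openLabels ξ) (n + 1) false d' j) with hρ
  have hρm : ∀ b, MeasurableSet {ξ | ρ ξ = b} := by
    rintro ⟨A, B⟩
    simp only [hρ, Prod.mk.injEq]
    exact (measurableSet_reached_eq measurableSet_mem_openLabels n true d i A).inter
      (measurableSet_reached_eq measurableSet_mem_openLabels (n + 1) false d' j B)
  have hρd : ∀ b, DependsOn (fun ξ => ξ ∈ {ξ | ρ ξ = b})
      (exploredLabels n (k + d) (k' + d')) := by
    intro b ξ ξ' h
    have h1 : reached (openLabels ξ) n true d i = reached (openLabels ξ') n true d i := by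
      refine reached_congr fun z hz => ?_
      have := h ((n, true, z ++ i), false) ⟨rfl, fun _ => by simp; omega, fun h => by simp at h⟩
      simp [openLabels, this]
    have h2 : reached (openLabels ξ) (n + 1) false d' j
        = reached (openLabels ξ') (n + 1) false d' j := by
      refine reached_congr fun z hz => ?_
      have := h ((n + 1, false, z ++ j), false)
        ⟨rfl, fun h => by simp at h, fun _ => by simp; omega⟩
      simp [openLabels, this]
    simp only [Set.mem_ofPred_eq, hρ, h1, h2]
  refine measure_le_of_conditioning (labelMeasure q) ((words d).powerset ×ˢ (words d').powerset)
    ρ ?_ hρm (fun b => (M ≤ b.1.card ∧ M' ≤ b.2.card) ∧ b.1 ⊆ words d ∧ b.2 ⊆ words d')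
    (fun b => {ξ | ∀ x ∈ b.1, ∀ y ∈ b.2, ¬ LinkOpen (openLabels ξ) n (x ++ i) (y ++ j)}) _ ?_
    |>.trans' (measure_mono ?_)
  · intro ξ
    simp only [hρ, Finset.mem_product, Finset.mem_powerset]
    exact ⟨reached_subset_words _ _ _ _ _, reached_subset_words _ _ _ _ _⟩
  · rintro ⟨A, B⟩ ⟨⟨hA, hB⟩, hAw, hBw⟩
    simp only at hA hB hAw hBw
    obtain ⟨f⟩ : Nonempty (Fin N ↪ A) :=
      Function.Embedding.nonempty_of_card_le (by simpa using hM.trans hA)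
    obtain ⟨g⟩ : Nonempty (Fin N ↪ B) :=
      Function.Embedding.nonempty_of_card_le (by simpa using hM'.trans hB)
    have hfl : ∀ m, (f m).1.length = d := fun m => mem_words.1 (hAw (f m).2)
    have hgl : ∀ m, (g m).1.length = d' := fun m => mem_words.1 (hBw (g m).2)
    set E : Fin N → Set (Label → Bool) := fun m =>
      {ξ | ¬ LinkOpen (openLabels ξ) n ((f m).1 ++ i) ((g m).1 ++ j)} with hE
    have hEm : ∀ m, MeasurableSet (E m) := fun m =>
      (measurableSet_linkOpen measurableSet_mem_openLabels _ _ _).compl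
    have hEd : ∀ m, DependsOn (fun ξ => ξ ∈ E m)
        (linkLabels n ((f m).1 ++ i) ((g m).1 ++ j)) := fun m =>
      LocalOn.dependsOn (f := fun S => ¬ LinkOpen S n ((f m).1 ++ i) ((g m).1 ++ j))
        (fun S T h => congrArg Not (localOn_linkOpen n _ _ S T h)) {true}
    have hE1 : ∀ m, (labelMeasure q) (E m)
        ≤ ENNReal.ofReal (1 - (q : ℝ) ^ ((k + d) + (k' + d') + 1)) := by
      intro m
      rw [← ofReal_measureReal]
      refine ENNReal.ofReal_le_ofReal ?_
      have h := pow_le_labelMeasure_linkOpen q n ((f m).1 ++ i) ((g m).1 ++ j)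
      change (labelMeasure q).real {ξ | LinkOpen (openLabels ξ) n _ _}ᶜ ≤ _
      rw [probReal_compl_eq_one_sub (measurableSet_linkOpen measurableSet_mem_openLabels _ _ _)]
      have hl : ((g m).1 ++ j).length + ((f m).1 ++ i).length + 1
          = (k + d) + (k' + d') + 1 := by
        simp only [List.length_append, hfl, hgl, hi, hj]; ring
      rw [hl] at h
      linarith
    have hEall : (labelMeasure q) (⋂ m ∈ (Finset.univ : Finset (Fin N)), E m)
        ≤ ENNReal.ofReal ((1 - (q : ℝ) ^ ((k + d) + (k' + d') + 1)) ^ N) := by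
      rw [labelMeasure, measure_biInter_of_dependsOn (edgeLaw q) _ hEm hEd]
      · calc _ ≤ ∏ m : Fin N, ENNReal.ofReal (1 - (q : ℝ) ^ ((k + d) + (k' + d') + 1)) :=
              Finset.prod_le_prod' fun m _ => hE1 m
          _ = _ := by
              rw [Finset.prod_const, Finset.card_univ, Fintype.card_fin, ENNReal.ofReal_pow]
              have : (q : ℝ) ^ ((k + d) + (k' + d') + 1) ≤ 1 := pow_le_one₀ q.2.1 q.2.2
              linarith
      · intro m _ m' _ hmm
        refine disjoint_linkLabels (by simp [hfl]) (by simp [hgl]) ?_ ?_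
        · exact fun h => hmm (f.injective (Subtype.ext (List.append_cancel_right h)))
        · exact fun h => hmm (g.injective (Subtype.ext (List.append_cancel_right h)))
    have hsub : {ξ | ∀ x ∈ A, ∀ y ∈ B, ¬ LinkOpen (openLabels ξ) n (x ++ i) (y ++ j)}
        ⊆ ⋂ m ∈ (Finset.univ : Finset (Fin N)), E m := by
      intro ξ h
      simp only [Set.mem_iInter]
      exact fun m _ => h _ (f m).2 _ (g m).2
    have hind := measure_inter_of_dependsOn (edgeLaw q) (hρm (A, B))
      (Finset.measurableSet_biInter Finset.univ fun m _ => hEm m) (hρd (A, B))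
      (t := ⋃ m, linkLabels n ((f m).1 ++ i) ((g m).1 ++ j)) ?_ ?_
    · calc _ ≤ (labelMeasure q) ({ξ | ρ ξ = (A, B)} ∩ ⋂ m ∈ (Finset.univ : Finset (Fin N)), E m) :=
            measure_mono (Set.inter_subset_inter_right _ hsub)
        _ = _ := hind
        _ ≤ _ := mul_le_mul' le_rfl hEall
    · intro x y hxy
      simp only [Set.mem_iInter]
      refine forall_congr fun m => forall_congr fun _ => ?_
      exact hEd m fun l hl => hxy l (Set.mem_iUnion.2 ⟨m, hl⟩)
    · rw [Set.disjoint_iUnion_right]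
      intro m
      have := disjoint_exploredLabels (n := n) (x := (f m).1 ++ i) (y := (g m).1 ++ j)
      simp only [List.length_append, hfl, hgl, hi, hj] at this
      rwa [add_comm d, add_comm d'] at this
  · rintro ξ ⟨h1, h2⟩
    exact ⟨⟨h1, reached_subset_words _ _ _ _ _, reached_subset_words _ _ _ _ _⟩, h2⟩

theorem labelMeasure_not_hubOpen_le (q : I) (a : ℕ → ℕ) (M M' N n : ℕ) (hM : N ≤ M)
    (hM' : N ≤ M') :
    (labelMeasure q).real {ξ | ¬ HubOpen a (openLabels ξ) M M' n}
      ≤ 2 ^ a n * 2 ^ a (n + 1) *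
        (1 - (q : ℝ) ^ (stem (a n) + stem (a (n + 1)) + 1)) ^ N := by
  set r : ℝ := (1 - (q : ℝ) ^ (stem (a n) + stem (a (n + 1)) + 1)) ^ N with hr
  have hr0 : 0 ≤ r := by
    have : (q : ℝ) ^ (stem (a n) + stem (a (n + 1)) + 1) ≤ 1 := pow_le_one₀ q.2.1 q.2.2
    exact pow_nonneg (by linarith) _
  have hsub : {ξ | ¬ HubOpen a (openLabels ξ) M M' n} ⊆
      ⋃ p ∈ words (a n) ×ˢ words (a (n + 1)),
        {ξ | (M ≤ (reached (openLabels ξ) n true (depth (a n)) p.1).card ∧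
          M' ≤ (reached (openLabels ξ) (n + 1) false (depth (a (n + 1))) p.2).card) ∧
          ∀ x ∈ reached (openLabels ξ) n true (depth (a n)) p.1,
          ∀ y ∈ reached (openLabels ξ) (n + 1) false (depth (a (n + 1))) p.2,
          ¬ LinkOpen (openLabels ξ) n (x ++ p.1) (y ++ p.2)} := by
    intro ξ h
    simp only [HubOpen, Set.mem_ofPred_eq, not_forall, not_exists, not_and] at h
    obtain ⟨i, j, hi, hj, h1, h2, h3⟩ := h
    simp only [Set.mem_iUnion]
    exact ⟨(i, j), Finset.mem_product.2 ⟨mem_words.2 hi, mem_words.2 hj⟩, ⟨h1, h2⟩, h3⟩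
  have hle : (labelMeasure q) {ξ | ¬ HubOpen a (openLabels ξ) M M' n}
      ≤ ENNReal.ofReal (2 ^ a n * 2 ^ a (n + 1) * r) := by
    refine (measure_mono hsub).trans ((measure_biUnion_finset_le _ _).trans ?_)
    calc _ ≤ ∑ p ∈ words (a n) ×ˢ words (a (n + 1)), ENNReal.ofReal r := by
          refine Finset.sum_le_sum fun p hp => ?_
          rw [Finset.mem_product, mem_words, mem_words] at hp
          exact labelMeasure_not_hubOpen_pair_le q n (a n) (a (n + 1)) _ _ M M' N hM hM' p.1 p.2
            hp.1 hp.2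
      _ = _ := by
          rw [Finset.sum_const, Finset.card_product, card_words, card_words, nsmul_eq_mul,
            ENNReal.ofReal_mul (by positivity)]
          have : (2 ^ a n * 2 ^ a (n + 1) : ℝ) = ((2 ^ a n * 2 ^ a (n + 1) : ℕ) : ℝ) := by
            push_cast; rfl
          rw [this, ENNReal.ofReal_natCast]
  rw [measureReal_def]
  exact ENNReal.toReal_le_of_le_ofReal (by positivity) hle

/-! ### Estimates for the branching recursion -/

theorem branch_mem {q u : ℝ} (hq : q ∈ Set.Icc (0 : ℝ) 1) (hu : u ∈ Set.Icc (0 : ℝ) 1) :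
    branch q u ∈ Set.Icc (0 : ℝ) 1 := by
  have h0 : 0 ≤ q * u := mul_nonneg hq.1 hu.1
  have h1 : q * u ≤ 1 := mul_le_one₀ hq.2 hu.1 hu.2
  constructor <;> unfold branch <;> nlinarith

theorem branch_le_branch {q q' u u' : ℝ} (hq : 0 ≤ q) (hqq : q ≤ q') (hq' : q' ≤ 1) (hu : 0 ≤ u)
    (huu : u ≤ u') (hu' : u' ≤ 1) : branch q u ≤ branch q' u' := by
  have h1 : q * u ≤ q' * u' := mul_le_mul hqq huu hu (hq.trans hqq)
  have h2 : q' * u' ≤ 1 := mul_le_one₀ hq' (hu.trans huu) hu'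
  have h3 : 0 ≤ q * u := mul_nonneg hq hu
  unfold branch
  nlinarith

theorem iterate_branch_mem {q x : ℝ} (hq : q ∈ Set.Icc (0 : ℝ) 1) (hx : x ∈ Set.Icc (0 : ℝ) 1)
    (d : ℕ) : (branch q)^[d] x ∈ Set.Icc (0 : ℝ) 1 := by
  induction d with
  | zero => simpa using hx
  | succ d ih => rw [Function.iterate_succ_apply']; exact branch_mem hq ih

theorem iterate_branch_le {q q' : ℝ} (hq : 0 ≤ q) (hqq : q ≤ q') (hq' : q' ≤ 1) (d : ℕ) :
    (branch q)^[d] 1 ≤ (branch q')^[d] 1 := by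
  have h1 : (1 : ℝ) ∈ Set.Icc (0 : ℝ) 1 := ⟨zero_le_one, le_rfl⟩
  induction d with
  | zero => simp
  | succ d ih =>
    rw [Function.iterate_succ_apply', Function.iterate_succ_apply']
    exact branch_le_branch hq hqq hq' (iterate_branch_mem ⟨hq, hqq.trans hq'⟩ h1 d).1 ih
      (iterate_branch_mem ⟨hq.trans hqq, hq'⟩ h1 d).2

theorem min_le_branch {q u : ℝ} (hq : 99 / 100 ≤ q) (hq1 : q ≤ 1) (hu : 0 ≤ u) (hu1 : u ≤ 1) :
    min (3 / 4) (6 / 5 * u) ≤ branch q u := by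
  unfold branch
  rcases le_total u (3 / 4) with h | h
  · refine (min_le_right _ _).trans ?_
    have h1 : 6 / 5 ≤ 2 * q - q ^ 2 * u := by nlinarith
    nlinarith
  · refine (min_le_left _ _).trans ?_
    have h1 : 7 / 10 ≤ q * u := by nlinarith
    have h2 : q * u ≤ 1 := mul_le_one₀ hq1 hu hu1
    nlinarith

theorem min_le_iterate_branch {q x : ℝ} (hq : 99 / 100 ≤ q) (hq1 : q ≤ 1) (hx : 0 ≤ x)
    (hx1 : x ≤ 1) (d : ℕ) : min (3 / 4) ((6 / 5) ^ d * x) ≤ (branch q)^[d] x := by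
  induction d with
  | zero => simp
  | succ d ih =>
    have hm := iterate_branch_mem (q := q) (x := x) ⟨by linarith, hq1⟩ ⟨hx, hx1⟩ d
    rw [Function.iterate_succ_apply']
    refine le_trans ?_ (min_le_branch hq hq1 hm.1 hm.2)
    refine le_min (min_le_left _ _) ?_
    rcases min_le_iff.1 ih with h | h
    · exact (min_le_left _ _).trans (by linarith)
    · refine (min_le_right _ _).trans ?_
      rw [pow_succ]
      linarith

theorem three_quarters_le_iterate_branch {q : ℝ} (hq : 99 / 100 ≤ q) (hq1 : q ≤ 1) (d : ℕ) :
    3 / 4 ≤ (branch q)^[d] 1 := by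
  have h := min_le_iterate_branch hq hq1 zero_le_one le_rfl d
  have h1 : (1 : ℝ) ≤ (6 / 5) ^ d := one_le_pow₀ (by norm_num)
  rwa [mul_one, min_eq_left (by linarith)] at h

/-- Near `q = 1` the recursion contracts: the orbit with a slightly smaller parameter and with
another starting point stays close. -/
theorem iterate_branch_sub_le {p q h x y : ℝ} (hp : 99 / 100 ≤ p) (hp1 : p ≤ 1)
    (hq : 99 / 100 ≤ q) (hq1 : q ≤ 1) (hpq : p - q ≤ h) (hh : 0 ≤ h) (hx : 3 / 4 ≤ x)
    (hx1 : x ≤ 1) (hy : 3 / 4 ≤ y) (hy1 : y ≤ 1) (d : ℕ) :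
    (branch p)^[d] x - (branch q)^[d] y ≤ (13 / 20) ^ d + 2 * h := by
  have low : ∀ {q x : ℝ}, 99 / 100 ≤ q → q ≤ 1 → 3 / 4 ≤ x → x ≤ 1 → ∀ d,
      3 / 4 ≤ (branch q)^[d] x := by
    intro q x hq hq1 hx hx1 d
    have h := min_le_iterate_branch hq hq1 (by linarith) hx1 d
    have h1 : (1 : ℝ) ≤ (6 / 5) ^ d := one_le_pow₀ (by norm_num)
    rwa [min_eq_left (by nlinarith)] at h
  induction d with
  | zero => simp; linarith
  | succ d ih =>
    rw [Function.iterate_succ_apply', Function.iterate_succ_apply', pow_succ]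
    set A := (branch p)^[d] x
    set B := (branch q)^[d] y
    have hA : 3 / 4 ≤ A := low hp hp1 hx hx1 d
    have hB : 3 / 4 ≤ B := low hq hq1 hy hy1 d
    have hA1 : A ≤ 1 := (iterate_branch_mem ⟨by linarith, hp1⟩ ⟨by linarith, hx1⟩ d).2
    have hB1 : B ≤ 1 := (iterate_branch_mem ⟨by linarith, hq1⟩ ⟨by linarith, hy1⟩ d).2
    have hE : 0 ≤ (13 / 20 : ℝ) ^ d := by positivity
    have hdiff : branch p A - branch q B = (p * A - q * B) * (2 - p * A - q * B) := by
      unfold branch; ring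
    have h1 : p * A - q * B ≤ (13 / 20) ^ d + 3 * h := by
      have e1 : p * (A - B) ≤ (13 / 20) ^ d + 2 * h := by nlinarith
      have e2 : (p - q) * B ≤ h := by nlinarith
      nlinarith
    have h2 : 0 ≤ 2 - p * A - q * B := by nlinarith
    have h3 : 2 - p * A - q * B ≤ 13 / 20 := by nlinarith
    rw [hdiff]
    calc (p * A - q * B) * (2 - p * A - q * B)
        ≤ ((13 / 20) ^ d + 3 * h) * (2 - p * A - q * B) := by gcongr
      _ ≤ ((13 / 20) ^ d + 3 * h) * (13 / 20) := by gcongr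
      _ ≤ _ := by linarith

/-! ### The critical parameter -/

/-- The critical probability of the graphs. The estimates only require it to be close to `1`. -/
noncomputable def crit : I := ⟨199 / 200, by norm_num, by norm_num⟩

theorem coe_crit : (crit : ℝ) = 199 / 200 := rfl

/-- The probability that an item of a gap with `2 ^ k` items is closed at criticality. -/
noncomputable def critDead (k : ℕ) : ℝ := deadProb crit k

theorem critDead_ge (k : ℕ) : 1 / 200 ≤ critDead k := by
  have h := iterate_branch_mem (q := 199 / 200) ⟨by norm_num, by norm_num⟩
    (Set.right_mem_Icc.2 zero_le_one) (depth k)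
  have : ((branch (199 / 200))^[depth k] 1) ^ 2 ≤ 1 := pow_le_one₀ h.1 h.2
  unfold critDead deadProb
  rw [coe_crit]
  linarith

theorem critDead_le (k : ℕ) : critDead k ≤ 1 / 2 := by
  have h := three_quarters_le_iterate_branch (q := 199 / 200) (by norm_num) (by norm_num) (depth k)
  unfold critDead deadProb
  rw [coe_crit]
  nlinarith

theorem critDead_pos (k : ℕ) : 0 < critDead k := lt_of_lt_of_le (by norm_num) (critDead_ge k)

/-- Below criticality the items are substantially more likely to be closed. -/
theorem critDead_mul_le_deadProb {p : ℝ} (hp : 0 ≤ p) (hpc : p ≤ crit) (k : ℕ) :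
    critDead k * (1 + (crit - p) / 2) ≤ deadProb p k := by
  have hmono := iterate_branch_le hp hpc crit.2.2 (depth k)
  have h1 := iterate_branch_mem (q := p) ⟨hp, hpc.trans crit.2.2⟩
    (Set.right_mem_Icc.2 zero_le_one) (depth k)
  have h2 := three_quarters_le_iterate_branch (q := crit) (by rw [coe_crit]; norm_num) crit.2.2
    (depth k)
  have h3 := critDead_le k
  unfold critDead deadProb at *
  set θ := (branch (crit : ℝ))^[depth k] 1
  set η := (branch p)^[depth k] 1
  have h4 : η ^ 2 ≤ θ ^ 2 := pow_le_pow_left₀ h1.1 hmono 2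
  have h5 : p * η ^ 2 ≤ p * θ ^ 2 := mul_le_mul_of_nonneg_left h4 hp
  have h6 : 9 / 16 ≤ θ ^ 2 := by nlinarith
  nlinarith

/-- The number of nodes of the inspected level that an item should reach in order to be connected
to the hub with overwhelming probability. -/
noncomputable def target (k : ℕ) : ℕ := ⌊(11 / 10 : ℝ) ^ 2 ^ k⌋₊

theorem target_le_target {k k' : ℕ} (h : k ≤ k') : target k ≤ target k' :=
  Nat.floor_le_floor (pow_le_pow_right₀ (by norm_num) (Nat.pow_le_pow_right two_pos h))

open Filter in
theorem eventually_mul_pow_le {r : ℝ} (hr : 0 ≤ r) (hr1 : r < 1) {ε : ℝ} (hε : 0 < ε) (m : ℕ) :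
    ∀ᶠ K : ℕ in atTop, (K : ℝ) ^ m * r ^ K ≤ ε :=
  (tendsto_pow_const_mul_const_pow_of_abs_lt_one m (by rwa [abs_of_nonneg hr])).eventually_le_const
    hε

open Filter in
theorem tendsto_two_pow : Tendsto (fun k : ℕ => 2 ^ k) atTop atTop :=
  tendsto_pow_atTop_atTop_of_one_lt one_lt_two

open Filter in
/-- At and slightly below criticality, the probability that no item of a gap reaches `target k`
nodes on both sides is at most a constant times the probability that the gap is closed at
criticality: both the change of the density and the higher threshold change the probability that a
given item is open by a quantity of order `2 ^ (-k)`. -/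
theorem eventually_not_gapOpen_le :
    ∃ C : ℝ, ∀ᶠ k : ℕ in atTop, ∀ (a : ℕ → ℕ) (n : ℕ), a n = k → ∀ q : I,
      (crit : ℝ) - 1 / 2 ^ k ≤ q →
      (labelMeasure q).real {ξ | ¬ GapOpen a (openLabels ξ) (target k) n}
        ≤ C * critDead k ^ 2 ^ k := by
  refine ⟨Real.exp 1800, ?_⟩
  have e1 := tendsto_two_pow.eventually (eventually_ge_atTop 200)
  have e2 := tendsto_two_pow.eventually
    (eventually_mul_pow_le (r := 13 / 20) (by norm_num) (by norm_num) one_pos 1)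
  have e3 := tendsto_two_pow.eventually
    (eventually_mul_pow_le (r := 11 / 12) (by norm_num) (by norm_num) one_pos 1)
  filter_upwards [e1, e2, e3] with k h1 h2 h3 a n hn q hq
  subst hn
  set k := a n
  set K : ℕ := 2 ^ k with hK
  have hKr : (2 : ℝ) ^ k = K := by rw [hK]; push_cast; rfl
  rw [hKr] at hq
  have hK200 : (200 : ℝ) ≤ K := by exact_mod_cast h1
  have hK0 : (0 : ℝ) < K := by linarith
  have hKi : (1 : ℝ) / K ≤ 1 / 200 := one_div_le_one_div_of_le (by norm_num) hK200
  have hKi0 : (0 : ℝ) ≤ 1 / K := by positivity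
  rw [coe_crit] at hq
  have hq99 : (99 : ℝ) / 100 ≤ q := by linarith
  have hq1 : (q : ℝ) ≤ 1 := q.2.2
  set θ := (branch (199 / 200))^[depth k] 1 with hθ
  have hθ0 := three_quarters_le_iterate_branch (q := 199 / 200) (by norm_num) (by norm_num)
    (depth k)
  have hθ1 := (iterate_branch_mem (q := 199 / 200) ⟨by norm_num, by norm_num⟩
    (Set.right_mem_Icc.2 zero_le_one) (depth k)).2
  rw [← hθ] at hθ0 hθ1
  -- the argument of the generating function: `K` generations, in each of which the branching
  -- recursion multiplies small arguments by at least `6 / 5`, bring it up to `3 / 4`, while it is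
  -- negligible in comparison with `1 / target k`
  set x : ℝ := (5 / 6) ^ K with hx
  have hx0 : 0 ≤ x := by positivity
  have hx1 : x ≤ 1 := pow_le_one₀ (by norm_num) (by norm_num)
  have h13 : (13 / 20 : ℝ) ^ K ≤ 1 / K := by
    rw [le_div_iff₀ hK0]; simpa [mul_comm] using h2
  have hMx : (target k : ℝ) * x ≤ 1 / K := by
    have : (target k : ℝ) ≤ (11 / 10) ^ K := Nat.floor_le (by positivity)
    calc (target k : ℝ) * x ≤ (11 / 10) ^ K * x := by gcongr
      _ = (11 / 12) ^ K := by rw [hx, ← mul_pow]; norm_num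
      _ ≤ 1 / K := by rw [le_div_iff₀ hK0]; simpa [mul_comm] using h3
  have hiter : θ - 3 / K ≤ (branch q)^[depth k] x := by
    have hd : depth k = K + K := by rw [hK]; unfold depth; ring
    have hB0 : 3 / 4 ≤ (branch q)^[K] x := by
      have := min_le_iterate_branch hq99 hq1 hx0 hx1 K
      have e : (6 / 5 : ℝ) ^ K * x = 1 := by rw [hx, ← mul_pow]; norm_num
      rwa [e, min_eq_left (by norm_num)] at this
    have hB1 := (iterate_branch_mem (q := q) ⟨by linarith, hq1⟩ ⟨hx0, hx1⟩ K).2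
    have hA0 := three_quarters_le_iterate_branch (q := 199 / 200) (by norm_num) (by norm_num) K
    have hA1 := (iterate_branch_mem (q := 199 / 200) ⟨by norm_num, by norm_num⟩
      (Set.right_mem_Icc.2 zero_le_one) K).2
    have := iterate_branch_sub_le (p := 199 / 200) (q := q) (h := 1 / K) (by norm_num)
      (by norm_num) hq99 hq1 (by linarith) hKi0 hA0 hA1 hB0 hB1 K
    rw [← Function.iterate_add_apply, ← Function.iterate_add_apply, ← hd, ← hθ] at this
    have e : (3 : ℝ) / K = 1 / K + 2 * (1 / K) := by ring
    linarith
  have e4 : (4 : ℝ) / K = 4 * (1 / K) := by ring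
  have e3 : (3 : ℝ) / K = 3 * (1 / K) := by ring
  have hb : 0 ≤ θ - 4 / K := by linarith
  have hgap := labelMeasure_not_gapOpen_le q a (target k) n hb fun s i => by
    have := le_labelMeasure_le_card_reached q hx0 hx1 (target k) n s (depth k) i
    linarith
  refine hgap.trans ?_
  have hu := critDead_ge k
  have hu0 := critDead_pos k
  have hbase : 1 - q * (θ - 4 / K) ^ 2 ≤ critDead k * (1 + 1800 / K) := by
    have hcd : critDead k = 1 - 199 / 200 * θ ^ 2 := rfl
    have c1 : θ ^ 2 - 8 * (1 / K) ≤ (θ - 4 / K) ^ 2 := by rw [e4]; nlinarith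
    have c2 : (q : ℝ) * (θ ^ 2 - 8 * (1 / K)) ≤ q * (θ - 4 / K) ^ 2 := by gcongr
    have c3 : (199 / 200 - 1 / K) * θ ^ 2 ≤ q * θ ^ 2 := by gcongr
    have c4 : θ ^ 2 ≤ 1 := pow_le_one₀ (by linarith) hθ1
    have c5 : (1800 : ℝ) / K = 1800 * (1 / K) := by ring
    have c6 : (9 : ℝ) * (1 / K) ≤ critDead k * (1800 * (1 / K)) := by nlinarith
    rw [c5]
    nlinarith
  have hbase0 : 0 ≤ 1 - q * (θ - 4 / K) ^ 2 := by
    have : (θ - 4 / K) ^ 2 ≤ 1 := pow_le_one₀ hb (by linarith)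
    nlinarith [q.2.1]
  calc (1 - q * (θ - 4 / K) ^ 2) ^ 2 ^ k
      ≤ (critDead k * (1 + 1800 / K)) ^ K := by
        rw [← hK]; exact pow_le_pow_left₀ hbase0 hbase K
    _ = (1 + 1800 / K) ^ K * critDead k ^ K := by rw [mul_pow, mul_comm]
    _ ≤ Real.exp (1800 / K) ^ K * critDead k ^ K := by
        gcongr
        rw [add_comm]
        exact Real.add_one_le_exp _
    _ = Real.exp 1800 * critDead k ^ 2 ^ k := by
        rw [← Real.exp_nat_mul, mul_div_cancel₀ _ hK0.ne']

open Filter in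
/-- A hub fails with at most the probability that an adjacent gap is closed at criticality. It
contains `(11 / 10) ^ 2 ^ k` disjoint links between two trees that reach as many nodes of the
inspected levels, and each link is open with probability at least `(23 / 25) ^ 2 ^ k`; the product
of these numbers is exponentially large in `2 ^ k`. -/
theorem eventually_not_hubOpen_le :
    ∀ᶠ k : ℕ in atTop, ∀ (a : ℕ → ℕ) (n : ℕ), a n = k → k ≤ a (n + 1) → a (n + 1) ≤ k + 1 →
      ∀ q : I, (crit : ℝ) - 1 / 2 ^ k ≤ q →
      (labelMeasure q).real
          {ξ | ¬ HubOpen a (openLabels ξ) (target k) (target (a (n + 1))) n}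
        ≤ critDead k ^ 2 ^ k := by
  have e1 := tendsto_two_pow.eventually (eventually_ge_atTop 200)
  have e2 := tendsto_two_pow.eventually
    (eventually_mul_pow_le (r := 250 / 253) (by norm_num) (by norm_num)
      (ε := 1 / 9) (by norm_num) 1)
  filter_upwards [e1, e2] with k h1 h2 a n hn hge hle q hq
  subst hn
  set k := a n
  set K : ℕ := 2 ^ k with hK
  have hKr : (2 : ℝ) ^ k = K := by rw [hK]; push_cast; rfl
  rw [hKr] at hq
  have hK200 : (200 : ℝ) ≤ K := by exact_mod_cast h1
  have hK0 : (0 : ℝ) < K := by linarith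
  have hKi : (1 : ℝ) / K ≤ 1 / 200 := one_div_le_one_div_of_le (by norm_num) hK200
  rw [coe_crit] at hq
  have hq99 : (99 : ℝ) / 100 ≤ q := by linarith
  have hq0 : (0 : ℝ) ≤ q := q.2.1
  have hq1 : (q : ℝ) ≤ 1 := q.2.2
  refine (labelMeasure_not_hubOpen_le q a (target k) (target (a (n + 1))) (target k) n le_rfl
    (target_le_target hge)).trans ?_
  set r : ℝ := (q : ℝ) ^ (stem k + stem (a (n + 1)) + 1) with hr
  have hpow : (2 : ℝ) ^ k * 2 ^ a (n + 1) ≤ 2 * K ^ 2 := by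
    have : (2 : ℝ) ^ a (n + 1) ≤ 2 ^ (k + 1) := pow_le_pow_right₀ (by norm_num) hle
    rw [pow_succ, hKr] at this
    rw [hKr]
    nlinarith
  have hlen : stem k + stem (a (n + 1)) + 1 ≤ 8 * K := by
    have hk1 : a (n + 1) ≤ k + 1 := hle
    have h2k : k < K := Nat.lt_two_pow_self
    have hd : depth (a (n + 1)) ≤ 4 * K := by
      unfold depth
      have : 2 ^ a (n + 1) ≤ 2 ^ (k + 1) := Nat.pow_le_pow_right two_pos hle
      rw [pow_succ] at this
      omega
    have hd' : depth k = 2 * K := rfl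
    unfold stem
    omega
  have hr0 : (23 / 25 : ℝ) ^ K ≤ r := by
    calc (23 / 25 : ℝ) ^ K ≤ ((99 / 100) ^ 8) ^ K :=
          pow_le_pow_left₀ (by norm_num) (by norm_num) K
      _ ≤ ((q : ℝ) ^ 8) ^ K := by gcongr
      _ = (q : ℝ) ^ (8 * K) := by rw [pow_mul]
      _ ≤ r := pow_le_pow_of_le_one hq0 hq1 hlen
  have hr1 : r ≤ 1 := pow_le_one₀ hq0 hq1
  have hrn : 0 ≤ r := le_trans (by positivity) hr0
  have htarget : (11 / 10 : ℝ) ^ K - 1 ≤ target k := by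
    have := Nat.lt_floor_add_one ((11 / 10 : ℝ) ^ K)
    have e : target k = ⌊(11 / 10 : ℝ) ^ K⌋₊ := rfl
    rw [e]; linarith
  have hMr : 9 * (K : ℝ) - 1 ≤ r * target k := by
    have c1 : (9 : ℝ) * K ≤ (253 / 250) ^ K := by
      have hpos : (0 : ℝ) < (250 / 253) ^ K := by positivity
      have : (253 / 250 : ℝ) ^ K * (250 / 253) ^ K = 1 := by rw [← mul_pow]; norm_num
      rw [pow_one] at h2
      nlinarith
    have c2 : (253 / 250 : ℝ) ^ K = (23 / 25) ^ K * (11 / 10) ^ K := by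
      rw [← mul_pow]; norm_num
    have c3 : (23 / 25 : ℝ) ^ K * (11 / 10) ^ K ≤ r * (11 / 10) ^ K := by gcongr
    have c4 : r * ((11 / 10 : ℝ) ^ K - 1) ≤ r * target k := by gcongr
    nlinarith
  have hexp : (1 - r) ^ target k ≤ Real.exp (-(9 * K - 1)) := by
    calc (1 - r) ^ target k ≤ Real.exp (-r) ^ target k := by
          refine pow_le_pow_left₀ (by linarith) ?_ _
          have := Real.add_one_le_exp (-r)
          linarith
      _ = Real.exp (-(r * target k)) := by rw [← Real.exp_nat_mul]; ring_nf
      _ ≤ _ := Real.exp_le_exp.2 (by linarith)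
  have hK2 : 2 * (K : ℝ) ^ 2 ≤ Real.exp (2 * K) := by
    have c1 : (K : ℝ) + 1 ≤ Real.exp K := Real.add_one_le_exp _
    have c2 := Real.quadratic_le_exp_of_nonneg (x := 2 * (K : ℝ)) (by positivity)
    nlinarith
  have h200 : Real.exp (-(6 * K)) ≤ critDead k ^ K := by
    have c1 : Real.exp (-6) ≤ 1 / 200 := by
      rw [Real.exp_neg, one_div]
      refine inv_anti₀ (by norm_num) ?_
      have : (2.7 : ℝ) ≤ Real.exp 1 := by linarith [Real.exp_one_gt_d9]
      calc (200 : ℝ) ≤ 2.7 ^ 6 := by norm_num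
        _ ≤ Real.exp 1 ^ 6 := by gcongr
        _ = Real.exp 6 := by rw [← Real.exp_nat_mul]; norm_num
    calc Real.exp (-(6 * K)) = Real.exp (-6) ^ K := by rw [← Real.exp_nat_mul]; ring_nf
      _ ≤ critDead k ^ K := pow_le_pow_left₀ (Real.exp_pos _).le (c1.trans (critDead_ge k)) K
  calc (2 : ℝ) ^ k * 2 ^ a (n + 1) * (1 - r) ^ target k
      ≤ Real.exp (2 * K) * Real.exp (-(9 * K - 1)) :=
        mul_le_mul (hpow.trans hK2) hexp (pow_nonneg (by linarith) _) (Real.exp_pos _).le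
    _ = Real.exp (2 * K + -(9 * K - 1)) := (Real.exp_add _ _).symm
    _ ≤ Real.exp (-(6 * K)) := Real.exp_le_exp.2 (by linarith)
    _ ≤ critDead k ^ 2 ^ k := h200

/-! ### Sequences with prescribed multiplicities -/

/-- The nondecreasing sequence that takes each value `k` exactly `m k` times. -/
def blockSeq (m : ℕ → ℕ) : ℕ → ℕ
  | 0 => 0
  | n + 1 => if ∑ j ∈ Finset.range (blockSeq m n + 1), m j ≤ n + 1 then blockSeq m n + 1
      else blockSeq m n

theorem blockSeq_le_succ (m : ℕ → ℕ) (n : ℕ) : blockSeq m n ≤ blockSeq m (n + 1) := by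
  rw [blockSeq]; split_ifs <;> omega

theorem blockSeq_succ_le (m : ℕ → ℕ) (n : ℕ) : blockSeq m (n + 1) ≤ blockSeq m n + 1 := by
  rw [blockSeq]; split_ifs <;> omega

theorem sum_le_and_lt_sum_blockSeq {m : ℕ → ℕ} (hm : ∀ k, 1 ≤ m k) (n : ℕ) :
    ∑ j ∈ Finset.range (blockSeq m n), m j ≤ n ∧
      n < ∑ j ∈ Finset.range (blockSeq m n + 1), m j := by
  induction n with
  | zero => simpa [blockSeq] using Nat.lt_of_succ_le (hm 0)
  | succ n ih =>
    rw [blockSeq]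
    split_ifs with h
    · refine ⟨h, ?_⟩
      rw [Finset.sum_range_succ]
      have := hm (blockSeq m n + 1)
      omega
    · exact ⟨by omega, by omega⟩

theorem blockSeq_eq {m : ℕ → ℕ} (hm : ∀ k, 1 ≤ m k) {n k : ℕ} (h1 : ∑ j ∈ Finset.range k, m j ≤ n)
    (h2 : n < ∑ j ∈ Finset.range (k + 1), m j) : blockSeq m n = k := by
  have hmono : Monotone fun k => ∑ j ∈ Finset.range k, m j := fun a b hab =>
    Finset.sum_le_sum_of_subset (Finset.range_mono hab)
  obtain ⟨h3, h4⟩ := sum_le_and_lt_sum_blockSeq hm n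
  by_contra hne
  rcases lt_or_gt_of_ne hne with h | h
  · have := hmono (show blockSeq m n + 1 ≤ k from h)
    simp only at this
    omega
  · have := hmono (show k + 1 ≤ blockSeq m n from h)
    simp only at this
    omega

theorem sum_blockSeq {m : ℕ → ℕ} (hm : ∀ k, 1 ≤ m k) (g : ℕ → ℝ) (k : ℕ) :
    ∑ n ∈ Finset.range (∑ j ∈ Finset.range k, m j), g (blockSeq m n)
      = ∑ j ∈ Finset.range k, m j * g j := by
  induction k with
  | zero => simp
  | succ k ih =>
    rw [Finset.sum_range_succ (fun j => (m j : ℝ) * g j) k, ← ih, ← Finset.sum_range_add_sum_Ico _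
      (show ∑ j ∈ Finset.range k, m j ≤ ∑ j ∈ Finset.range (k + 1), m j by
        rw [Finset.sum_range_succ]; omega)]
    congr 1
    rw [Finset.sum_congr rfl (g := fun _ => g k)]
    · rw [Finset.sum_const, Nat.card_Ico, Finset.sum_range_succ, Nat.add_sub_cancel_left,
        nsmul_eq_mul]
    · intro n hn
      rw [Finset.mem_Ico] at hn
      rw [blockSeq_eq hm hn.1 hn.2]

open Filter in
theorem tendsto_blockSeq {m : ℕ → ℕ} (hm : ∀ k, 1 ≤ m k) : Tendsto (blockSeq m) atTop atTop := by
  refine tendsto_atTop_atTop.2 fun k => ⟨∑ j ∈ Finset.range k, m j, fun n hn => ?_⟩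
  by_contra! h
  have h2 := (sum_le_and_lt_sum_blockSeq hm n).2
  have : ∑ j ∈ Finset.range (blockSeq m n + 1), m j ≤ ∑ j ∈ Finset.range k, m j :=
    Finset.sum_le_sum_of_subset (Finset.range_mono h)
  omega

theorem le_sum_of_one_le {m : ℕ → ℕ} (hm : ∀ k, 1 ≤ m k) (k : ℕ) :
    k ≤ ∑ j ∈ Finset.range k, m j := by
  calc k = ∑ _j ∈ Finset.range k, 1 := by simp
    _ ≤ _ := Finset.sum_le_sum fun j _ => hm j

theorem summable_blockSeq_iff {m : ℕ → ℕ} (hm : ∀ k, 1 ≤ m k) {g : ℕ → ℝ} (hg : ∀ k, 0 ≤ g k) :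
    (Summable fun n => g (blockSeq m n)) ↔ Summable fun k => m k * g k := by
  have hg' : ∀ k, 0 ≤ m k * g k := fun k => mul_nonneg (Nat.cast_nonneg _) (hg k)
  constructor
  · intro h
    refine summable_of_sum_range_le (c := ∑' n, g (blockSeq m n)) hg' fun k => ?_
    rw [← sum_blockSeq hm]
    exact h.sum_le_tsum _ fun n _ => hg _
  · intro h
    refine summable_of_sum_range_le (c := ∑' k, m k * g k) (fun n => hg _) fun k => ?_
    calc ∑ n ∈ Finset.range k, g (blockSeq m n)
        ≤ ∑ n ∈ Finset.range (∑ j ∈ Finset.range k, m j), g (blockSeq m n) :=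
          Finset.sum_le_sum_of_subset_of_nonneg
            (Finset.range_mono (le_sum_of_one_le hm k)) fun n _ _ => hg _
      _ = _ := sum_blockSeq hm g k
      _ ≤ _ := h.sum_le_tsum _ fun n _ => hg' n

/-- The number of gaps with `2 ^ k` items: such that the expected number of them that are closed at
criticality is about `β ^ (-k)`. -/
noncomputable def mult (β : ℝ) (k : ℕ) : ℕ := ⌈(β ^ k * critDead k ^ 2 ^ k)⁻¹⌉₊

/-- The sequence of the binary logarithms of the numbers of items of the gaps. -/
noncomputable def gapSeq (β : ℝ) : ℕ → ℕ := blockSeq (mult β)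

theorem one_le_mult {β : ℝ} (hβ : 0 < β) (k : ℕ) : 1 ≤ mult β k :=
  Nat.one_le_ceil_iff.2 (inv_pos.2 (mul_pos (pow_pos hβ k) (pow_pos (critDead_pos k) _)))

theorem le_mult_mul (β : ℝ) (k : ℕ) : (β ^ k)⁻¹ ≤ mult β k * critDead k ^ 2 ^ k := by
  have h := pow_pos (critDead_pos k) (2 ^ k)
  calc (β ^ k)⁻¹ = (β ^ k * critDead k ^ 2 ^ k)⁻¹ * critDead k ^ 2 ^ k := by
        rw [mul_inv, mul_assoc, inv_mul_cancel₀ h.ne', mul_one]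
    _ ≤ _ := by
        gcongr
        exact Nat.le_ceil _

theorem critDead_pow_le (k : ℕ) : critDead k ^ 2 ^ k ≤ (4 ^ k : ℝ)⁻¹ := by
  have h2k : 2 * k ≤ 2 ^ k := by
    rcases Nat.eq_zero_or_pos k with rfl | hk
    · simp
    · have := Nat.lt_two_pow_self (n := k - 1)
      have e : 2 ^ k = 2 * 2 ^ (k - 1) := by rw [← pow_succ']; congr 1; omega
      omega
  calc critDead k ^ 2 ^ k ≤ (1 / 2) ^ 2 ^ k :=
        pow_le_pow_left₀ (critDead_pos k).le (critDead_le k) _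
    _ ≤ (1 / 2) ^ (2 * k) := pow_le_pow_of_le_one (by norm_num) (by norm_num) h2k
    _ = (4 ^ k : ℝ)⁻¹ := by rw [pow_mul, ← inv_pow]; norm_num

theorem mult_mul_le {β : ℝ} (hβ : 0 < β) (hβ4 : β ≤ 4) (k : ℕ) :
    mult β k * critDead k ^ 2 ^ k ≤ 2 * (β ^ k)⁻¹ := by
  have h := pow_pos (critDead_pos k) (2 ^ k)
  have hc := (Nat.ceil_lt_add_one (a := (β ^ k * critDead k ^ 2 ^ k)⁻¹) (by positivity)).le
  have h4 : (4 ^ k : ℝ)⁻¹ ≤ (β ^ k)⁻¹ := by gcongr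
  calc mult β k * critDead k ^ 2 ^ k
      ≤ ((β ^ k * critDead k ^ 2 ^ k)⁻¹ + 1) * critDead k ^ 2 ^ k := by
        gcongr; exact hc
    _ = (β ^ k)⁻¹ + critDead k ^ 2 ^ k := by
        rw [add_mul, mul_inv, mul_assoc, inv_mul_cancel₀ h.ne', mul_one, one_mul]
    _ ≤ _ := by have := critDead_pow_le k; linarith

/-- At criticality, the closing probabilities are summable even if they are multiplied by powers
of a number `γ < β` to the binary logarithm of the number of items. -/
theorem summable_gapSeq {β : ℝ} (hβ : 0 < β) (hβ4 : β ≤ 4) {γ : ℝ} (hγ : 0 ≤ γ) (hγβ : γ < β) :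
    Summable fun n => γ ^ gapSeq β n * critDead (gapSeq β n) ^ 2 ^ gapSeq β n := by
  have hu : ∀ k, 0 ≤ critDead k := fun k => (critDead_pos k).le
  refine (summable_blockSeq_iff (one_le_mult hβ) (g := fun k => γ ^ k * critDead k ^ 2 ^ k)
    fun k => mul_nonneg (pow_nonneg hγ k) (pow_nonneg (hu k) _)).2 ?_
  refine Summable.of_nonneg_of_le (f := fun k => 2 * (γ / β) ^ k)
    (fun k => mul_nonneg (Nat.cast_nonneg _) (mul_nonneg (pow_nonneg hγ k) (pow_nonneg (hu k) _)))
    (fun k => ?_)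
    ((summable_geometric_of_lt_one (by positivity) ((div_lt_one hβ).2 hγβ)).mul_left 2)
  calc mult β k * (γ ^ k * critDead k ^ 2 ^ k) = γ ^ k * (mult β k * critDead k ^ 2 ^ k) := by ring
    _ ≤ γ ^ k * (2 * (β ^ k)⁻¹) :=
        mul_le_mul_of_nonneg_left (mult_mul_le hβ hβ4 k) (pow_nonneg hγ k)
    _ = 2 * (γ / β) ^ k := by rw [div_pow]; ring

/-- If the terms exceed the closing probabilities at criticality by factors of at least `c * β ^ k`
in the gaps with `2 ^ k` items, for all large `k`, then they are not summable. -/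
theorem not_summable_gapSeq {β : ℝ} (hβ : 0 < β) {g : ℕ → ℝ} (hg : ∀ k, 0 ≤ g k) {c : ℝ}
    (hc : 0 < c) (h : ∀ᶠ k in Filter.atTop, c * β ^ k * critDead k ^ 2 ^ k ≤ g k) :
    ¬ Summable fun n => g (gapSeq β n) := by
  intro hs
  have h1 := ((summable_blockSeq_iff (one_le_mult hβ) hg).1 hs).tendsto_atTop_zero
  obtain ⟨k, hk, hk'⟩ := (h.and (h1.eventually_lt_const hc)).exists
  have h2 := le_mult_mul β k
  have h3 : c = c * β ^ k * (β ^ k)⁻¹ := by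
    rw [mul_assoc, mul_inv_cancel₀ (pow_pos hβ k).ne', mul_one]
  have h4 : c * β ^ k * (β ^ k)⁻¹ ≤ c * β ^ k * (mult β k * critDead k ^ 2 ^ k) :=
    mul_le_mul_of_nonneg_left h2 (by positivity)
  have h5 : (mult β k : ℝ) * (c * β ^ k * critDead k ^ 2 ^ k) ≤ mult β k * g k :=
    mul_le_mul_of_nonneg_left hk (Nat.cast_nonneg _)
  linarith

open Filter in
theorem tendsto_gapSeq {β : ℝ} (hβ : 0 < β) : Tendsto (gapSeq β) atTop atTop :=
  tendsto_blockSeq (one_le_mult hβ)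

/-! ### From edges to labels -/

theorem mem_range_label {a : ℕ → ℕ} {l : Label} {u v : Vert a} (h : IsEdge a l u.1 v.1) :
    l ∈ Set.range (label : (chainGraph a).edgeSet → Label) :=
  ⟨⟨s(u, v), ⟨l, trivial, Or.inl h⟩⟩, label_eq rfl h⟩

/-- The property `P` of sets of labels ignores the labels that do not belong to any edge. -/
def IgnoresJunk (a : ℕ → ℕ) (P : Set Label → Prop) : Prop :=
  ∀ S, P (S ∩ Set.range (label : (chainGraph a).edgeSet → Label)) ↔ P S

theorem ignoresJunk_pathOpen {a : ℕ → ℕ} {n : ℕ} {s : Bool} {y w : List Bool}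
    (hw : a n ≤ w.length) (hy : y.length + w.length ≤ top a n s) :
    IgnoresJunk a fun S => PathOpen S n s y w := by
  intro S
  induction y with
  | nil => rfl
  | cons b y ih =>
    simp only [List.length_cons] at hy
    refine and_congr ⟨fun h => h.1, fun h => ⟨h, ?_⟩⟩ (ih (by omega))
    exact mem_range_label (u := ⟨(n, s, y ++ w), by simp; omega, by simp; omega⟩)
      (v := ⟨(n, s, b :: (y ++ w)), by simp; omega, by simp; omega⟩)
      (IsEdge.tree n s b (y ++ w) (by simp; omega) (by simp; omega))

theorem reached_inter_range {a : ℕ → ℕ} {n : ℕ} {i : List Bool} (hi : i.length = a n) (s : Bool)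
    (S : Set Label) :
    reached (S ∩ Set.range (label : (chainGraph a).edgeSet → Label)) n s (depth (a n)) i
      = reached S n s (depth (a n)) i := by
  ext y
  simp only [mem_reached]
  refine and_congr_right fun hy => ignoresJunk_pathOpen hi.ge ?_ S
  rw [hy, hi, add_comm]
  exact stem_le_top a n s

theorem ignoresJunk_itemOpen {a : ℕ → ℕ} {n M : ℕ} {i : List Bool} (hi : i.length = a n) :
    IgnoresJunk a fun S => ItemOpen a S n M i := by
  intro S
  simp only [ItemOpen, reached_inter_range hi]
  refine and_congr ⟨fun h => h.1, fun h => ⟨h, ?_⟩⟩ Iff.rfl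
  exact mem_range_label (u := ⟨(n, false, i), hi.ge, hi.le.trans (le_top a n _)⟩)
    (v := ⟨(n, true, i), hi.ge, hi.le.trans (le_top a n _)⟩) (IsEdge.bottleneck n i hi)

theorem ignoresJunk_gapClosed (a : ℕ → ℕ) (n : ℕ) :
    IgnoresJunk a fun S => GapClosed a S n := fun S =>
  forall_congr' fun _ => forall_congr' fun hi => not_congr (ignoresJunk_itemOpen hi S)

theorem ignoresJunk_gapOpen (a : ℕ → ℕ) (M n : ℕ) :
    IgnoresJunk a fun S => GapOpen a S M n := fun S =>
  exists_congr fun _ => and_congr_right fun hi => ignoresJunk_itemOpen hi S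

theorem ignoresJunk_linkOpen {a : ℕ → ℕ} {n : ℕ} {x y : List Bool}
    (hx : x.length = stem (a n)) (hy : y.length = stem (a (n + 1))) :
    IgnoresJunk a fun S => LinkOpen S n x y := by
  intro S
  have ht : top a n true = stem (a n) + stem (a (n + 1)) := by simp [top]
  have ht' : top a (n + 1) false = stem (a (n + 1)) + stem (a n) := by simp [top]
  have h1 := le_stem (a n)
  have h2 := le_stem (a (n + 1))
  refine and_congr (ignoresJunk_pathOpen (by omega) (by omega) S) (and_congr
    ⟨fun h => h.1, fun h => ⟨h, ?_⟩⟩ (ignoresJunk_pathOpen (by omega) (by omega) S))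
  exact mem_range_label (u := ⟨(n, true, y ++ x), by simp; omega, by simp; omega⟩)
    (v := ⟨(n + 1, false, x ++ y), by simp; omega, by simp; omega⟩) (IsEdge.hub n x y hx hy)

theorem ignoresJunk_hubOpen (a : ℕ → ℕ) (M M' n : ℕ) :
    IgnoresJunk a fun S => HubOpen a S M M' n := by
  intro S
  refine forall_congr' fun i => forall_congr' fun j => forall_congr' fun hi =>
    forall_congr' fun hj => ?_
  rw [reached_inter_range hi, reached_inter_range hj]
  refine imp_congr_right fun _ => imp_congr_right fun _ => exists_congr fun x =>
    and_congr_right fun hx => exists_congr fun y => and_congr_right fun hy => ?_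
  refine ignoresJunk_linkOpen ?_ ?_ S
  · simp [(mem_reached.1 hx).1, hi, stem, add_comm]
  · simp [(mem_reached.1 hy).1, hj, stem, add_comm]

/-- The labels of the edges whose state lies in `o`. -/
def labelsIn {a : ℕ → ℕ} {α : Type*} (ω : (chainGraph a).edgeSet → α) (o : Set α) : Set Label :=
  label '' {e | ω e ∈ o}

theorem hasInfiniteCluster_iff {a : ℕ → ℕ} {α : Type*} (ω : (chainGraph a).edgeSet → α)
    (o : Set α) : HasInfiniteCluster (chainGraph a) {e | ω e ∈ o} ↔
      ∃ c : (labelGraph a (labelsIn ω o)).ConnectedComponent, c.supp.Infinite := by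
  have : {e : (chainGraph a).edgeSet | ω e ∈ o} = {e | label e ∈ labelsIn ω o} := by
    ext e
    exact ⟨fun h => ⟨e, h, rfl⟩, fun ⟨e', h, he⟩ => label_injective he ▸ h⟩
  rw [HasInfiniteCluster, this, openSubgraph_chainGraph]

theorem measurableSet_mem_labelsIn {a : ℕ → ℕ} {α : Type*} [MeasurableSpace α] {o : Set α}
    (ho : MeasurableSet o) (l : Label) :
    MeasurableSet {ω : (chainGraph a).edgeSet → α | l ∈ labelsIn ω o} := by
  by_cases h : ∃ e : (chainGraph a).edgeSet, label e = l
  · obtain ⟨e, rfl⟩ := h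
    have : {ω : (chainGraph a).edgeSet → α | label e ∈ labelsIn ω o} = {ω | ω e ∈ o} := by
      ext ω
      exact ⟨fun ⟨e', h, he⟩ => label_injective he ▸ h, fun h => ⟨e, h, rfl⟩⟩
    rw [this]
    exact measurable_pi_apply e ho
  · have : {ω : (chainGraph a).edgeSet → α | l ∈ labelsIn ω o} = ∅ := by
      ext ω
      simp only [Set.mem_ofPred_eq, Set.mem_empty_iff_false, iff_false]
      exact fun ⟨e, _, he⟩ => h ⟨e, he⟩
    rw [this]
    exact MeasurableSet.empty

theorem labelsIn_comp_label {a : ℕ → ℕ} {α : Type*} (ξ : Label → α) (o : Set α) :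
    labelsIn (fun e : (chainGraph a).edgeSet => ξ (label e)) o
      = {l | ξ l ∈ o} ∩ Set.range (label : (chainGraph a).edgeSet → Label) := by
  ext l
  constructor
  · rintro ⟨e, he, rfl⟩
    exact ⟨he, e, rfl⟩
  · rintro ⟨h, e, rfl⟩
    exact ⟨e, h, rfl⟩

/-- The edges may be replaced by their labels, the other labels being independent of them. -/
theorem measure_edges_eq (a : ℕ → ℕ) {α : Type*} [MeasurableSpace α] (κ : Measure α)
    [IsProbabilityMeasure κ] {B : Set ((chainGraph a).edgeSet → α)} (hB : MeasurableSet B) :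
    (Measure.infinitePi fun _ : (chainGraph a).edgeSet => κ).real B
      = (Measure.infinitePi fun _ : Label => κ).real {ξ | (fun e => ξ (label e)) ∈ B} := by
  have h := Measure.map_infinitePi_infinitePi_of_inj (P := fun _ : Label => κ)
    (label_injective (a := a))
  rw [measureReal_def, ← h, Measure.map_apply (by fun_prop) hB]
  rfl

/-- The labels in a given state form a Bernoulli set. -/
theorem measure_labels_eq {α : Type*} [MeasurableSpace α] (κ : Measure α) [IsProbabilityMeasure κ]
    {o : Set α} (ho : MeasurableSet o) (q : I) (hq : κ.real o = q) {P : Set Label → Prop}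
    (hP : MeasurableSet {ξ | P (openLabels ξ)}) :
    (Measure.infinitePi fun _ : Label => κ).real {ξ | P {l | ξ l ∈ o}}
      = (labelMeasure q).real {ξ | P (openLabels ξ)} := by
  classical
  set f : α → Bool := fun x => decide (x ∈ o) with hf
  have hfm : Measurable f := measurable_to_bool (by
    have : f ⁻¹' {true} = o := by ext x; simp [hf]
    rwa [this])
  have hpt : f ⁻¹' {true} = o := by ext x; simp [hf]
  have hpf : f ⁻¹' {false} = oᶜ := by ext x; simp [hf]
  have hlaw : κ.map f = edgeLaw q := by
    refine Measure.ext_of_singleton fun b => ?_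
    have hne : ∀ (μ : Measure Bool) [IsFiniteMeasure μ] (s : Set Bool),
      μ s = ENNReal.ofReal (μ.real s) := fun μ _ s => (ofReal_measureReal).symm
    rw [Measure.map_apply hfm (measurableSet_singleton b), hne (edgeLaw q), ← ofReal_measureReal]
    cases b
    · rw [hpf, probReal_compl_eq_one_sub ho, hq, edgeLaw_real_false]
    · rw [hpt, hq, edgeLaw_real_true]
  have h := Measure.infinitePi_map_pi (μ := fun _ : Label => κ) (f := fun _ => f) fun _ => hfm
  simp only [hlaw] at h
  rw [measureReal_def, measureReal_def, labelMeasure, ← h, Measure.map_apply (by fun_prop) hP]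
  congr 2
  ext ξ
  simp [openLabels, hf]

/-- The probability of a property of the set of edges in a given state. -/
theorem measure_labelsIn_eq (a : ℕ → ℕ) {α : Type*} [MeasurableSpace α] (κ : Measure α)
    [IsProbabilityMeasure κ] {o : Set α} (ho : MeasurableSet o) (q : I) (hq : κ.real o = q)
    {P : Set Label → Prop} (hP : MeasurableSet {ξ | P (openLabels ξ)})
    (hP' : MeasurableSet {ω : (chainGraph a).edgeSet → α | P (labelsIn ω o)})
    (hPj : IgnoresJunk a P) :
    (Measure.infinitePi fun _ : (chainGraph a).edgeSet => κ).real {ω | P (labelsIn ω o)}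
      = (labelMeasure q).real {ξ | P (openLabels ξ)} := by
  rw [measure_edges_eq a κ hP', ← measure_labels_eq κ ho q hq hP]
  congr 1
  ext ξ
  simp only [Set.mem_ofPred_eq, labelsIn_comp_label]
  exact hPj _

/-! ### The critical probability -/

/-- The `n`-th gap and the hub behind it are open, so that they can be part of an infinite
cluster. -/
def Robust (a : ℕ → ℕ) (n : ℕ) (S : Set Label) : Prop :=
  GapOpen a S (target (a n)) n ∧ HubOpen a S (target (a n)) (target (a (n + 1))) n

theorem measurableSet_robust {Ω : Type*} [MeasurableSpace Ω] {R : Ω → Set Label}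
    (hR : ∀ l, MeasurableSet {ω | l ∈ R ω}) (a : ℕ → ℕ) (n : ℕ) :
    MeasurableSet {ω | Robust a n (R ω)} :=
  (measurableSet_gapOpen hR a _ n).inter (measurableSet_hubOpen hR a _ _ n)

theorem ignoresJunk_not_robust (a : ℕ → ℕ) (n : ℕ) :
    IgnoresJunk a fun S => ¬ Robust a n S := fun S =>
  not_congr (and_congr (ignoresJunk_gapOpen a _ n S) (ignoresJunk_hubOpen a _ _ n S))

theorem exists_infinite_component_of_robust {a : ℕ → ℕ} {S : Set Label}
    (h : ∀ᶠ n in Filter.atTop, Robust a n S) :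
    ∃ c : (labelGraph a S).ConnectedComponent, c.supp.Infinite := by
  obtain ⟨N, hN⟩ := Filter.eventually_atTop.1 h
  exact exists_infinite_component (W := fun _ => S) monotone_const (fun _ => subset_rfl)
    (fun n => target (a n)) N (fun n hn => (hN n hn).1) fun n hn => (hN n hn).2

theorem eventually_not_robust_le {β : ℝ} (hβ : 0 < β) :
    ∃ C : ℝ, ∀ᶠ n in Filter.atTop, ∀ q : I, (crit : ℝ) - 1 / 2 ^ gapSeq β n ≤ q →
      (labelMeasure q).real {ξ | ¬ Robust (gapSeq β) n (openLabels ξ)}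
        ≤ C * critDead (gapSeq β n) ^ 2 ^ gapSeq β n := by
  obtain ⟨C, hC⟩ := eventually_not_gapOpen_le
  refine ⟨C + 1, ?_⟩
  filter_upwards [(tendsto_gapSeq hβ).eventually hC,
    (tendsto_gapSeq hβ).eventually eventually_not_hubOpen_le] with n h1 h2 q hq
  have hsub : {ξ | ¬ Robust (gapSeq β) n (openLabels ξ)} ⊆
      {ξ | ¬ GapOpen (gapSeq β) (openLabels ξ) (target (gapSeq β n)) n} ∪
      {ξ | ¬ HubOpen (gapSeq β) (openLabels ξ) (target (gapSeq β n))
        (target (gapSeq β (n + 1))) n} := by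
    intro ξ h
    exact not_and_or.1 h
  have h3 := h1 (gapSeq β) n rfl q hq
  have h4 := h2 (gapSeq β) n rfl (blockSeq_le_succ _ n) (blockSeq_succ_le _ n) q hq
  have h5 := (measureReal_mono hsub (measure_ne_top (labelMeasure q) _)).trans
    (measureReal_union_le _ _)
  rw [add_mul, one_mul]
  linarith

theorem ae_eventually_notMem_of_summable {Ω : Type*} [MeasurableSpace Ω] {μ : Measure Ω}
    [IsProbabilityMeasure μ] {s : ℕ → Set Ω} {f : ℕ → ℝ} (hf : Summable f)
    (h : ∀ᶠ n in Filter.atTop, μ.real (s n) ≤ f n) :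
    ∀ᵐ ω ∂μ, ∀ᶠ n in Filter.atTop, ω ∉ s n := by
  refine ae_eventually_notMem ?_
  have hs : Summable fun n => μ.real (s n) :=
    Summable.of_norm_bounded_eventually_nat hf (by
      filter_upwards [h] with n hn
      rwa [Real.norm_of_nonneg measureReal_nonneg])
  have h1 : ∀ n, ENNReal.ofReal (μ.real (s n)) = μ (s n) := fun n => ofReal_measureReal
  simpa only [h1] using hs.tsum_ofReal_ne_top

theorem measureReal_not_robust (a : ℕ → ℕ) {α : Type*} [MeasurableSpace α] (κ : Measure α)
    [IsProbabilityMeasure κ] {o : Set α} (ho : MeasurableSet o) (q : I) (hq : κ.real o = q)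
    (n : ℕ) :
    (Measure.infinitePi fun _ : (chainGraph a).edgeSet => κ).real
        {ω | ¬ Robust a n (labelsIn ω o)}
      = (labelMeasure q).real {ξ | ¬ Robust a n (openLabels ξ)} :=
  measure_labelsIn_eq a κ ho q hq (P := fun S => ¬ Robust a n S)
    (measurableSet_robust measurableSet_mem_openLabels a n).compl
    (measurableSet_robust (measurableSet_mem_labelsIn ho) a n).compl (ignoresJunk_not_robust a n)

theorem ae_mem_percolates {β : ℝ} (hβ : 1 < β) (hβ4 : β ≤ 4) {q : I} (hq : crit ≤ q) :
    ∀ᵐ η ∂bondMeasure (chainGraph (gapSeq β)) q, η ∈ percolates (chainGraph (gapSeq β)) := by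
  have hβ0 : 0 < β := zero_lt_one.trans hβ
  obtain ⟨C, hC⟩ := eventually_not_robust_le hβ0
  have hsum : Summable fun n => C * critDead (gapSeq β n) ^ 2 ^ gapSeq β n := by
    have := summable_gapSeq hβ0 hβ4 zero_le_one hβ
    simp only [one_pow, one_mul] at this
    exact this.mul_left C
  have hae := ae_eventually_notMem_of_summable (μ := bondMeasure (chainGraph (gapSeq β)) q)
    (s := fun n => {η | ¬ Robust (gapSeq β) n (labelsIn η {true})}) hsum (by
      filter_upwards [hC] with n hn
      refine (measureReal_not_robust (gapSeq β) (edgeLaw q) (measurableSet_singleton true) q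
        (edgeLaw_real_true q) n).trans_le (hn q ?_)
      have h1 : (crit : ℝ) ≤ q := hq
      have h2 : (0 : ℝ) ≤ 1 / 2 ^ gapSeq β n := by positivity
      linarith)
  filter_upwards [hae] with η hη
  refine (hasInfiniteCluster_iff η {true}).2 (exists_infinite_component_of_robust ?_)
  filter_upwards [hη] with n hn
  exact not_not.1 hn

/-- Events that depend on the items of different gaps are independent. -/
theorem iIndepSet_of_gapLabels (a : ℕ → ℕ) {α : Type*} [MeasurableSpace α] (κ : Measure α)
    [IsProbabilityMeasure κ] {B : ℕ → Set ((chainGraph a).edgeSet → α)}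
    (hB : ∀ n, MeasurableSet (B n))
    (hd : ∀ n, DependsOn (fun ω => ω ∈ B n) {e | label e ∈ gapLabels n}) :
    iIndepSet B (Measure.infinitePi fun _ : (chainGraph a).edgeSet => κ) := by
  refine iIndepSet_of_dependsOn κ hB hd fun n m hnm => ?_
  refine Set.disjoint_left.2 ?_
  rintro e ⟨h1, -⟩ ⟨h2, -⟩
  exact hnm (h1.symm.trans h2)

theorem dependsOn_gapClosed (a : ℕ → ℕ) {α : Type*} (o : Set α) (n : ℕ) :
    DependsOn (fun ω : (chainGraph a).edgeSet → α => GapClosed a (labelsIn ω o) n)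
      {e | label e ∈ gapLabels n} := by
  intro ω ω' h
  refine localOn_gapClosed a n _ _ fun l hl => ?_
  constructor
  · rintro ⟨e, he, rfl⟩
    exact ⟨e, (congrArg (· ∈ o) (h e hl)).mp he, rfl⟩
  · rintro ⟨e, he, rfl⟩
    exact ⟨e, (congrArg (· ∈ o) (h e hl)).mpr he, rfl⟩

theorem measureReal_gapClosed (a : ℕ → ℕ) {α : Type*} [MeasurableSpace α] (κ : Measure α)
    [IsProbabilityMeasure κ] {o : Set α} (ho : MeasurableSet o) (q : I) (hq : κ.real o = q)
    (n : ℕ) :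
    (Measure.infinitePi fun _ : (chainGraph a).edgeSet => κ).real
        {ω | GapClosed a (labelsIn ω o) n} = deadProb q (a n) ^ 2 ^ a n := by
  rw [← labelMeasure_gapClosed]
  exact measure_labelsIn_eq a κ ho q hq (P := fun S => GapClosed a S n)
    (measurableSet_gapClosed measurableSet_mem_openLabels a n)
    (measurableSet_gapClosed (measurableSet_mem_labelsIn ho) a n) (ignoresJunk_gapClosed a n)

/-- The second Borel-Cantelli lemma. -/
theorem ae_frequently_mem_of_not_summable {Ω : Type*} [MeasurableSpace Ω] {μ : Measure Ω}
    {s : ℕ → Set Ω} (hs : ∀ n, MeasurableSet (s n)) (hind : iIndepSet s μ)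
    (h : ¬ Summable fun n => μ.real (s n)) : ∀ᵐ ω ∂μ, ∃ᶠ n in Filter.atTop, ω ∈ s n := by
  have : IsProbabilityMeasure μ := hind.isProbabilityMeasure
  have htop : ∑' n, μ (s n) = ⊤ := by
    by_contra hne
    exact h (ENNReal.summable_toReal hne)
  have h1 := measure_limsup_eq_one hs hind htop
  have h2 := (prob_compl_eq_zero_iff (MeasurableSet.measurableSet_limsup hs)).2 h1
  rw [← mem_ae_iff] at h2
  filter_upwards [h2] with ω hω
  exact Filter.mem_limsup_iff_frequently_mem.1 hω

open Filter in
theorem bondMeasure_percolates_eq_zero {β : ℝ} (hβ : 0 < β) {p : I} (hp : p < crit) :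
    bondMeasure (chainGraph (gapSeq β)) p (percolates (chainGraph (gapSeq β))) = 0 := by
  set a := gapSeq β with ha
  have hm : ∀ n, MeasurableSet {η : (chainGraph a).edgeSet → Bool |
      GapClosed a (labelsIn η {true}) n} := fun n =>
    measurableSet_gapClosed (measurableSet_mem_labelsIn (measurableSet_singleton true)) a n
  have hpc : (p : ℝ) < crit := hp
  have hns : ¬ Summable fun n => deadProb p (a n) ^ 2 ^ a n := by
    refine not_summable_gapSeq hβ (g := fun k => deadProb p k ^ 2 ^ k) (fun k => ?_) one_pos ?_
    · refine pow_nonneg ?_ _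
      exact le_trans (mul_nonneg (critDead_pos k).le (by linarith))
        (critDead_mul_le_deadProb p.2.1 hpc.le k)
    · -- `(1 + c) ^ 2 ^ k` outgrows `β ^ k`
      set c : ℝ := (crit - p) / 2 with hc
      have hc0 : 0 < c := by rw [hc]; linarith
      obtain ⟨m, hm⟩ := pow_unbounded_of_one_lt β one_lt_two
      have h1 := tendsto_two_pow.eventually (eventually_mul_pow_le (r := (1 + c)⁻¹)
        (by positivity) (inv_lt_one_of_one_lt₀ (by linarith)) one_pos m)
      filter_upwards [h1] with k hk
      have h2 : β ^ k ≤ (1 + c) ^ 2 ^ k := by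
        have h3 : β ^ k ≤ ((2 ^ k : ℕ) : ℝ) ^ m := by
          calc β ^ k ≤ (2 ^ m) ^ k := pow_le_pow_left₀ hβ.le hm.le k
            _ = ((2 ^ k : ℕ) : ℝ) ^ m := by push_cast; rw [← pow_mul, ← pow_mul, mul_comm]
        refine h3.trans ?_
        rwa [inv_pow, ← div_eq_mul_inv, div_le_one (by positivity)] at hk
      calc 1 * β ^ k * critDead k ^ 2 ^ k ≤ (1 + c) ^ 2 ^ k * critDead k ^ 2 ^ k := by
            rw [one_mul]
            exact mul_le_mul_of_nonneg_right h2 (pow_nonneg (critDead_pos k).le _)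
        _ = (critDead k * (1 + c)) ^ 2 ^ k := by rw [mul_pow, mul_comm]
        _ ≤ deadProb p k ^ 2 ^ k :=
            pow_le_pow_left₀ (mul_nonneg (critDead_pos k).le (by linarith))
              (critDead_mul_le_deadProb p.2.1 hpc.le k) _
  have hae := ae_frequently_mem_of_not_summable (μ := bondMeasure (chainGraph a) p) hm
    (iIndepSet_of_gapLabels a (edgeLaw p) hm fun n => dependsOn_gapClosed a {true} n) (by
      have he : ∀ n, (bondMeasure (chainGraph a) p).real {η | GapClosed a (labelsIn η {true}) n}
          = deadProb p (a n) ^ 2 ^ a n := fun n => measureReal_gapClosed a (edgeLaw p)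
        (measurableSet_singleton true) p (edgeLaw_real_true p) n
      simpa only [he] using hns)
  have : ∀ᵐ η ∂bondMeasure (chainGraph a) p, η ∉ percolates (chainGraph a) := by
    filter_upwards [hae] with η hη hperc
    refine not_exists_infinite_component (fun N => ?_) ((hasInfiniteCluster_iff η {true}).1 hperc)
    obtain ⟨n, hn, h⟩ := frequently_atTop.1 hη N
    exact ⟨n, hn, h⟩
  rw [ae_iff] at this
  simpa using this

theorem criticalProb_chainGraph {β : ℝ} (hβ : 1 < β) (hβ4 : β ≤ 4) :
    criticalProb (chainGraph (gapSeq β)) = crit := by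
  refine le_antisymm (sSup_le fun p hp => ?_) (le_of_forall_lt fun p hp => ?_)
  · by_contra! h
    have h1 := ae_mem_percolates hβ hβ4 h.le
    have h2 : ∀ᵐ η ∂bondMeasure (chainGraph (gapSeq β)) p,
        η ∉ percolates (chainGraph (gapSeq β)) := measure_eq_zero_iff_ae_notMem.1 hp
    obtain ⟨η, h3, h4⟩ := (h1.and h2).exists
    exact h4 h3
  · obtain ⟨p', h1, h2⟩ := exists_between hp
    exact h1.trans_le (le_sSup (bondMeasure_percolates_eq_zero (zero_lt_one.trans hβ) h2))

/-! ### The evolution of a single edge -/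

/-- The waiting times and statuses of a single edge. -/
abbrev Track : Type := ℕ → ℝ × Bool

/-- The law of the evolution of a single edge. -/
noncomputable def trackLaw (p : I) : Measure Track := Measure.infinitePi fun _ => stepLaw p

instance (p : I) : IsProbabilityMeasure (trackLaw p) := by
  unfold trackLaw; infer_instance

instance : IsProbabilityMeasure (expMeasure 1) := isProbabilityMeasure_expMeasure one_pos

/-- The time of the `n`-th refresh. -/
noncomputable def ring (x : Track) (n : ℕ) : ℝ := ∑ i ∈ Finset.range n, (x i).1

theorem ring_succ (x : Track) (n : ℕ) : ring x (n + 1) = ring x n + (x n).1 :=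
  Finset.sum_range_succ _ _

theorem measurable_ring (n : ℕ) : Measurable fun x => ring x n :=
  Finset.measurable_sum _ fun i _ => (measurable_pi_apply i).fst

theorem dependsOn_ring (n : ℕ) : DependsOn (fun x => ring x n) (Set.Iio n) := by
  intro x y h
  exact Finset.sum_congr rfl fun i hi => by rw [h i (Finset.mem_range.1 hi)]

/-- The tracks whose waiting times are nonnegative and whose refresh times do not accumulate. -/
def regularTracks : Set Track :=
  {x | (∀ n, 0 ≤ (x n).1) ∧ Filter.Tendsto (ring x) Filter.atTop Filter.atTop}

theorem ring_mono {x : Track} (hx : x ∈ regularTracks) : Monotone (ring x) :=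
  monotone_nat_of_le_succ fun n => by rw [ring_succ]; linarith [hx.1 n]

theorem expMeasure_Ioi {y : ℝ} (hy : 0 ≤ y) :
    expMeasure 1 (Set.Ioi y) = ENNReal.ofReal (Real.exp (-y)) := by
  have h := cdf_expMeasure_eq one_pos y
  rw [if_pos hy, cdf_eq_real] at h
  rw [← ofReal_measureReal, ← Set.compl_Iic, probReal_compl_eq_one_sub measurableSet_Iic, h]
  simp

theorem stepLaw_prod (p : I) (A : Set ℝ) (B : Set Bool) :
    stepLaw p (A ×ˢ B) = expMeasure 1 A * edgeLaw p B := Measure.prod_prod _ _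

/-- Integrating out the `m`-th step, given a function of the preceding ones. -/
theorem trackLaw_eq_lintegral (p : I) {δ : Type*} [MeasurableSpace δ] {f : Track → δ} {m : ℕ}
    (hf : Measurable f) (hd : DependsOn f (Set.Iio m)) {D : Set (δ × (ℝ × Bool))}
    (hD : MeasurableSet D) :
    trackLaw p {x | (f x, x m) ∈ D} = ∫⁻ x, stepLaw p {z | (f x, z) ∈ D} ∂trackLaw p := by
  have hm : Measurable fun x : Track => x m := measurable_pi_apply m
  have hind : IndepFun f (fun x : Track => x m) (trackLaw p) :=
    indepFun_of_dependsOn (stepLaw p) hf hm hd (t := {m}) (fun x y h => h m rfl)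
      (Set.disjoint_singleton_right.2 (lt_irrefl m))
  have hmap := (indepFun_iff_map_prod_eq_prod_map_map hf.aemeasurable hm.aemeasurable).1 hind
  have hlaw : (trackLaw p).map (fun x : Track => x m) = stepLaw p :=
    Measure.infinitePi_map_eval (μ := fun _ : ℕ => stepLaw p) m
  have h1 : trackLaw p {x | (f x, x m) ∈ D} = (trackLaw p).map (fun x => (f x, x m)) D :=
    (Measure.map_apply (hf.prodMk hm) hD).symm
  rw [h1, hmap, hlaw, Measure.prod_apply hD, lintegral_map (measurable_measure_prodMk_left hD) hf]
  rfl

theorem ae_mem_regularTracks (p : I) : ∀ᵐ x ∂trackLaw p, x ∈ regularTracks := by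
  have hstep : ∀ A : Set ℝ, MeasurableSet A → ∀ n,
      trackLaw p {x | (x n).1 ∈ A} = expMeasure 1 A := by
    intro A hA n
    have h := (measurePreserving_eval_infinitePi (fun _ : ℕ => stepLaw p) n).measure_preimage
      (hA.prod MeasurableSet.univ).nullMeasurableSet
    rw [stepLaw_prod, measure_univ, mul_one] at h
    rw [← h, trackLaw]
    congr 1
    ext x
    simp
  have hpos : ∀ᵐ x ∂trackLaw p, ∀ n, 0 ≤ (x n).1 := by
    refine ae_all_iff.2 fun n => ?_
    have h1 : expMeasure 1 (Set.Iio 0) = 0 := by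
      have h2 := expMeasure_Ioi (le_refl 0)
      rw [neg_zero, Real.exp_zero, ENNReal.ofReal_one, ← Set.compl_Iic] at h2
      exact measure_mono_null Set.Iio_subset_Iic_self
        ((prob_compl_eq_one_iff measurableSet_Iic).1 h2)
    rw [ae_iff]
    refine (congrArg _ ?_).trans ((hstep _ measurableSet_Iio n).trans h1)
    ext x
    simp
  have hlarge : ∀ᵐ x ∂trackLaw p, ∃ᶠ n in Filter.atTop, x ∈ {x : Track | (x n).1 ∈ Set.Ioi 1} := by
    have hm : ∀ n, MeasurableSet {x : Track | (x n).1 ∈ Set.Ioi 1} := fun n =>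
      (measurable_pi_apply n).fst measurableSet_Ioi
    refine ae_frequently_mem_of_not_summable hm (iIndepSet_of_dependsOn (stepLaw p) hm
      (L := fun n => {n}) (fun n x y h => by simp [h n rfl]) fun n m hnm => by
        simpa using hnm) ?_
    intro hs
    have h1 : ∀ n, (trackLaw p).real {x | (x n).1 ∈ Set.Ioi 1} = Real.exp (-1) := by
      intro n
      rw [measureReal_def, hstep _ measurableSet_Ioi, expMeasure_Ioi zero_le_one,
        ENNReal.toReal_ofReal (Real.exp_pos _).le]
    have h2 : Summable fun _ : ℕ => Real.exp (-1) := by rw [← funext h1]; exact hs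
    exact (Real.exp_pos (-1)).ne' ((summable_const_iff _).1 h2)
  filter_upwards [hpos, hlarge] with x h0 h1
  refine ⟨h0, ?_⟩
  have hmono : Monotone (ring x) :=
    monotone_nat_of_le_succ fun n => by rw [ring_succ]; linarith [h0 n]
  refine Filter.tendsto_atTop_atTop_of_monotone hmono fun b => ?_
  have hnat : ∀ N : ℕ, ∃ n, (N : ℝ) ≤ ring x n := by
    intro N
    induction N with
    | zero => exact ⟨0, by simp [ring]⟩
    | succ N ih =>
      obtain ⟨n, hn⟩ := ih
      obtain ⟨k, hk, hk1⟩ := Filter.frequently_atTop.1 h1 n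
      refine ⟨k + 1, ?_⟩
      have h2 : (1 : ℝ) < (x k).1 := hk1
      have h3 := hmono hk
      rw [ring_succ]
      push_cast
      linarith
  obtain ⟨N, hN⟩ := exists_nat_ge b
  obtain ⟨n, hn⟩ := hnat N
  exact ⟨n, hN.trans hn⟩

/-- At time `t`, the last refresh was the `n`-th one. -/
def currentStep (n : ℕ) (t : ℝ) : Set Track := {x | ring x n ≤ t ∧ t < ring x (n + 1)}

theorem measurableSet_currentStep (n : ℕ) (t : ℝ) : MeasurableSet (currentStep n t) :=
  (measurableSet_le (measurable_ring n) measurable_const).inter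
    (measurableSet_lt measurable_const (measurable_ring (n + 1)))

theorem currentStep_unique {x : Track} (hx : x ∈ regularTracks) {n m : ℕ} {t : ℝ}
    (hn : x ∈ currentStep n t) (hm : x ∈ currentStep m t) : n = m := by
  by_contra hne
  rcases lt_or_gt_of_ne hne with h | h
  · exact absurd (ring_mono hx (show n + 1 ≤ m from h)) (not_le.2 (hm.1.trans_lt hn.2))
  · exact absurd (ring_mono hx (show m + 1 ≤ n from h)) (not_le.2 (hn.1.trans_lt hm.2))

theorem exists_currentStep {x : Track} (hx : x ∈ regularTracks) {t : ℝ} {n : ℕ}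
    (ht : ring x n ≤ t) : ∃ m, n ≤ m ∧ x ∈ currentStep m t := by
  classical
  have hex : ∃ k, t < ring x k := (hx.2.eventually_gt_atTop t).exists
  have hlt : n < Nat.find hex := by
    by_contra! h
    exact absurd (ring_mono hx h) (not_le.2 (ht.trans_lt (Nat.find_spec hex)))
  refine ⟨Nat.find hex - 1, by omega, ?_, ?_⟩
  · exact not_lt.1 (Nat.find_min hex (show Nat.find hex - 1 < Nat.find hex by omega))
  · have := Nat.find_spec hex
    rwa [show Nat.find hex = Nat.find hex - 1 + 1 by omega] at this

theorem aedisjoint_of_subset_currentStep (p : I) {t : ℝ} {A : ℕ → Set Track}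
    (hA : ∀ n, A n ⊆ currentStep n t) :
    Pairwise (Function.onFun (AEDisjoint (trackLaw p)) A) := by
  intro n m hnm
  refine measure_mono_null (t := regularTracksᶜ) ?_ (mem_ae_iff.1 (ae_mem_regularTracks p))
  rintro x ⟨h1, h2⟩ hx
  exact hnm (currentStep_unique hx (hA n h1) (hA m h2))

theorem tsum_currentStep (p : I) {t : ℝ} (ht : 0 ≤ t) :
    ∑' n, trackLaw p (currentStep n t) = 1 := by
  rw [← measure_iUnion₀ (aedisjoint_of_subset_currentStep p fun n => subset_rfl)
    fun n => (measurableSet_currentStep n t).nullMeasurableSet]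
  rw [← measure_univ (μ := trackLaw p)]
  refine measure_congr ?_
  filter_upwards [ae_mem_regularTracks p] with x hx
  refine eq_true (p := x ∈ ⋃ n, currentStep n t) ?_ |>.trans (eq_true (Set.mem_univ x)).symm
  obtain ⟨m, -, hm⟩ := exists_currentStep hx (n := 0) (t := t) (by simpa [ring] using ht)
  exact Set.mem_iUnion.2 ⟨m, hm⟩

/-- The loss of memory: given the past of the `m`-th refresh, its status is Bernoulli and the time
until the next one is exponential. -/
theorem trackLaw_step (p : I) (m : ℕ) {F : Set Track} (hF : MeasurableSet F)
    (hd : DependsOn (fun x => x ∈ F) (Set.Iio m)) {s t : ℝ} (hst : s ≤ t) (B : Set Bool) :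
    trackLaw p (F ∩ {x | ring x m ≤ s ∧ t < ring x (m + 1) ∧ (x m).2 ∈ B})
      = edgeLaw p B * ENNReal.ofReal (Real.exp (-(t - s))) * trackLaw p (F ∩ currentStep m s) := by
  have key : ∀ (t : ℝ) (B : Set Bool), s ≤ t →
      trackLaw p (F ∩ {x | ring x m ≤ s ∧ t < ring x (m + 1) ∧ (x m).2 ∈ B})
        = edgeLaw p B * ENNReal.ofReal (Real.exp (-(t - s))) *
          ∫⁻ x, (F ∩ {x | ring x m ≤ s}).indicator
            (fun x => ENNReal.ofReal (Real.exp (-(s - ring x m)))) x ∂trackLaw p := by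
    intro t B hst
    set f : Track → Prop × ℝ := fun x => (x ∈ F, ring x m) with hf
    have hfm : Measurable f := (measurable_mem.2 hF).prodMk (measurable_ring m)
    have hfd : DependsOn f (Set.Iio m) := fun x y h => by
      have h1 := hd h
      have h2 := dependsOn_ring m h
      simp only at h1 h2
      simp only [hf, h1, h2]
    set D : Set ((Prop × ℝ) × (ℝ × Bool)) :=
      {w | w.1.1 ∧ w.1.2 ≤ s ∧ t < w.1.2 + w.2.1 ∧ w.2.2 ∈ B} with hD
    have hDm : MeasurableSet D := by
      refine (measurableSet_setOfPred.2 measurable_fst.fst).inter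
        ((measurableSet_le measurable_fst.snd measurable_const).inter
        ((measurableSet_lt measurable_const (measurable_fst.snd.add measurable_snd.fst)).inter
        (measurable_snd.snd (MeasurableSet.of_discrete (s := B)))))
    have hset : F ∩ {x | ring x m ≤ s ∧ t < ring x (m + 1) ∧ (x m).2 ∈ B}
        = {x | (f x, x m) ∈ D} := by
      ext x
      simp only [Set.mem_inter_iff, Set.mem_ofPred_eq, hf, hD, ring_succ]
    rw [hset, trackLaw_eq_lintegral p hfm hfd hDm, ← lintegral_const_mul']
    swap
    · exact ENNReal.mul_ne_top (measure_ne_top _ _) ENNReal.ofReal_ne_top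
    refine lintegral_congr fun x => ?_
    by_cases hx : x ∈ F ∩ {x | ring x m ≤ s}
    · have hslice : {z | (f x, z) ∈ D} = Set.Ioi (t - ring x m) ×ˢ B := by
        ext z
        have h1 : x ∈ F := hx.1
        have h2 : ring x m ≤ s := hx.2
        simp only [hf, hD, Set.mem_ofPred_eq, h1, h2, true_and, Set.mem_prod, Set.mem_Ioi]
        rw [sub_lt_iff_lt_add']
      have h2 : ring x m ≤ s := hx.2
      rw [hslice, stepLaw_prod, expMeasure_Ioi (by linarith), Set.indicator_of_mem hx, mul_assoc,
        ← ENNReal.ofReal_mul (Real.exp_pos _).le, ← Real.exp_add, mul_comm]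
      ring_nf
    · have hslice : {z | (f x, z) ∈ D} = ∅ := by
        ext z
        simp only [hf, hD, Set.mem_ofPred_eq, Set.mem_empty_iff_false, iff_false]
        exact fun h => hx ⟨h.1, h.2.1⟩
      rw [hslice, measure_empty, Set.indicator_of_notMem hx, mul_zero]
  have h1 := key s Set.univ le_rfl
  rw [sub_self, neg_zero, Real.exp_zero, ENNReal.ofReal_one, measure_univ, one_mul, one_mul] at h1
  rw [key t B hst, ← h1]
  congr 3
  ext x
  simp [currentStep]

theorem trackLaw_openStep (p : I) (n : ℕ) {s t : ℝ} (hst : s ≤ t) (B : Set Bool) :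
    trackLaw p {x | ring x n ≤ s ∧ t < ring x (n + 1) ∧ (x n).2 ∈ B}
      = edgeLaw p B * ENNReal.ofReal (Real.exp (-(t - s))) * trackLaw p (currentStep n s) := by
  have h := trackLaw_step p n MeasurableSet.univ (fun _ _ _ => rfl) hst B
  simpa only [Set.univ_inter] using h

theorem measurableSet_step (n : ℕ) (s t : ℝ) (B : Set Bool) :
    MeasurableSet {x : Track | ring x n ≤ s ∧ t < ring x (n + 1) ∧ (x n).2 ∈ B} :=
  (measurableSet_le (measurable_ring n) measurable_const).inter
    ((measurableSet_lt measurable_const (measurable_ring (n + 1))).inter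
      ((measurable_pi_apply n).snd (MeasurableSet.of_discrete (s := B))))

/-- The last refresh before the time `s` resulted in the status `b`, and there is no refresh
between `s` and `t`. -/
def steadyOn (b : Bool) (s t : ℝ) : Set Track :=
  ⋃ n, {x | ring x n ≤ s ∧ t < ring x (n + 1) ∧ (x n).2 ∈ ({b} : Set Bool)}

theorem measurableSet_steadyOn (b : Bool) (s t : ℝ) : MeasurableSet (steadyOn b s t) :=
  MeasurableSet.iUnion fun n => measurableSet_step n s t {b}

theorem trackLaw_steadyOn (p : I) (b : Bool) {s t : ℝ} (hs : 0 ≤ s) (hst : s ≤ t) :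
    trackLaw p (steadyOn b s t) = edgeLaw p {b} * ENNReal.ofReal (Real.exp (-(t - s))) := by
  rw [steadyOn, measure_iUnion₀ (aedisjoint_of_subset_currentStep p (t := s) fun n x hx =>
    ⟨hx.1, hst.trans_lt hx.2.1⟩) fun n => (measurableSet_step n s t {b}).nullMeasurableSet]
  simp only [trackLaw_openStep p _ hst]
  rw [ENNReal.tsum_mul_left, tsum_currentStep p hs, mul_one]

/-- The edge is open at time `t`. The ends of the waiting intervals count on both sides, as they do
in `openEdgesAt`. -/
def openAt (t : ℝ) : Set Track :=
  {x | ∃ n, (x n).2 = true ∧ ring x n ≤ t ∧ t ≤ ring x (n + 1)}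

theorem measurableSet_openAt (t : ℝ) : MeasurableSet (openAt t) := by
  have : openAt t = ⋃ n, {x : Track | (x n).2 ∈ ({true} : Set Bool) ∧ ring x n ≤ t ∧
      t ≤ ring x (n + 1)} := by
    ext x; simp [openAt]
  rw [this]
  exact MeasurableSet.iUnion fun n =>
    ((measurable_pi_apply n).snd (MeasurableSet.of_discrete (s := {true}))).inter
      ((measurableSet_le (measurable_ring n) measurable_const).inter
        (measurableSet_le measurable_const (measurable_ring (n + 1))))

theorem steadyOn_true_subset {s t r : ℝ} (hr : r ∈ Set.Icc s t) :
    steadyOn true s t ⊆ openAt r := by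
  intro x hx
  obtain ⟨n, h1, h2, h3⟩ := Set.mem_iUnion.1 hx
  exact ⟨n, h3, h1.trans hr.1, hr.2.trans h2.le⟩

theorem trackLaw_ring_eq (p : I) (n : ℕ) (t : ℝ) : trackLaw p {x | ring x (n + 1) = t} = 0 := by
  have h := trackLaw_eq_lintegral p (measurable_ring n) (dependsOn_ring n)
    (D := {w : ℝ × (ℝ × Bool) | w.1 + w.2.1 = t})
    (measurableSet_eq_fun (measurable_fst.add measurable_snd.fst) measurable_const)
  simp only [Set.mem_ofPred_eq, ← ring_succ] at h
  rw [h]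
  refine lintegral_eq_zero_of_ae_eq_zero (.of_forall fun x => ?_)
  change stepLaw p {z : ℝ × Bool | ring x n + z.1 = t} = 0
  have hset : {z : ℝ × Bool | ring x n + z.1 = t} = {t - ring x n} ×ˢ Set.univ := by
    ext z
    simp only [Set.mem_ofPred_eq, Set.mem_prod, Set.mem_singleton_iff, Set.mem_univ, and_true]
    constructor <;> intro h <;> linarith
  have hac : expMeasure 1 ≪ volume := withDensity_absolutelyContinuous _ _
  rw [hset, stepLaw_prod, hac Real.volume_singleton, zero_mul]

/-- Almost surely, an edge whose last refresh before `t` has made it closed is closed at time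
`t`. -/
theorem ae_steadyOn_false_notMem_openAt (p : I) (t : ℝ) :
    ∀ᵐ x ∂trackLaw p, x ∈ steadyOn false t t → x ∉ openAt t := by
  have h : ∀ᵐ x ∂trackLaw p, ∀ n, ring x (n + 1) ≠ t :=
    ae_all_iff.2 fun n => by
      rw [ae_iff]
      simpa using trackLaw_ring_eq p n t
  filter_upwards [h, ae_mem_regularTracks p] with x h1 hx hc
  rintro ⟨m, hm, hm1, hm2⟩
  obtain ⟨n, hn1, hn2, hn3⟩ := Set.mem_iUnion.1 hc
  have hn3 : (x n).2 = false := hn3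
  rcases lt_trichotomy m n with hmn | rfl | hmn
  · have h2 := ring_mono hx (show m + 1 ≤ n from hmn)
    have h3 : ring x (m + 1) = t := le_antisymm (h2.trans hn1) hm2
    exact h1 m h3
  · rw [hm] at hn3
    exact Bool.noConfusion hn3
  · exact absurd (ring_mono hx (show n + 1 ≤ m from hmn)) (not_le.2 (hm1.trans_lt hn2))

theorem edgeLaw_true (p : I) : edgeLaw p {true} = ENNReal.ofReal p := by
  rw [← ofReal_measureReal, edgeLaw_real_true]

theorem edgeLaw_false (p : I) : edgeLaw p {false} = ENNReal.ofReal (1 - p) := by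
  rw [← ofReal_measureReal, edgeLaw_real_false]

theorem trackLaw_real_steadyOn (p : I) {s t : ℝ} (hs : 0 ≤ s) (hst : s ≤ t) :
    (trackLaw p).real (steadyOn true s t) = p * Real.exp (-(t - s)) := by
  rw [measureReal_def, trackLaw_steadyOn p true hs hst, edgeLaw_true, ENNReal.toReal_mul,
    ENNReal.toReal_ofReal p.2.1, ENNReal.toReal_ofReal (Real.exp_pos _).le]

theorem trackLaw_real_openAt (p : I) {t : ℝ} (ht : 0 ≤ t) : (trackLaw p).real (openAt t) = p := by
  refine le_antisymm ?_ ?_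
  · have h1 : (trackLaw p).real (steadyOn false t t) = 1 - p := by
      rw [measureReal_def, trackLaw_steadyOn p false ht le_rfl, edgeLaw_false, sub_self, neg_zero,
        Real.exp_zero, ENNReal.ofReal_one, mul_one, ENNReal.toReal_ofReal]
      linarith [p.2.2]
    have h2 : (trackLaw p).real (openAt t) ≤ (trackLaw p).real (steadyOn false t t)ᶜ := by
      refine ENNReal.toReal_mono (measure_ne_top _ _) (measure_mono_ae ?_)
      filter_upwards [ae_steadyOn_false_notMem_openAt p t] with x hx h h'
      exact hx h' h
    rw [probReal_compl_eq_one_sub (measurableSet_steadyOn _ _ _), h1] at h2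
    linarith
  · have h1 := trackLaw_real_steadyOn p ht (le_refl t)
    rw [sub_self, neg_zero, Real.exp_zero, mul_one] at h1
    rw [← h1]
    exact measureReal_mono (steadyOn_true_subset ⟨le_rfl, le_rfl⟩)

/-- The probability to be closed at time `s` and open at time `t`. -/
theorem le_trackLaw_real_closed_open (p : I) {s t : ℝ} (hs : 0 ≤ s) (hst : s ≤ t) :
    p * (1 - p) * (1 - Real.exp (-(t - s)))
      ≤ (trackLaw p).real {x | x ∉ openAt s ∧ x ∈ openAt t} := by
  set C : ℕ → Set Track := fun n =>
    {x | ring x n ≤ s ∧ s < ring x (n + 1) ∧ (x n).2 ∈ ({false} : Set Bool)} with hC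
  have hCm : ∀ n, MeasurableSet (C n) := fun n => measurableSet_step n s s {false}
  have hCsub : ∀ n, C n ⊆ currentStep n s := fun n x hx => ⟨hx.1, hx.2.1⟩
  have hCd : ∀ n m, n < m → DependsOn (fun x => x ∈ C n) (Set.Iio m) := by
    intro n m hnm x y h
    have h1 := dependsOn_ring n fun i hi => h i (lt_trans (Set.mem_Iio.1 hi) hnm)
    have h2 := dependsOn_ring (n + 1) fun i hi =>
      h i (lt_of_lt_of_le (Set.mem_Iio.1 hi) hnm)
    simp only at h1 h2
    simp only [hC, Set.mem_ofPred_eq, h1, h2, h n hnm]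
  have he1 : Real.exp (-(t - s)) ≤ 1 := Real.exp_le_one_iff.2 (by linarith)
  -- the probability that the `n`-th step is current at time `s` and closed, and that the edge has
  -- been refreshed and is open at time `t`
  have hn : ∀ n, edgeLaw p {true} * (edgeLaw p {false} *
      ENNReal.ofReal (1 - Real.exp (-(t - s))) * trackLaw p (currentStep n s))
      ≤ trackLaw p (C n ∩ openAt t) := by
    intro n
    have hsub : ⋃ k, C n ∩ {x | ring x (n + 1 + k) ≤ t ∧ t < ring x (n + 1 + k + 1) ∧
        (x (n + 1 + k)).2 ∈ ({true} : Set Bool)} ⊆ C n ∩ openAt t := by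
      refine Set.iUnion_subset fun k x hx => ⟨hx.1, n + 1 + k, hx.2.2.2, hx.2.1, hx.2.2.1.le⟩
    have hdisj : ∀ (A : ℕ → Set Track), (∀ k, A k ⊆ currentStep (n + 1 + k) t) →
        Pairwise (Function.onFun (AEDisjoint (trackLaw p)) A) := by
      intro A hA k k' hkk
      refine measure_mono_null (t := regularTracksᶜ) ?_ (mem_ae_iff.1 (ae_mem_regularTracks p))
      rintro x ⟨h1, h2⟩ hx
      have := currentStep_unique hx (hA k h1) (hA k' h2)
      omega
    refine le_trans ?_ (measure_mono hsub)
    rw [measure_iUnion₀ (hdisj _ fun k x hx => ⟨hx.2.1, hx.2.2.1⟩)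
      fun k => ((hCm n).inter (measurableSet_step _ t t {true})).nullMeasurableSet]
    have hstep : ∀ k, trackLaw p (C n ∩ {x | ring x (n + 1 + k) ≤ t ∧ t < ring x (n + 1 + k + 1) ∧
        (x (n + 1 + k)).2 ∈ ({true} : Set Bool)}) = _ := fun k =>
      trackLaw_step p (n + 1 + k) (hCm n) (hCd n _ (by omega)) (le_refl t) {true}
    simp only [hstep]
    rw [sub_self, neg_zero, Real.exp_zero, ENNReal.ofReal_one, mul_one, ENNReal.tsum_mul_left]
    gcongr
    rw [← measure_iUnion₀ (hdisj _ fun k => Set.inter_subset_right)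
      fun k => ((hCm n).inter (measurableSet_currentStep _ t)).nullMeasurableSet]
    have hcover : trackLaw p (C n) ≤ trackLaw p (⋃ k, C n ∩ currentStep (n + 1 + k) t) +
        trackLaw p {x | ring x n ≤ s ∧ t < ring x (n + 1) ∧ (x n).2 ∈ ({false} : Set Bool)} := by
      refine (measure_mono_ae ?_).trans (measure_union_le _ _)
      filter_upwards [ae_mem_regularTracks p] with x hx hxC
      by_cases ht : t < ring x (n + 1)
      · exact Or.inr ⟨hxC.1, ht, hxC.2.2⟩
      · obtain ⟨m, hm, hm'⟩ := exists_currentStep hx (not_lt.1 ht)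
        refine Or.inl (Set.mem_iUnion.2 ⟨m - (n + 1), hxC, ?_⟩)
        rwa [show n + 1 + (m - (n + 1)) = m by omega]
    have hCn : trackLaw p (C n) = edgeLaw p {false} * trackLaw p (currentStep n s) := by
      have := trackLaw_openStep p n (le_refl s) {false}
      rwa [sub_self, neg_zero, Real.exp_zero, ENNReal.ofReal_one, mul_one] at this
    rw [hCn, trackLaw_openStep p n hst] at hcover
    refine le_trans ?_ (tsub_le_iff_right.2 hcover)
    refine ENNReal.le_sub_of_add_le_right (ENNReal.mul_ne_top (ENNReal.mul_ne_top
      (measure_ne_top _ _) ENNReal.ofReal_ne_top) (measure_ne_top _ _)) ?_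
    rw [← add_mul, ← mul_add, ← ENNReal.ofReal_add (by linarith) (Real.exp_pos _).le]
    simp
  have htot : edgeLaw p {true} * (edgeLaw p {false} * ENNReal.ofReal (1 - Real.exp (-(t - s))))
      ≤ trackLaw p {x | x ∉ openAt s ∧ x ∈ openAt t} := by
    calc _ = ∑' n, edgeLaw p {true} * (edgeLaw p {false} *
          ENNReal.ofReal (1 - Real.exp (-(t - s))) * trackLaw p (currentStep n s)) := by
          rw [ENNReal.tsum_mul_left, ENNReal.tsum_mul_left, tsum_currentStep p hs, mul_one]
      _ ≤ ∑' n, trackLaw p (C n ∩ openAt t) := ENNReal.tsum_le_tsum hn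
      _ = trackLaw p (⋃ n, C n ∩ openAt t) :=
          (measure_iUnion₀ (aedisjoint_of_subset_currentStep p
            fun n => Set.inter_subset_left.trans (hCsub n))
            fun n => ((hCm n).inter (measurableSet_openAt t)).nullMeasurableSet).symm
      _ ≤ _ := by
          refine measure_mono_ae ?_
          filter_upwards [ae_steadyOn_false_notMem_openAt p s] with x hx hxC
          obtain ⟨n, hn1, hn2⟩ := Set.mem_iUnion.1 hxC
          exact ⟨hx (Set.mem_iUnion.2 ⟨n, hn1⟩), hn2⟩
  have h0 : (0 : ℝ) ≤ 1 - p := by linarith [p.2.2]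
  rw [edgeLaw_true, edgeLaw_false, ← ENNReal.ofReal_mul h0, ← ENNReal.ofReal_mul p.2.1,
    ← ofReal_measureReal, ENNReal.ofReal_le_ofReal_iff measureReal_nonneg] at htot
  linarith

/-- The set of times at which an edge is closed is open. -/
theorem isOpen_closedTimes {x : Track} (hx : x ∈ regularTracks) : IsOpen {t | x ∉ openAt t} := by
  have hset : {t | x ∉ openAt t}
      = (⋃ n : {n // (x n).2 = true}, Set.Icc (ring x n) (ring x (n + 1)))ᶜ := by
    ext t
    simp [openAt]
  rw [hset, isOpen_compl_iff]
  refine LocallyFinite.isClosed_iUnion (fun t => ⟨Set.Iio (t + 1), Iio_mem_nhds (by linarith), ?_⟩)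
    fun n => isClosed_Icc
  obtain ⟨N, hN⟩ := Filter.eventually_atTop.1 (hx.2.eventually_ge_atTop (t + 1))
  refine Set.Finite.of_finite_image ((Set.finite_Iio N).subset ?_) Subtype.val_injective.injOn
  rintro _ ⟨n, ⟨r, hr1, hr2⟩, rfl⟩
  by_contra h
  exact absurd (hN n (not_lt.1 h)) (not_le.2 (hr1.1.trans_lt hr2))

/-! ### Percolation at all times -/

/-- The edge is open throughout the `j`-th dyadic window of length `2 ^ (-d)`, in which it is not
refreshed. -/
def openWindow (d j : ℕ) : Set Track := steadyOn true (j / 2 ^ d) ((j + 1) / 2 ^ d)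

theorem measurableSet_openWindow (d j : ℕ) : MeasurableSet (openWindow d j) :=
  measurableSet_steadyOn _ _ _

theorem steadyOn_mono (b : Bool) {s s' t t' : ℝ} (hs : s ≤ s') (ht : t' ≤ t) :
    steadyOn b s t ⊆ steadyOn b s' t' :=
  Set.iUnion_mono fun _ _ hx => ⟨hx.1.trans hs, ht.trans_lt hx.2.1, hx.2.2⟩

theorem openWindow_subset_openAt {t : ℝ} (ht : 0 ≤ t) (d : ℕ) :
    openWindow d ⌊t * 2 ^ d⌋₊ ⊆ openAt t := by
  have h0 : (0 : ℝ) < 2 ^ d := by positivity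
  refine steadyOn_true_subset ⟨?_, ?_⟩
  · rw [div_le_iff₀ h0]
    exact Nat.floor_le (by positivity)
  · rw [le_div_iff₀ h0]
    exact (Nat.lt_floor_add_one _).le

theorem monotone_openWindow {t : ℝ} (ht : 0 ≤ t) :
    Monotone fun d : ℕ => openWindow d ⌊t * 2 ^ d⌋₊ := by
  refine monotone_nat_of_le_succ fun d => steadyOn_mono true ?_ ?_
  · have h1 : (⌊t * 2 ^ d⌋₊ : ℝ) ≤ t * 2 ^ d := Nat.floor_le (by positivity)
    have h2 : 2 * ⌊t * 2 ^ d⌋₊ ≤ ⌊t * 2 ^ (d + 1)⌋₊ := by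
      refine Nat.le_floor ?_
      rw [pow_succ]
      push_cast
      linarith
    have h3 : (2 * ⌊t * 2 ^ d⌋₊ : ℝ) ≤ ⌊t * 2 ^ (d + 1)⌋₊ := by exact_mod_cast h2
    rw [div_le_div_iff₀ (by positivity) (by positivity)]
    calc (⌊t * 2 ^ d⌋₊ : ℝ) * 2 ^ (d + 1) = 2 * ⌊t * 2 ^ d⌋₊ * 2 ^ d := by ring
      _ ≤ ⌊t * 2 ^ (d + 1)⌋₊ * 2 ^ d := by gcongr
  · have h1 : t * 2 ^ d < ⌊t * 2 ^ d⌋₊ + 1 := Nat.lt_floor_add_one _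
    have h2 : ⌊t * 2 ^ (d + 1)⌋₊ < 2 * (⌊t * 2 ^ d⌋₊ + 1) := by
      refine (Nat.floor_lt (by positivity)).2 ?_
      rw [pow_succ]
      push_cast
      linarith
    have h3 : (⌊t * 2 ^ (d + 1)⌋₊ + 1 : ℝ) ≤ 2 * (⌊t * 2 ^ d⌋₊ + 1) := by exact_mod_cast h2
    rw [div_le_div_iff₀ (by positivity) (by positivity)]
    calc (⌊t * 2 ^ (d + 1)⌋₊ + 1 : ℝ) * 2 ^ d ≤ 2 * (⌊t * 2 ^ d⌋₊ + 1) * 2 ^ d := by gcongr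
      _ = (⌊t * 2 ^ d⌋₊ + 1) * 2 ^ (d + 1) := by ring

/-- The density of the edges that are open throughout a short window is slightly subcritical. -/
theorem exists_trackLaw_real_openWindow (d j : ℕ) :
    ∃ q : I, (crit : ℝ) - 1 / 2 ^ d ≤ q ∧ (trackLaw crit).real (openWindow d j) = q := by
  refine ⟨⟨(trackLaw crit).real (openWindow d j), measureReal_nonneg, measureReal_le_one⟩, ?_, rfl⟩
  have h0 : (0 : ℝ) < 2 ^ d := by positivity
  have h1 := trackLaw_real_steadyOn crit (s := j / 2 ^ d) (t := (j + 1) / 2 ^ d) (by positivity)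
    (by gcongr; linarith)
  have h2 := Real.add_one_le_exp (-(((j : ℝ) + 1) / 2 ^ d - j / 2 ^ d))
  have h3 : ((j : ℝ) + 1) / 2 ^ d - j / 2 ^ d = 1 / 2 ^ d := by ring
  have h4 : (crit : ℝ) ≤ 1 := crit.2.2
  have h5 : (0 : ℝ) ≤ crit := crit.2.1
  have h6 : (0 : ℝ) < 1 / 2 ^ d := by positivity
  change _ ≤ (trackLaw crit).real (openWindow d j)
  rw [openWindow, h1]
  rw [h3] at h2 ⊢
  nlinarith

/-- A union bound over the windows that meet a bounded time interval. -/
theorem dynMeasure_exists_window_le (a : ℕ → ℕ) {P : Set Label → Prop} (d N : ℕ) {b : ℝ}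
    (hP : ∀ {Ω : Type} [MeasurableSpace Ω] {R : Ω → Set Label},
      (∀ l, MeasurableSet {ω | l ∈ R ω}) → MeasurableSet {ω | P (R ω)})
    (hPj : IgnoresJunk a P)
    (hb : ∀ q : I, (crit : ℝ) - 1 / 2 ^ d ≤ q → (labelMeasure q).real {ξ | P (openLabels ξ)} ≤ b) :
    (dynMeasure (chainGraph a) crit).real
      {ω | ∃ j < N * 2 ^ d, P (labelsIn ω (openWindow d j))} ≤ N * (2 ^ d * b) := by
  have hset : {ω : History (chainGraph a) | ∃ j < N * 2 ^ d, P (labelsIn ω (openWindow d j))}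
      = ⋃ j ∈ Finset.range (N * 2 ^ d), {ω | P (labelsIn ω (openWindow d j))} := by
    ext ω
    simp
  rw [hset]
  refine (measureReal_biUnion_finset_le _ _).trans ?_
  have h1 : ∀ j ∈ Finset.range (N * 2 ^ d), (dynMeasure (chainGraph a) crit).real
      {ω | P (labelsIn ω (openWindow d j))} ≤ b := by
    intro j _
    obtain ⟨q, hq, hj⟩ := exists_trackLaw_real_openWindow d j
    exact (measure_labelsIn_eq a (trackLaw crit) (measurableSet_openWindow d j) q hj
      (hP measurableSet_mem_openLabels) (hP (measurableSet_mem_labelsIn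
        (measurableSet_openWindow d j))) hPj).trans_le (hb q hq)
  refine (Finset.sum_le_card_nsmul _ _ _ h1).trans_eq ?_
  rw [Finset.card_range, nsmul_eq_mul]
  push_cast
  ring

open Filter in
theorem ae_forall_percolatesAt : ∀ᵐ ω ∂dynMeasure (chainGraph (gapSeq 4)) crit,
    ∀ t : ℝ, 0 ≤ t → ω ∈ percolatesAt (chainGraph (gapSeq 4)) t := by
  set a := gapSeq 4 with ha
  have hmono : Monotone a := monotone_nat_of_le_succ fun n => blockSeq_le_succ _ n
  have hsum : Summable fun n => (2 : ℝ) ^ a n * critDead (a n) ^ 2 ^ a n :=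
    summable_gapSeq (by norm_num) le_rfl (by norm_num) (by norm_num)
  obtain ⟨C, hC⟩ := eventually_not_gapOpen_le
  have hgap : ∀ᵐ ω ∂dynMeasure (chainGraph a) crit, ∀ N : ℕ, ∀ᶠ n in atTop,
      ω ∉ {ω | ∃ j < N * 2 ^ a n, ¬ GapOpen a (labelsIn ω (openWindow (a n) j))
        (target (a n)) n} := by
    refine ae_all_iff.2 fun N => ae_eventually_notMem_of_summable ((hsum.mul_left C).mul_left
      (N : ℝ)) ?_
    filter_upwards [(tendsto_gapSeq (β := 4) (by norm_num)).eventually hC] with n hn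
    refine (dynMeasure_exists_window_le a
      (P := fun S => ¬ GapOpen a S (target (a n)) n) (a n) N
      (fun hR => (measurableSet_gapOpen hR a _ n).compl)
      (fun S => not_congr (ignoresJunk_gapOpen a _ n S)) fun q hq => hn a n rfl q hq).trans_eq ?_
    ring
  have hhub : ∀ᵐ ω ∂dynMeasure (chainGraph a) crit, ∀ N : ℕ, ∀ᶠ n in atTop,
      ω ∉ {ω | ∃ j < N * 2 ^ a (n + 1), ¬ HubOpen a (labelsIn ω (openWindow (a (n + 1)) j))
        (target (a n)) (target (a (n + 1))) n} := by
    refine ae_all_iff.2 fun N => ae_eventually_notMem_of_summable ((hsum.mul_left 2).mul_left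
      (N : ℝ)) ?_
    filter_upwards [(tendsto_gapSeq (β := 4) (by norm_num)).eventually eventually_not_hubOpen_le]
      with n hn
    have h1 : a n ≤ a (n + 1) := blockSeq_le_succ _ n
    have h2 : a (n + 1) ≤ a n + 1 := blockSeq_succ_le _ n
    refine (dynMeasure_exists_window_le a
      (P := fun S => ¬ HubOpen a S (target (a n)) (target (a (n + 1))) n) (a (n + 1)) N
      (fun hR => (measurableSet_hubOpen hR a _ _ n).compl)
      (fun S => not_congr (ignoresJunk_hubOpen a _ _ n S)) fun q hq =>
        hn a n rfl h1 h2 q (le_trans ?_ hq)).trans ?_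
    · have : (1 : ℝ) / 2 ^ a (n + 1) ≤ 1 / 2 ^ a n :=
        one_div_le_one_div_of_le (by positivity) (pow_le_pow_right₀ one_le_two h1)
      linarith
    · have h3 : (2 : ℝ) ^ a (n + 1) ≤ 2 * 2 ^ a n := by
        rw [← pow_succ']
        exact pow_le_pow_right₀ one_le_two h2
      have h4 : (0 : ℝ) ≤ critDead (a n) ^ 2 ^ a n := pow_nonneg (critDead_pos _).le _
      have h5 := mul_le_mul_of_nonneg_right h3 h4
      have h6 : (0 : ℝ) ≤ N := Nat.cast_nonneg N
      rw [mul_assoc] at h5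
      exact mul_le_mul_of_nonneg_left h5 h6
  filter_upwards [hgap, hhub] with ω h1 h2 t ht
  obtain ⟨N, hN⟩ := exists_nat_gt t
  have hlt : ∀ d : ℕ, ⌊t * 2 ^ d⌋₊ < N * 2 ^ d := fun d => by
    refine (Nat.floor_lt (by positivity)).2 ?_
    push_cast
    gcongr
  obtain ⟨m, hm⟩ := eventually_atTop.1 ((h1 N).and (h2 N))
  refine (hasInfiniteCluster_iff ω (openAt t)).2 (exists_infinite_component
    (W := fun n => labelsIn ω (openWindow (a n) ⌊t * 2 ^ a n⌋₊)) ?_ ?_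
    (fun n => target (a n)) m (fun n hn => ?_) fun n hn => ?_)
  · exact fun n n' h => Set.image_mono fun e he => monotone_openWindow ht (hmono h) he
  · exact fun n => Set.image_mono fun e he => openWindow_subset_openAt ht _ he
  · by_contra h
    exact (hm n hn).1 ⟨_, hlt _, h⟩
  · by_contra h
    exact (hm n hn).2 ⟨_, hlt _, h⟩

/-! ### Exceptional times -/

theorem measureReal_not_itemOpen_openAt (a : ℕ → ℕ) (n : ℕ) (i : List Bool) {t : ℝ} (ht : 0 ≤ t) :
    (Measure.infinitePi fun _ : Label => trackLaw crit).real
      {ξ | ¬ ItemOpen a {l | ξ l ∈ openAt t} n 1 i} = critDead (a n) := by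
  have hm := measurableSet_itemOpen measurableSet_mem_openLabels a n 1 i
  rw [measure_labels_eq (trackLaw crit) (measurableSet_openAt t) crit (trackLaw_real_openAt crit ht)
    (P := fun S => ¬ ItemOpen a S n 1 i) hm.compl]
  change (labelMeasure crit).real {ξ | ItemOpen a (openLabels ξ) n 1 i}ᶜ = _
  rw [probReal_compl_eq_one_sub hm, labelMeasure_itemOpen_one, critDead]
  ring

/-- The probability that the trees of an item are alive and that its bottleneck edge is in a
state of `o`. -/
theorem measureReal_bottleneck_inter (a : ℕ → ℕ) (n : ℕ) (i : List Bool) {t : ℝ} {o : Set Track}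
    (ho : MeasurableSet o) :
    (Measure.infinitePi fun _ : Label => trackLaw crit).real
      ({ξ | ξ ((n, true, i), false) ∈ o} ∩
        {ξ | ∀ s, 1 ≤ (reached {l | ξ l ∈ openAt t} n s (depth (a n)) i).card})
      = (trackLaw crit).real o * (Measure.infinitePi fun _ : Label => trackLaw crit).real
        {ξ | ∀ s, 1 ≤ (reached {l | ξ l ∈ openAt t} n s (depth (a n)) i).card} := by
  have hR : ∀ l : Label, MeasurableSet {ξ : Label → Track | l ∈ {l | ξ l ∈ openAt t}} := fun l =>
    measurable_pi_apply l (measurableSet_openAt t)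
  have hm : MeasurableSet {ξ : Label → Track |
      ∀ s, 1 ≤ (reached {l | ξ l ∈ openAt t} n s (depth (a n)) i).card} := by
    rw [Set.ofPred_forall]
    exact MeasurableSet.iInter fun s => measurable_card_reached hR n s _ i measurableSet_Ici
  have hd : DependsOn (fun ξ : Label → Track => ξ ∈ {ξ : Label → Track |
      ∀ s, 1 ≤ (reached {l | ξ l ∈ openAt t} n s (depth (a n)) i).card})
      {l | ∃ s, l ∈ treeLabels n s i} := by
    refine LocalOn.dependsOn (f := fun S => ∀ s, 1 ≤ (reached S n s (depth (a n)) i).card)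
      (fun S T h => ?_) (openAt t)
    have hr : ∀ s, reached S n s (depth (a n)) i = reached T n s (depth (a n)) i := fun s =>
      localOn_reached n s _ i S T fun l hl => h l ⟨s, hl⟩
    simp only [hr]
  have ho' : MeasurableSet {ξ : Label → Track | ξ ((n, true, i), false) ∈ o} :=
    measurable_pi_apply _ ho
  have hlaw := (measurePreserving_eval_infinitePi (fun _ : Label => trackLaw crit)
    ((n, true, i), false)).measure_preimage ho.nullMeasurableSet
  rw [measureReal_def, measure_inter_of_dependsOn (trackLaw crit) ho' hm
    (s := {((n, true, i), false)}) (fun ξ ξ' h => by simp [h _ rfl]) hd, ENNReal.toReal_mul,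
    measureReal_def, measureReal_def, ← hlaw]
  · rfl
  · rw [Set.disjoint_singleton_left]
    rintro ⟨s, hs⟩
    exact notMem_treeLabels n true s i hs

/-- The probability that an item is closed at two times: its bottleneck edge may open between
these times. -/
theorem measureReal_not_itemOpen_inter_le (a : ℕ → ℕ) (n : ℕ) (i : List Bool) {s t : ℝ}
    (hs : 0 ≤ s) (hst : s ≤ t) (hts : t ≤ s + 1) :
    (Measure.infinitePi fun _ : Label => trackLaw crit).real
      ({ξ | ¬ ItemOpen a {l | ξ l ∈ openAt s} n 1 i} ∩
        {ξ | ¬ ItemOpen a {l | ξ l ∈ openAt t} n 1 i})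
      ≤ critDead (a n) * Real.exp (-((t - s) / 1000)) := by
  set μ := Measure.infinitePi fun _ : Label => trackLaw crit with hμ
  set T : Set (Label → Track) :=
    {ξ | ∀ s, 1 ≤ (reached {l | ξ l ∈ openAt t} n s (depth (a n)) i).card} with hT
  set D : ℝ → Set (Label → Track) := fun r => {ξ | ¬ ItemOpen a {l | ξ l ∈ openAt r} n 1 i} with hD
  have hDm : ∀ r, MeasurableSet (D r) := fun r => (measurableSet_itemOpen (fun l =>
    measurable_pi_apply l (measurableSet_openAt r)) a n 1 i).compl
  have hDs : ∀ {r : ℝ}, 0 ≤ r → μ.real (D r) = critDead (a n) := fun hr =>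
    measureReal_not_itemOpen_openAt a n i hr
  have hu := critDead_le (a n)
  have hu0 := critDead_pos (a n)
  have halive : 1 / 2 ≤ μ.real T := by
    have h1 := measureReal_bottleneck_inter a n i (t := t) (measurableSet_openAt t)
    rw [trackLaw_real_openAt crit (hs.trans hst), ← hμ, ← hT] at h1
    have h2 : {ξ : Label → Track | ξ ((n, true, i), false) ∈ openAt t} ∩ T = (D t)ᶜ := by
      ext ξ
      exact not_not.symm
    rw [h2, probReal_compl_eq_one_sub (hDm t), hDs (hs.trans hst), coe_crit] at h1
    linarith [measureReal_nonneg (μ := μ) (s := T)]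
  -- the item is closed at time `s` and open at time `t` as soon as this holds for the bottleneck
  -- edge and the trees are alive at time `t`
  have hflip : (t - s) / 1000 ≤ μ.real (D s \ D t) := by
    have ho : MeasurableSet {x | x ∉ openAt s ∧ x ∈ openAt t} :=
      (measurableSet_openAt s).compl.inter (measurableSet_openAt t)
    have h1 := measureReal_bottleneck_inter a n i (t := t) ho
    have h2 : {ξ : Label → Track | ξ ((n, true, i), false) ∈ {x | x ∉ openAt s ∧ x ∈ openAt t}} ∩ T
        ⊆ D s \ D t := by
      rintro ξ ⟨⟨h3, h4⟩, h5⟩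
      exact ⟨fun h => h3 h.1, not_not.2 ⟨h4, h5⟩⟩
    have h3 := measureReal_mono h2 (measure_ne_top μ _)
    rw [h1] at h3
    have h4 := le_trackLaw_real_closed_open crit hs hst
    rw [coe_crit] at h4
    -- `1 - exp (-x) ≥ x / 2` for `x ≤ 1`
    have h5 : (t - s) / 2 ≤ 1 - Real.exp (-(t - s)) := by
      have h6 := Real.add_one_le_exp (t - s)
      have h7 : Real.exp (-(t - s)) * Real.exp (t - s) = 1 := by
        rw [← Real.exp_add]; simp
      have h8 := Real.exp_pos (-(t - s))
      by_contra! h9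
      nlinarith
    have h6 : 199 / 40000 * ((t - s) / 2) ≤
        (trackLaw crit).real {x | x ∉ openAt s ∧ x ∈ openAt t} := by
      refine le_trans ?_ h4
      linarith
    have h7 := mul_le_mul h6 halive (by norm_num) measureReal_nonneg
    linarith
  have hsplit := measureReal_inter_add_sdiff (μ := μ) (s := D s) (hDm t)
  rw [hDs hs] at hsplit
  have hexp := Real.add_one_le_exp (-((t - s) / 1000))
  have h1 : critDead (a n) * (-((t - s) / 1000) + 1) ≤
      critDead (a n) * Real.exp (-((t - s) / 1000)) := mul_le_mul_of_nonneg_left hexp hu0.le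
  change μ.real (D s ∩ D t) ≤ _
  nlinarith

theorem measurableSet_gapClosed_openAt (a : ℕ → ℕ) (n : ℕ) (t : ℝ) :
    MeasurableSet {ω : History (chainGraph a) | GapClosed a (labelsIn ω (openAt t)) n} :=
  measurableSet_gapClosed (measurableSet_mem_labelsIn (measurableSet_openAt t)) a n

theorem dynMeasure_gapClosed (a : ℕ → ℕ) (n : ℕ) {t : ℝ} (ht : 0 ≤ t) :
    (dynMeasure (chainGraph a) crit).real {ω | GapClosed a (labelsIn ω (openAt t)) n}
      = critDead (a n) ^ 2 ^ a n :=
  measureReal_gapClosed a (trackLaw crit) (measurableSet_openAt t) crit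
    (trackLaw_real_openAt crit ht) n

/-- The events that a gap is closed decorrelate at the time scale `2 ^ (-a n)`. -/
theorem dynMeasure_gapClosed_inter_le (a : ℕ → ℕ) (n : ℕ) {s t : ℝ}
    (hs : 0 ≤ s) (hst : s ≤ t) (hts : t ≤ s + 1) :
    (dynMeasure (chainGraph a) crit).real
      ({ω | GapClosed a (labelsIn ω (openAt s)) n} ∩ {ω | GapClosed a (labelsIn ω (openAt t)) n})
      ≤ critDead (a n) ^ 2 ^ a n * Real.exp (-((t - s) / 1000)) ^ 2 ^ a n := by
  have h1 := measure_edges_eq a (trackLaw crit) ((measurableSet_gapClosed_openAt a n s).inter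
    (measurableSet_gapClosed_openAt a n t))
  set E : List Bool → Set (Label → Track) := fun i =>
    {ξ | ¬ ItemOpen a {l | ξ l ∈ openAt s} n 1 i} ∩
      {ξ | ¬ ItemOpen a {l | ξ l ∈ openAt t} n 1 i} with hE
  have h2 := measureReal_forall_item (trackLaw crit) n (a n) E
    (fun i => ((measurableSet_itemOpen (fun l => measurable_pi_apply l (measurableSet_openAt s))
      a n 1 i).compl).inter ((measurableSet_itemOpen (fun l =>
        measurable_pi_apply l (measurableSet_openAt t)) a n 1 i).compl)) fun i ξ ξ' h => by
      have h3 := dependsOn_not_itemOpen a n 1 i (openAt s) (x := ξ) (y := ξ') h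
      have h4 := dependsOn_not_itemOpen a n 1 i (openAt t) (x := ξ) (y := ξ') h
      simp only [hE, Set.mem_inter_iff] at h3 h4 ⊢
      rw [h3, h4]
  refine h1.trans_le (le_trans (le_of_eq ?_) (h2.trans_le ?_))
  · congr 1
    ext ξ
    have hj : ∀ r, GapClosed a (labelsIn (fun e : (chainGraph a).edgeSet => ξ (label e)) (openAt r))
        n ↔ GapClosed a {l | ξ l ∈ openAt r} n := by
      intro r
      rw [labelsIn_comp_label]
      exact ignoresJunk_gapClosed a n _
    refine (and_congr (hj s) (hj t)).trans ?_
    exact ⟨fun h i hi => ⟨h.1 i hi, h.2 i hi⟩, fun h => ⟨fun i hi => (h i hi).1,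
      fun i hi => (h i hi).2⟩⟩
  · rw [← mul_pow, ← card_words (a n)]
    exact (Finset.prod_le_prod (fun _ _ => measureReal_nonneg) fun i _ =>
      measureReal_not_itemOpen_inter_le a n i hs hst hts).trans_eq (Finset.prod_const _)

theorem sum_pow_sub_le {r : ℝ} (hr0 : 0 ≤ r) (hr : r ≤ 1 / 3) (j : ℕ) :
    ∑ i ∈ Finset.range j, r ^ (j - i) ≤ 1 / 2 := by
  induction j with
  | zero => simp
  | succ j ih =>
    have h : ∑ i ∈ Finset.range (j + 1), r ^ (j + 1 - i)
        = r * (∑ i ∈ Finset.range j, r ^ (j - i) + 1) := by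
      rw [Finset.sum_range_succ, mul_add, Finset.mul_sum, mul_one, Nat.add_sub_cancel_left,
        pow_one]
      congr 1
      refine Finset.sum_congr rfl fun i hi => ?_
      rw [← pow_succ', Nat.sub_add_comm (Finset.mem_range.1 hi).le]
    rw [h]
    have h0 : 0 ≤ ∑ i ∈ Finset.range j, r ^ (j - i) :=
      Finset.sum_nonneg fun i _ => pow_nonneg hr0 _
    nlinarith

theorem dependsOn_exists_gapClosed (a : ℕ → ℕ) (n : ℕ) (T : Set ℝ) :
    DependsOn (fun ω : History (chainGraph a) => ∃ t ∈ T, GapClosed a (labelsIn ω (openAt t)) n)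
      {e | label e ∈ gapLabels n} := by
  intro ω ω' h
  have h1 : ∀ t, GapClosed a (labelsIn ω (openAt t)) n = GapClosed a (labelsIn ω' (openAt t)) n :=
    fun t => dependsOn_gapClosed a (openAt t) n h
  simp only [h1]

/-- The times, at distance `2000 * 2 ^ (-k)` from each other in an interval of length `h`, at which
a gap with `2 ^ k` items is inspected. At this distance the correlations are small. -/
noncomputable def inspectionTimes (s h : ℝ) (k : ℕ) : Set ℝ :=
  {t | ∃ j < ⌊h * 2 ^ k / 2000⌋₊, t = s + j * (2000 / 2 ^ k)}

theorem inspectionTimes_subset {s h : ℝ} (hh : 0 ≤ h) (k : ℕ) :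
    inspectionTimes s h k ⊆ Set.Icc s (s + h) := by
  rintro _ ⟨j, hj, rfl⟩
  have h1 : (j : ℝ) ≤ h * 2 ^ k / 2000 :=
    (Nat.cast_le.2 hj.le).trans (Nat.floor_le (by positivity))
  have h2 : (j : ℝ) * (2000 / 2 ^ k) ≤ h * 2 ^ k / 2000 * (2000 / 2 ^ k) := by gcongr
  have h3 : h * 2 ^ k / 2000 * (2000 / 2 ^ k) = h := by field_simp
  have h4 : 0 ≤ (j : ℝ) * (2000 / 2 ^ k) := by positivity
  constructor <;> linarith

theorem setOf_exists_inspectionTimes (a : ℕ → ℕ) (n : ℕ) (s h : ℝ) (k : ℕ) :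
    {ω : History (chainGraph a) | ∃ t ∈ inspectionTimes s h k,
      GapClosed a (labelsIn ω (openAt t)) n}
      = ⋃ j ∈ Finset.range ⌊h * 2 ^ k / 2000⌋₊,
        {ω | GapClosed a (labelsIn ω (openAt (s + j * (2000 / 2 ^ k)))) n} := by
  ext ω
  simp only [inspectionTimes, Set.mem_ofPred_eq, Set.mem_iUnion, Finset.mem_range, exists_prop]
  constructor
  · rintro ⟨_, ⟨j, hj, rfl⟩, h⟩
    exact ⟨j, hj, h⟩
  · rintro ⟨j, hj, h⟩
    exact ⟨_, ⟨j, hj, rfl⟩, h⟩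

theorem le_dynMeasure_exists_gapClosed (a : ℕ → ℕ) (n : ℕ) {s h : ℝ} (hs : 0 ≤ s) (hh : 0 ≤ h)
    (hh1 : h ≤ 1) :
    ⌊h * 2 ^ a n / 2000⌋₊ * (critDead (a n) ^ 2 ^ a n / 2) ≤ (dynMeasure (chainGraph a) crit).real
      {ω | ∃ t ∈ inspectionTimes s h (a n), GapClosed a (labelsIn ω (openAt t)) n} := by
  rw [setOf_exists_inspectionTimes]
  set δ : ℝ := 2000 / 2 ^ a n with hδ
  have hδ0 : 0 ≤ δ := by positivity
  refine le_measureReal_biUnion_range _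
    (fun j : ℕ => {ω : History (chainGraph a) | GapClosed a (labelsIn ω (openAt (s + j * δ))) n})
    (fun j => measurableSet_gapClosed_openAt a n _) _
    (fun j => dynMeasure_gapClosed a n (by positivity)) fun j hj => ?_
  have hpow : 0 ≤ critDead (a n) ^ 2 ^ a n := pow_nonneg (critDead_pos _).le _
  have hr : Real.exp (-2) ≤ 1 / 3 := by
    have h1 := Real.add_one_le_exp (2 : ℝ)
    rw [Real.exp_neg, ← one_div]
    exact one_div_le_one_div_of_le (by norm_num) (by linarith)
  have hterm : ∀ i ∈ Finset.range j, (dynMeasure (chainGraph a) crit).real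
      ({ω | GapClosed a (labelsIn ω (openAt (s + i * δ))) n} ∩
        {ω | GapClosed a (labelsIn ω (openAt (s + j * δ))) n})
      ≤ critDead (a n) ^ 2 ^ a n * Real.exp (-2) ^ (j - i) := by
    intro i hi
    have hij : i ≤ j := (Finset.mem_range.1 hi).le
    have h1 : (i : ℝ) * δ ≤ j * δ := by gcongr
    have h2 := (inspectionTimes_subset (s := s) hh (a n) ⟨j, hj, rfl⟩).2
    have h3 : 0 ≤ (i : ℝ) * δ := by positivity
    refine (dynMeasure_gapClosed_inter_le a n (by positivity) (by linarith)
      (by linarith)).trans_eq ?_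
    rw [← Real.exp_nat_mul, ← Real.exp_nat_mul, Nat.cast_sub hij, hδ]
    congr 2
    push_cast
    field_simp
    ring
  refine (Finset.sum_le_sum hterm).trans ?_
  rw [← Finset.mul_sum]
  have h1 := mul_le_mul_of_nonneg_left (sum_pow_sub_le (Real.exp_pos (-2)).le hr j) hpow
  linarith

open Filter in
/-- In every time interval, infinitely many gaps get closed. -/
theorem ae_frequently_exists_gapClosed {s h : ℝ} (hs : 0 ≤ s) (hh : 0 < h) (hh1 : h ≤ 1) :
    ∀ᵐ ω ∂dynMeasure (chainGraph (gapSeq 2)) crit, ∃ᶠ n in atTop,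
      ∃ t ∈ Set.Icc s (s + h), GapClosed (gapSeq 2) (labelsIn ω (openAt t)) n := by
  set a := gapSeq 2 with ha
  set B : ℕ → Set (History (chainGraph a)) := fun n =>
    {ω | ∃ t ∈ inspectionTimes s h (a n), GapClosed a (labelsIn ω (openAt t)) n} with hB
  have hm : ∀ n, MeasurableSet (B n) := by
    intro n
    simp only [hB, setOf_exists_inspectionTimes]
    exact Finset.measurableSet_biUnion _ fun j _ => measurableSet_gapClosed_openAt a n _
  have hns : ¬ Summable fun n => (dynMeasure (chainGraph a) crit).real (B n) := by
    intro hsum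
    refine not_summable_gapSeq (β := 2) two_pos
      (g := fun k => h / 8000 * 2 ^ k * critDead k ^ 2 ^ k) (c := h / 8000)
      (fun k => mul_nonneg (by positivity) (pow_nonneg (critDead_pos k).le _)) (by positivity)
      (.of_forall fun k => le_rfl) ?_
    refine Summable.of_norm_bounded_eventually_nat hsum ?_
    have h1 : ∀ᶠ k : ℕ in atTop, 4000 / h ≤ 2 ^ k :=
      (tendsto_pow_atTop_atTop_of_one_lt one_lt_two).eventually_ge_atTop _
    filter_upwards [(tendsto_gapSeq (β := 2) two_pos).eventually h1] with n hn
    have hp : 0 ≤ critDead (a n) ^ 2 ^ a n := pow_nonneg (critDead_pos _).le _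
    rw [Real.norm_of_nonneg (mul_nonneg (by positivity) hp)]
    refine le_trans ?_ (le_dynMeasure_exists_gapClosed a n hs hh.le hh1)
    rw [div_le_iff₀ hh] at hn
    have h2 := Nat.lt_floor_add_one (h * 2 ^ a n / 2000)
    have h3 : h / 8000 * 2 ^ a n ≤ ⌊h * 2 ^ a n / 2000⌋₊ / 2 := by linarith
    calc _ ≤ (⌊h * 2 ^ a n / 2000⌋₊ / 2 : ℝ) * critDead (a n) ^ 2 ^ a n :=
          mul_le_mul_of_nonneg_right h3 hp
      _ = _ := by ring
  have hae := ae_frequently_mem_of_not_summable (μ := dynMeasure (chainGraph a) crit) hm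
    (iIndepSet_of_gapLabels a (trackLaw crit) hm fun n =>
      dependsOn_exists_gapClosed a n (inspectionTimes s h (a n))) hns
  filter_upwards [hae] with ω hω
  refine hω.mono fun n hn => ?_
  obtain ⟨t, ht, hc⟩ := hn
  exact ⟨t, inspectionTimes_subset hh.le _ ht, hc⟩

/-- If each edge is closed on an open set of times, then so is each gap. -/
theorem isOpen_gapClosed {R : ℝ → Set Label} (hR : ∀ l, IsClosed {t | l ∈ R t}) (a : ℕ → ℕ)
    (n : ℕ) : IsOpen {t | GapClosed a (R t) n} := by
  have hpath : ∀ (s : Bool) (y w : List Bool), IsClosed {t | PathOpen (R t) n s y w} := by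
    intro s y w
    induction y with
    | nil => simp [PathOpen]
    | cons b y ih => exact (hR _).inter ih
  have hreach : ∀ (s : Bool) (d : ℕ) (w : List Bool),
      IsClosed {t | 1 ≤ (reached (R t) n s d w).card} := by
    intro s d w
    have : {t | 1 ≤ (reached (R t) n s d w).card}
        = ⋃ y ∈ words d, {t | PathOpen (R t) n s y w} := by
      ext t
      simp only [Set.mem_ofPred_eq, Set.mem_iUnion, Nat.one_le_iff_ne_zero, ← Nat.pos_iff_ne_zero,
        Finset.card_pos, Finset.Nonempty, mem_reached, mem_words, exists_prop]
    rw [this]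
    exact isClosed_biUnion_finset fun y _ => hpath s y w
  have hitem : ∀ i, IsClosed {t | ItemOpen a (R t) n 1 i} := by
    intro i
    refine (hR _).inter ?_
    change IsClosed {t | ∀ s, 1 ≤ (reached (R t) n s (depth (a n)) i).card}
    rw [Set.ofPred_forall]
    exact isClosed_iInter fun s => hreach s _ i
  have : {t | GapClosed a (R t) n} = (⋃ i ∈ words (a n), {t | ItemOpen a (R t) n 1 i})ᶜ := by
    ext t
    simp [GapClosed, mem_words]
  rw [this, isOpen_compl_iff]
  exact isClosed_biUnion_finset fun i _ => hitem i

theorem isClosed_openTimes {a : ℕ → ℕ} {ω : History (chainGraph a)}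
    (hω : ∀ e, ω e ∈ regularTracks) (l : Label) : IsClosed {t | l ∈ labelsIn ω (openAt t)} := by
  by_cases h : ∃ e : (chainGraph a).edgeSet, label e = l
  · obtain ⟨e, rfl⟩ := h
    have : {t | label e ∈ labelsIn ω (openAt t)} = {t | ω e ∉ openAt t}ᶜ := by
      ext t
      refine Iff.trans ?_ not_not.symm
      exact ⟨fun ⟨e', h, he⟩ => label_injective he ▸ h, fun h => ⟨e, h, rfl⟩⟩
    rw [this, isClosed_compl_iff]
    exact isOpen_closedTimes (hω e)
  · have : {t | l ∈ labelsIn ω (openAt t)} = ∅ := by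
      ext t
      simp only [Set.mem_ofPred_eq, Set.mem_empty_iff_false, iff_false]
      exact fun ⟨e, _, he⟩ => h ⟨e, he⟩
    rw [this]
    exact isClosed_empty

theorem ae_forall_mem_regularTracks (a : ℕ → ℕ) (p : I) :
    ∀ᵐ ω ∂dynMeasure (chainGraph a) p, ∀ e, ω e ∈ regularTracks := by
  have : Countable (chainGraph a).edgeSet := (label_injective (a := a)).countable
  refine ae_all_iff.2 fun e => ?_
  exact (measurePreserving_eval_infinitePi (fun _ : (chainGraph a).edgeSet => trackLaw p)
    e).quasiMeasurePreserving.ae (ae_mem_regularTracks p)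

open Filter in
/-- By the Baire category theorem, there is a time at which infinitely many gaps are closed. -/
theorem ae_exists_notMem_percolatesAt : ∀ᵐ ω ∂dynMeasure (chainGraph (gapSeq 2)) crit,
    ∃ t : ℝ, 0 ≤ t ∧ ω ∉ percolatesAt (chainGraph (gapSeq 2)) t := by
  set a := gapSeq 2 with ha
  have hfreq : ∀ᵐ ω ∂dynMeasure (chainGraph a) crit, ∀ (q : ℚ) (m : ℕ), (0 : ℝ) ≤ q →
      ∃ᶠ n in atTop, ∃ t ∈ Set.Icc (q : ℝ) (q + 1 / (m + 1)),
        GapClosed a (labelsIn ω (openAt t)) n := by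
    refine ae_all_iff.2 fun q => ae_all_iff.2 fun m => ?_
    by_cases hq : (0 : ℝ) ≤ q
    swap
    · exact .of_forall fun _ h => absurd h hq
    have hm : (1 : ℝ) / (m + 1) ≤ 1 := by
      rw [div_le_one (by positivity)]
      linarith [(Nat.cast_nonneg m : (0 : ℝ) ≤ m)]
    filter_upwards [ae_frequently_exists_gapClosed hq (by positivity) hm] with ω hω _
    exact hω
  filter_upwards [hfreq, ae_forall_mem_regularTracks a crit] with ω hω hreg
  -- the negative times are added in order to obtain dense sets
  set U : ℕ → Set ℝ := fun N =>
    Set.Iio 0 ∪ ⋃ n ≥ N, {t | GapClosed a (labelsIn ω (openAt t)) n} with hU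
  have hUo : ∀ N, IsOpen (U N) := fun N => isOpen_Iio.union
    (isOpen_iUnion fun n => isOpen_iUnion fun _ =>
      isOpen_gapClosed (isClosed_openTimes hreg) a n)
  have hUd : ∀ N, Dense (U N) := by
    intro N
    refine Metric.dense_iff.2 fun x r hr => ?_
    rcases lt_or_ge x 0 with hx | hx
    · exact ⟨x, Metric.mem_ball_self hr, Or.inl hx⟩
    obtain ⟨q, hq1, hq2⟩ := exists_rat_btwn (show x < x + r / 2 by linarith)
    obtain ⟨m, hm⟩ := exists_nat_one_div_lt (show 0 < r / 2 by linarith)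
    obtain ⟨n, hn, t, ht, hc⟩ := frequently_atTop.1 (hω q m (hx.trans hq1.le)) N
    refine ⟨t, ?_, Or.inr (Set.mem_biUnion hn hc)⟩
    rw [Real.ball_eq_Ioo]
    constructor <;> linarith [ht.1, ht.2]
  obtain ⟨t, ht, ht'⟩ := (dense_iInter_of_isOpen_nat hUo hUd).inter_open_nonempty (Set.Ioi 0)
    isOpen_Ioi ⟨1, Set.mem_Ioi.2 one_pos⟩
  have ht0 : (0 : ℝ) < t := ht
  refine ⟨t, ht0.le, fun hperc => ?_⟩
  refine not_exists_infinite_component (fun N => ?_) ((hasInfiniteCluster_iff ω (openAt t)).1 hperc)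
  rcases Set.mem_iInter.1 ht' N with h | h
  · exact absurd h (not_lt.2 ht0.le)
  · obtain ⟨n, hn, h⟩ := Set.mem_iUnion₂.1 h
    exact ⟨n, hn, h⟩

end Percolation

open Percolation in
theorem theorem1p1 :
    (∃ (V : Type) (G : SimpleGraph V), Infinite V ∧ G.Connected ∧ BoundedDegree G ∧
      0 < criticalProb G ∧ criticalProb G < 1 ∧
      ∀ᵐ ω ∂(dynMeasure G (criticalProb G)), ∀ t : ℝ, 0 ≤ t → ω ∈ percolatesAt G t) ∧
    (∃ (V : Type) (G : SimpleGraph V), Infinite V ∧ G.Connected ∧ BoundedDegree G ∧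
      0 < criticalProb G ∧ criticalProb G < 1 ∧
      bondMeasure G (criticalProb G) (percolates G) = 1 ∧
      ∀ᵐ ω ∂(dynMeasure G (criticalProb G)), ∃ t : ℝ, 0 ≤ t ∧ ω ∉ percolatesAt G t) := by
  have h0 : 0 < crit := by
    rw [← Subtype.coe_lt_coe, coe_crit]; norm_num
  have h1 : crit < 1 := by
    rw [← Subtype.coe_lt_coe, coe_crit]; norm_num
  have hc : ∀ {β : ℝ}, 1 < β → β ≤ 4 → criticalProb (chainGraph (gapSeq β)) = crit :=
    criticalProb_chainGraph
  refine ⟨⟨Vert (gapSeq 4), chainGraph (gapSeq 4), infinite_vert _, connected_chainGraph _,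
    boundedDegree_chainGraph _, ?_⟩, ⟨Vert (gapSeq 2), chainGraph (gapSeq 2), infinite_vert _,
    connected_chainGraph _, boundedDegree_chainGraph _, ?_⟩⟩
  · rw [hc (by norm_num) le_rfl]
    exact ⟨h0, h1, ae_forall_percolatesAt⟩
  · rw [hc (by norm_num) (by norm_num)]
    refine ⟨h0, h1, ?_, ae_exists_notMem_percolatesAt⟩
    have h := ae_mem_percolates (β := 2) (by norm_num) (by norm_num) le_rfl
    exact (measure_congr (Filter.eventuallyEq_univ.2 h)).trans measure_univ
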